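/- Let $(M,g,J,\Omega)$ be a connected smooth almost Kähler $4$-manifold: $g$ is a Riemannian metric, $J$ is a smooth $g$-orthogonal almost complex structure, and $\Omega(X,Y)=g(JX,Y)$ is closed. Suppose that $(g,J)$ is not Kähler (that is, $J$ is not integrable) and that its curvature tensor satisfies the second Gray condition $$G_2:\qquad R_{XYZW}-R_{JXJYZW}=R_{JXYJZW}+R_{JXYZJW}\quad\text{for all } X,Y,Z,W .$$ Let $\nabla$ be the Levi-Civita connection, and orient $M$ by $J$, so that $\tfrac12\Omega\wedge\Omega$ is the volume form. Let $\mathrm{Ric}_0=\mathrm{Ric}-\frac s4 g$ be the traceless Ricci tensor, $W^+$ and $W^-$ the self-dual and anti-self-dual parts of the Weyl tensor, and $\kappa=3\langle W^+(\Omega),\Omega\rangle$ the conformal scalar curvature, where two-forms carry the inner product with $|\Omega|^2=2$ and the curvature operator is positive on round spheres. Then the Kähler nullity $\mathcal D=\{X\in TM\mid\nabla_XJ=0\}$ has rank $2$ at every point, and the following hold. (i) $\mathrm{Ric}_0=\dfrac{\kappa}{4}\bigl[-g^{\mathcal D}+g^{\mathcal D^\perp}\bigr]$, where $g^{\mathcal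 D}$ and $g^{\mathcal D^\perp}$ are the restrictions of $g$ to $\mathcal D$ and $\mathcal D^\perp$ (extended by zero on the orthogonal complement). (ii) Let $\bar J$ be equal to $J$ on $\mathcal D$ and to $-J$ on $\mathcal D^\perp$, and let $\bar\Omega(X,Y)=g(\bar JX,Y)$. Then $\bar J$ induces the reversed orientation of $M$, the triple $(g,\bar J,\bar\Omega)$ is an almost Kähler structure (in particular $\bar J$ is smooth), the Ricci tensor is $\bar J$-invariant, and $W_2^-=0$. Here $W^-_2$ is the part of $W^-$, as an endomorphism of $\Lambda^-M=\mathbb R\bar\Omega\oplus\Lambda^{\mathrm{anti}}_{\bar J}M$, that exchanges the two summands, $\Lambda^{\mathrm{anti}}_{\bar J}M$ being the bundle of $\bar J$-anti-invariant two-forms. Moreover $\nabla_X\bar J=0$ for all $X\in\mathcal D^\perp$, that is, $\mathcal D^\perp$ lies in the Kähler nullity of $(g,\bar J,\bar\Omega)$. -/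

import Mathlib

open Bundle VectorField FiberBundle
open scoped Manifold ContDiff

noncomputable section

namespace AKFour

section LeviCivita

variable {E : Type*} [NormedAddCommGroup E] [NormedSpace ℝ E]
  {H : Type*} [TopologicalSpace H] {I : ModelWithCorners ℝ E H}
  {M : Type*} [TopologicalSpace M] [ChartedSpace H M]

instance (x : M) [FiniteDimensional ℝ E] : FiniteDimensional ℝ (TangentSpace I x) :=
  inferInstanceAs (FiniteDimensional ℝ E)

variable [IsManifold I 2 M] [RiemannianBundle (fun x : M => TangentSpace I x)]

/-- The Koszul expression of three vector fields; it is `2 g(∇_X Y, Z)` for the Levi-Civita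
connection `∇`. -/
def koszul (X Y Z : Π x : M, TangentSpace I x) (x : M) : ℝ :=
  d% (fun y => inner ℝ (Y y) (Z y)) x (X x) + d% (fun y => inner ℝ (Z y) (X y)) x (Y x)
    - d% (fun y => inner ℝ (X y) (Y y)) x (Z x)
    + inner ℝ (mlieBracket I X Y x) (Z x) - inner ℝ (mlieBracket I Y Z x) (X x)
    + inner ℝ (mlieBracket I Z X x) (Y x)

theorem endomorphism_ext {x : M} {A B : TangentSpace I x →L[ℝ] TangentSpace I x}
    (h : ∀ X Z : Π x : M, TangentSpace I x, MDiffAt (T% X) x → MDiffAt (T% Z) x →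
      (inner ℝ (A (X x)) (Z x) : ℝ) = inner ℝ (B (X x)) (Z x)) : A = B := by
  ext1 u
  refine ext_inner_right ℝ fun w => ?_
  simpa using h (extend E u) (extend E w) (mdifferentiableAt_extend ..)
    (mdifferentiableAt_extend ..)

variable [IsContMDiffRiemannianBundle I 1 E (fun x : M => TangentSpace I x)]

theorem mdiffAt_inner {X Y : Π x : M, TangentSpace I x} {x : M}
    (hX : MDiffAt (T% X) x) (hY : MDiffAt (T% Y) x) :
    MDiffAt (fun y => (inner ℝ (X y) (Y y) : ℝ)) x :=
  MDifferentiableAt.inner_bundle (IB := I) (F := E) (E := fun x : M => TangentSpace I x)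
    (b := fun x => x) hX hY

theorem d_inner_smul_left {f : M → ℝ} {X Y : Π x : M, TangentSpace I x} {x : M}
    (hf : MDiffAt f x) (hX : MDiffAt (T% X) x) (hY : MDiffAt (T% Y) x) (v : TangentSpace I x) :
    d% (fun y => (inner ℝ ((f • X) y) (Y y) : ℝ)) x v
      = f x * d% (fun y => (inner ℝ (X y) (Y y) : ℝ)) x v + d% f x v * inner ℝ (X x) (Y x) := by
  simp [inner_smul_left, mvfderiv_fun_mul hf (mdiffAt_inner hX hY)]
  ring

theorem d_inner_smul_right {f : M → ℝ} {X Y : Π x : M, TangentSpace I x} {x : M}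
    (hf : MDiffAt f x) (hX : MDiffAt (T% X) x) (hY : MDiffAt (T% Y) x) (v : TangentSpace I x) :
    d% (fun y => (inner ℝ (X y) ((f • Y) y) : ℝ)) x v
      = f x * d% (fun y => (inner ℝ (X y) (Y y) : ℝ)) x v + d% f x v * inner ℝ (X x) (Y x) := by
  simp [inner_smul_right, mvfderiv_fun_mul hf (mdiffAt_inner hX hY)]
  ring

theorem d_inner_add_left {X X' Y : Π x : M, TangentSpace I x} {x : M} (hX : MDiffAt (T% X) x)
    (hX' : MDiffAt (T% X') x) (hY : MDiffAt (T% Y) x) (v : TangentSpace I x) :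
    d% (fun y => (inner ℝ ((X + X') y) (Y y) : ℝ)) x v
      = d% (fun y => (inner ℝ (X y) (Y y) : ℝ)) x v
        + d% (fun y => (inner ℝ (X' y) (Y y) : ℝ)) x v := by
  simp [inner_add_left, mvfderiv_fun_add (mdiffAt_inner hX hY) (mdiffAt_inner hX' hY)]

theorem d_inner_add_right {X Y Y' : Π x : M, TangentSpace I x} {x : M} (hX : MDiffAt (T% X) x)
    (hY : MDiffAt (T% Y) x) (hY' : MDiffAt (T% Y') x) (v : TangentSpace I x) :
    d% (fun y => (inner ℝ (X y) ((Y + Y') y) : ℝ)) x v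
      = d% (fun y => (inner ℝ (X y) (Y y) : ℝ)) x v
        + d% (fun y => (inner ℝ (X y) (Y' y) : ℝ)) x v := by
  simp [inner_add_right, mvfderiv_fun_add (mdiffAt_inner hX hY) (mdiffAt_inner hX hY')]

variable [FiniteDimensional ℝ E]

theorem koszul_tensorial_left {x : M} {Y : Π x : M, TangentSpace I x} (hY : MDiffAt (T% Y) x)
    (Z : Π x : M, TangentSpace I x) (hZ : MDiffAt (T% Z) x) :
    TensorialAt I E (fun X => koszul X Y Z x) x where
  smul {f X} hf hX := by
    simp only [koszul, d_inner_smul_left hf hX hY, d_inner_smul_right hf hZ hX,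
      mlieBracket_smul_left hf hX, mlieBracket_smul_right hf hX]
    simp [inner_smul_left, inner_smul_right, inner_add_left, real_inner_comm (X x) (Z x)]
    ring
  add {X X'} hX hX' := by
    simp only [koszul, d_inner_add_left hX hX' hY, d_inner_add_right hZ hX hX',
      mlieBracket_add_left hX hX', mlieBracket_add_right hX hX']
    simp [inner_add_left, inner_add_right]
    ring

theorem koszul_tensorial_right {x : M} {Y : Π x : M, TangentSpace I x} (hY : MDiffAt (T% Y) x)
    (X : Π x : M, TangentSpace I x) (hX : MDiffAt (T% X) x) :
    TensorialAt I E (fun Z => koszul X Y Z x) x where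
  smul {f Z} hf hZ := by
    simp only [koszul, d_inner_smul_left hf hZ hX, d_inner_smul_right hf hY hZ,
      mlieBracket_smul_left hf hZ, mlieBracket_smul_right hf hZ]
    simp [inner_smul_left, inner_smul_right, inner_add_left, real_inner_comm (Y x) (Z x)]
    ring
  add {Z Z'} hZ hZ' := by
    simp only [koszul, d_inner_add_left hZ hZ' hX, d_inner_add_right hY hZ hZ',
      mlieBracket_add_left hZ hZ', mlieBracket_add_right hZ hZ']
    simp [inner_add_left, inner_add_right]
    ring

/-- The Koszul expression as a bilinear form `(u, w) ↦ 2 g(∇_u Y, w)` on `T_x M`. -/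
def koszulForm (Y : Π x : M, TangentSpace I x) (x : M) (hY : MDiffAt (T% Y) x) :
    TangentSpace I x →L[ℝ] TangentSpace I x →L[ℝ] ℝ :=
  TensorialAt.mkHom₂ (fun X Z => koszul X Y Z x) x
    (koszul_tensorial_left hY) (koszul_tensorial_right hY)

theorem koszulForm_apply {X Y Z : Π x : M, TangentSpace I x} {x : M} (hX : MDiffAt (T% X) x)
    (hY : MDiffAt (T% Y) x) (hZ : MDiffAt (T% Z) x) :
    koszulForm Y x hY (X x) (Z x) = koszul X Y Z x :=
  TensorialAt.mkHom₂_apply _ _ hX hZ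

open Classical in
/-- The map `u ↦ ∇_u Y` on `T_x M` determined by `2 g(∇_u Y, w) = koszulForm Y x u w`
(and `0` if `Y` is not differentiable at `x`). -/
def leviCivitaFun (Y : Π x : M, TangentSpace I x) (x : M) :
    TangentSpace I x →L[ℝ] TangentSpace I x :=
  if hY : MDiffAt (T% Y) x then
    (1 / 2 : ℝ) • ∑ i, ((koszulForm Y x hY).flip
      (stdOrthonormalBasis ℝ (TangentSpace I x) i)).smulRight
        (stdOrthonormalBasis ℝ (TangentSpace I x) i)
  else 0

theorem inner_leviCivitaFun_form {Y : Π x : M, TangentSpace I x} {x : M} (hY : MDiffAt (T% Y) x)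
    (u w : TangentSpace I x) :
    inner ℝ (leviCivitaFun Y x u) w = (1 / 2 : ℝ) * koszulForm Y x hY u w := by
  conv_rhs => rw [← (stdOrthonormalBasis ℝ (TangentSpace I x)).sum_repr' w]
  simp [leviCivitaFun, hY, sum_inner, inner_smul_left, mul_comm]

theorem inner_leviCivitaFun {X Y Z : Π x : M, TangentSpace I x} {x : M} (hX : MDiffAt (T% X) x)
    (hY : MDiffAt (T% Y) x) (hZ : MDiffAt (T% Z) x) :
    inner ℝ (leviCivitaFun Y x (X x)) (Z x) = (1 / 2 : ℝ) * koszul X Y Z x := by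
  rw [inner_leviCivitaFun_form hY, koszulForm_apply hX hY hZ]

theorem isCovariantDerivativeOn_leviCivitaFun :
    IsCovariantDerivativeOn E (leviCivitaFun (I := I) (M := M)) where
  add {Y Y' x} hY hY' _ := by
    refine endomorphism_ext fun X Z hX hZ => ?_
    have hs : MDiffAt (T% (Y + Y')) x := mdifferentiableAt_add_section hY hY'
    simp only [add_apply, inner_add_left]
    rw [inner_leviCivitaFun hX hs hZ, inner_leviCivitaFun hX hY hZ, inner_leviCivitaFun hX hY' hZ]
    simp only [koszul, d_inner_add_left hY hY' hZ, d_inner_add_right hX hY hY',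
      mlieBracket_add_left hY hY', mlieBracket_add_right hY hY']
    simp [inner_add_left, inner_add_right]
    ring
  leibniz {Y f x} hY hf _ := by
    refine endomorphism_ext fun X Z hX hZ => ?_
    have hs : MDiffAt (T% (f • Y)) x := hf.smul_section hY
    simp only [add_apply, inner_add_left, smul_apply,
      inner_smul_left, ContinuousLinearMap.smulRight_apply]
    rw [inner_leviCivitaFun hX hs hZ, inner_leviCivitaFun hX hY hZ]
    simp only [koszul, d_inner_smul_left hf hY hZ, d_inner_smul_right hf hX hY,
      mlieBracket_smul_left hf hY, mlieBracket_smul_right hf hY]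
    simp [inner_smul_left, inner_smul_right, inner_add_left, real_inner_comm (X x) (Y x)]
    ring

variable (I M) in
/-- The Levi-Civita connection of the Riemannian manifold `M`, constructed by Koszul's formula. -/
def leviCivita : CovariantDerivative I E (fun x : M => TangentSpace I x) where
  toFun := leviCivitaFun
  isCovariantDerivativeOnUniv := isCovariantDerivativeOn_leviCivitaFun

theorem leviCivita_torsion : (leviCivita I M).torsion = 0 := by
  rw [CovariantDerivative.torsion_eq_zero_iff]
  intro X Y x hX hY
  refine ext_inner_right ℝ fun w => ?_
  have hw := mdifferentiableAt_extend (I := I) (F := E) w (x := x)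
  have h1 := inner_leviCivitaFun hX hY hw
  have h2 := inner_leviCivitaFun hY hX hw
  have hs : mlieBracket I Y X x = - mlieBracket I X Y x := mlieBracket_swap_apply
  have hs1 : mlieBracket I (extend E w) Y x = - mlieBracket I Y (extend E w) x :=
    mlieBracket_swap_apply
  have hs2 : mlieBracket I (extend E w) X x = - mlieBracket I X (extend E w) x :=
    mlieBracket_swap_apply
  simp only [extend_apply_self] at h1 h2
  change inner ℝ (leviCivitaFun Y x (X x) - leviCivitaFun X x (Y x)) w = _
  rw [inner_sub_left, h1, h2]
  simp only [koszul, hs, hs1, hs2, inner_neg_left, extend_apply_self]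
  have c1 : (fun y => inner ℝ (extend E w y) (X y) : M → ℝ) = fun y => inner ℝ (X y) (extend E w y) :=
    funext fun y => real_inner_comm _ _
  have c2 : (fun y => inner ℝ (extend E w y) (Y y) : M → ℝ) = fun y => inner ℝ (Y y) (extend E w y) :=
    funext fun y => real_inner_comm _ _
  have c3 : (fun y => inner ℝ (Y y) (X y) : M → ℝ) = fun y => inner ℝ (X y) (Y y) :=
    funext fun y => real_inner_comm _ _
  rw [c1, c2, c3]
  ring

theorem leviCivita_metric {x : M} {X Y Z : Π x : M, TangentSpace I x} (hX : MDiffAt (T% X) x)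
    (hY : MDiffAt (T% Y) x) (hZ : MDiffAt (T% Z) x) :
    d% (fun y => (inner ℝ (Y y) (Z y) : ℝ)) x (X x)
      = inner ℝ (leviCivita I M Y x (X x)) (Z x) + inner ℝ (Y x) (leviCivita I M Z x (X x)) := by
  have h1 := inner_leviCivitaFun hX hY hZ
  have h2 := inner_leviCivitaFun hX hZ hY
  change _ = inner ℝ (leviCivitaFun Y x (X x)) (Z x) + inner ℝ (Y x) (leviCivitaFun Z x (X x))
  rw [real_inner_comm (leviCivitaFun Z x (X x)) (Y x), h1, h2]
  have hs : mlieBracket I Z Y x = - mlieBracket I Y Z x := mlieBracket_swap_apply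
  have hs1 : mlieBracket I X Y x = - mlieBracket I Y X x := mlieBracket_swap_apply
  have hs2 : mlieBracket I X Z x = - mlieBracket I Z X x := mlieBracket_swap_apply
  have c1 : (fun y => inner ℝ (Z y) (X y) : M → ℝ) = fun y => inner ℝ (X y) (Z y) :=
    funext fun y => real_inner_comm _ _
  have c2 : (fun y => inner ℝ (Y y) (X y) : M → ℝ) = fun y => inner ℝ (X y) (Y y) :=
    funext fun y => real_inner_comm _ _
  have c3 : (fun y => inner ℝ (Z y) (Y y) : M → ℝ) = fun y => inner ℝ (Y y) (Z y) :=
    funext fun y => real_inner_comm _ _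
  simp only [koszul, hs, hs1, hs2, inner_neg_left, c1, c2, c3]
  ring

end LeviCivita

section PointwiseAlgebra

/-! Algebra in one tangent space `V`, a four-dimensional Euclidean vector space. Two-forms are
written as functions `φ : V → V → ℝ` and curvature tensors as functions
`R : V → V → V → V → ℝ`. All traces are taken in an orthonormal basis. -/

variable {V : Type*} [NormedAddCommGroup V] [InnerProductSpace ℝ V] [FiniteDimensional ℝ V]

/-- The Ricci contraction `Ric(u, v) = ∑ R(e_i, u, e_i, v)`. -/
def ricciOf (R : V → V → V → V → ℝ) (u v : V) : ℝ :=
  ∑ i, R (stdOrthonormalBasis ℝ V i) u (stdOrthonormalBasis ℝ V i) v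

/-- The scalar curvature `s`, the trace of `Ric`. -/
def scalarOf (R : V → V → V → V → ℝ) : ℝ :=
  ∑ i, ricciOf R (stdOrthonormalBasis ℝ V i) (stdOrthonormalBasis ℝ V i)

/-- The traceless Ricci tensor `Ric_0 = Ric - (s/4) g` in dimension four. -/
def ricciZeroOf (R : V → V → V → V → ℝ) (u v : V) : ℝ :=
  ricciOf R u v - scalarOf R / 4 * inner ℝ u v

/-- The normalized Ricci tensor `h = (Ric - (s/6) g) / 2` in dimension four. -/
def normalizedRicciOf (R : V → V → V → V → ℝ) (u v : V) : ℝ :=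
  (ricciOf R u v - scalarOf R / 6 * inner ℝ u v) / 2

/-- The Weyl tensor in dimension four: `R` minus the Kulkarni-Nomizu product of `h` and `g`. -/
def weylOf (R : V → V → V → V → ℝ) (x y z t : V) : ℝ :=
  R x y z t -
    (normalizedRicciOf R x z * inner ℝ y t + normalizedRicciOf R y t * inner ℝ x z
      - normalizedRicciOf R x t * inner ℝ y z - normalizedRicciOf R y z * inner ℝ x t)

/-- A curvature-like tensor `T` acting on two-forms:
`(T φ)(z, t) = (1/2) ∑ φ(e_i, e_j) T(e_i, e_j, z, t)`. -/
def curvatureOp (T : V → V → V → V → ℝ) (φ : V → V → ℝ) (z t : V) : ℝ :=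
  (1 / 2 : ℝ) * ∑ i, ∑ j, φ (stdOrthonormalBasis ℝ V i) (stdOrthonormalBasis ℝ V j) *
    T (stdOrthonormalBasis ℝ V i) (stdOrthonormalBasis ℝ V j) z t

/-- The inner product of two-forms, normalized so that `|e_1 ∧ e_2| = 1`. -/
def formInner (φ ψ : V → V → ℝ) : ℝ :=
  (1 / 2 : ℝ) * ∑ i, ∑ j, φ (stdOrthonormalBasis ℝ V i) (stdOrthonormalBasis ℝ V j) *
    ψ (stdOrthonormalBasis ℝ V i) (stdOrthonormalBasis ℝ V j)

/-- The fundamental two-form `Ω(u, v) = g(J u, v)`. -/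
def fundForm (J : V →L[ℝ] V) (u v : V) : ℝ := inner ℝ (J u) v

/-- The volume form `(1/2) Ω ∧ Ω` of an orthogonal almost complex structure `J` on a
four-dimensional space: the metric volume form of the orientation for which the bases
`(u, J u, v, J v)` are positive. -/
def volForm (J : V →L[ℝ] V) (a b c d : V) : ℝ :=
  fundForm J a b * fundForm J c d - fundForm J a c * fundForm J b d
    + fundForm J a d * fundForm J b c

/-- The Hodge star on two-forms for the oriented volume form `vol`. -/
def hodgeStar (vol : V → V → V → V → ℝ) (φ : V → V → ℝ) (u v : V) : ℝ :=
  (1 / 2 : ℝ) * ∑ i, ∑ j, φ (stdOrthonormalBasis ℝ V i) (stdOrthonormalBasis ℝ V j) *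
    vol (stdOrthonormalBasis ℝ V i) (stdOrthonormalBasis ℝ V j) u v

/-- The projection of two-forms to the self-dual forms `Λ^+`. -/
def selfDualPart (vol : V → V → V → V → ℝ) (φ : V → V → ℝ) : V → V → ℝ :=
  (1 / 2 : ℝ) • (φ + hodgeStar vol φ)

/-- The projection of two-forms to the anti-self-dual forms `Λ^-`. -/
def antiSelfDualPart (vol : V → V → V → V → ℝ) (φ : V → V → ℝ) : V → V → ℝ :=
  (1 / 2 : ℝ) • (φ - hodgeStar vol φ)

/-- The self-dual Weyl tensor `W^+` as an endomorphism of two-forms. -/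
def weylPlus (vol R : V → V → V → V → ℝ) (φ : V → V → ℝ) : V → V → ℝ :=
  selfDualPart vol (curvatureOp (weylOf R) (selfDualPart vol φ))

/-- The anti-self-dual Weyl tensor `W^-` as an endomorphism of two-forms. -/
def weylMinus (vol R : V → V → V → V → ℝ) (φ : V → V → ℝ) : V → V → ℝ :=
  antiSelfDualPart vol (curvatureOp (weylOf R) (antiSelfDualPart vol φ))

/-- The conformal scalar curvature `κ = 3 ⟨W^+(Ω), Ω⟩` of `(g, J)`; the orientation is that
of `J`. -/
def conformalScalar (J : V →L[ℝ] V) (R : V → V → V → V → ℝ) : ℝ :=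
  3 * formInner (weylPlus (volForm J) R (fundForm J)) (fundForm J)

/-- The orthogonal projection of two-forms to the line spanned by `Ω` (note `|Ω|² = 2`). -/
def projFund (J : V →L[ℝ] V) (φ : V → V → ℝ) : V → V → ℝ :=
  (formInner φ (fundForm J) / 2) • fundForm J

/-- The projection of two-forms to the `J`-anti-invariant forms. -/
def projAnti (J : V →L[ℝ] V) (φ : V → V → ℝ) : V → V → ℝ :=
  fun u v => (φ u v - φ (J u) (J v)) / 2

/-- The second `U(2)`-component, with respect to `J`, of an endomorphism `A` of the rank three
bundle `ℝΩ ⊕ Λ^anti` of self-dual forms for the orientation of `J`: the part of `A` exchanging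
the two summands. -/
def componentTwo (J : V →L[ℝ] V) (A : (V → V → ℝ) → (V → V → ℝ)) (φ : V → V → ℝ) : V → V → ℝ :=
  projAnti J (A (projFund J φ)) + projFund J (A (projAnti J φ))

/-- The second Gray condition
`R(X,Y,Z,W) - R(JX,JY,Z,W) = R(JX,Y,JZ,W) + R(JX,Y,Z,JW)`. -/
def SecondGrayAt (J : V →L[ℝ] V) (R : V → V → V → V → ℝ) : Prop :=
  ∀ X Y Z W : V, R X Y Z W - R (J X) (J Y) Z W = R (J X) Y (J Z) W + R (J X) Y Z (J W)

/-- The metric restricted to a subspace `D` and extended by zero on `Dᗮ`. -/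
def restrictedMetric (D : Submodule ℝ V) (u v : V) : ℝ :=
  inner ℝ (D.starProjection u) (D.starProjection v)

/-- The endomorphism equal to `J` on `D` and to `-J` on `Dᗮ`. -/
def flipOn (D : Submodule ℝ V) (J : V →L[ℝ] V) : V →L[ℝ] V :=
  J ∘L D.starProjection - J ∘L Dᗮ.starProjection

end PointwiseAlgebra

section Manifold

variable {E : Type*} [NormedAddCommGroup E] [NormedSpace ℝ E] [FiniteDimensional ℝ E]
  {H : Type*} [TopologicalSpace H] {I : ModelWithCorners ℝ E H}
  {M : Type*} [TopologicalSpace M] [ChartedSpace H M] [IsManifold I ∞ M]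

/-- The exterior derivative of a two-form `σ`, evaluated at `x` on three vector fields. -/
def dTwoForm (σ : Π x : M, TangentSpace I x → TangentSpace I x → ℝ)
    (X Y Z : Π x : M, TangentSpace I x) (x : M) : ℝ :=
  d% (fun y => σ y (Y y) (Z y)) x (X x) - d% (fun y => σ y (X y) (Z y)) x (Y x)
    + d% (fun y => σ y (X y) (Y y)) x (Z x)
    - σ x (mlieBracket I X Y x) (Z x) + σ x (mlieBracket I X Z x) (Y x)
    - σ x (mlieBracket I Y Z x) (X x)

/-- The Nijenhuis tensor `[JX, JY] - [X, Y] - J[JX, Y] - J[X, JY]` at `x`. -/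
def nijenhuis (J : Π x : M, TangentSpace I x →L[ℝ] TangentSpace I x)
    (X Y : Π x : M, TangentSpace I x) (x : M) : TangentSpace I x :=
  mlieBracket I (fun y => J y (X y)) (fun y => J y (Y y)) x - mlieBracket I X Y x
    - J x (mlieBracket I (fun y => J y (X y)) Y x) - J x (mlieBracket I X (fun y => J y (Y y)) x)

/-- Integrability of an almost complex structure: the Nijenhuis tensor vanishes. -/
def IsIntegrable (J : Π x : M, TangentSpace I x →L[ℝ] TangentSpace I x) : Prop :=
  ∀ (x : M) (X Y : Π x : M, TangentSpace I x), CMDiffAt ∞ (T% X) x → CMDiffAt ∞ (T% Y) x →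
    nijenhuis J X Y x = 0

variable [RiemannianBundle (fun x : M => TangentSpace I x)]

/-- `(g, J, Ω)` with `Ω(X, Y) = g(JX, Y)` is an almost Kähler structure: `J` is a smooth
`g`-orthogonal almost complex structure and `Ω` is closed. (Nondegeneracy of `Ω` is automatic.) -/
structure IsAlmostKahler (J : Π x : M, TangentSpace I x →L[ℝ] TangentSpace I x) : Prop where
  smooth : ContMDiff I (I.prod 𝓘(ℝ, E →L[ℝ] E)) ∞
    (fun x => TotalSpace.mk' (E →L[ℝ] E) (E := fun x : M => TangentSpace I x →L[ℝ] TangentSpace I x)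
      x (J x))
  sq : ∀ (x : M) (u : TangentSpace I x), J x (J x u) = -u
  orthogonal : ∀ (x : M) (u v : TangentSpace I x),
    (inner ℝ (J x u) (J x v) : ℝ) = inner ℝ u v
  closed : ∀ (x : M) (X Y Z : Π x : M, TangentSpace I x), CMDiffAt ∞ (T% X) x →
    CMDiffAt ∞ (T% Y) x → CMDiffAt ∞ (T% Z) x → dTwoForm (fun y => fundForm (J y)) X Y Z x = 0

/-- `(g, J, Ω)` is a Kähler structure: almost Kähler with `J` integrable. -/
def IsKahler (J : Π x : M, TangentSpace I x →L[ℝ] TangentSpace I x) : Prop :=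
  IsAlmostKahler J ∧ IsIntegrable J

variable [IsContMDiffRiemannianBundle I ∞ E (fun x : M => TangentSpace I x)]

/-- `R(u, v) w = ∇_u ∇_v w - ∇_v ∇_u w - ∇_[u, v] w` at `x`, computed with local extensions of
the tangent vectors to vector fields that are smooth near `x`. -/
def curvatureEnd (x : M) (u v w : TangentSpace I x) : TangentSpace I x :=
  leviCivita I M (fun y => leviCivita I M (extend E w) y (extend E v y)) x u
    - leviCivita I M (fun y => leviCivita I M (extend E w) y (extend E u y)) x v
    - leviCivita I M (extend E w) x (mlieBracket I (extend E u) (extend E v) x)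

/-- The Riemannian curvature tensor, with the sign for which `R(X, Y, X, Y)` is positive on
round spheres. -/
def curvatureTensor (x : M) (u v w z : TangentSpace I x) : ℝ :=
  -inner ℝ (curvatureEnd x u v w) z

/-- The map `u ↦ (∇_u J) w = ∇_u (J w) - J (∇_u w)` at `x`, computed with a local extension of
the tangent vector `w` to a vector field that is smooth near `x`. -/
def covDerivEnd (J : Π x : M, TangentSpace I x →L[ℝ] TangentSpace I x) (x : M)
    (w : TangentSpace I x) : TangentSpace I x →L[ℝ] TangentSpace I x :=
  leviCivita I M (fun y => J y (extend E w y)) x - J x ∘L leviCivita I M (extend E w) x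

/-- The Kähler nullity `D_x = {u ∈ T_x M | ∇_u J = 0}`. -/
def kahlerNullity (J : Π x : M, TangentSpace I x →L[ℝ] TangentSpace I x) (x : M) :
    Submodule ℝ (TangentSpace I x) where
  carrier := {u | ∀ w, covDerivEnd J x w u = 0}
  add_mem' hu hv w := by rw [map_add, hu w, hv w, add_zero]
  zero_mem' w := map_zero _
  smul_mem' c u hu w := by rw [map_smul, hu w, smul_zero]

/-- The structure equal to `J` on the Kähler nullity of `J` and to `-J` on its orthogonal
complement. -/
def reversedStructure (J : Π x : M, TangentSpace I x →L[ℝ] TangentSpace I x) (x : M) :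
    TangentSpace I x →L[ℝ] TangentSpace I x :=
  flipOn (kahlerNullity J x) (J x)

end Manifold

end AKFour

end

/-! The argument is a local computation with moving frames, followed by a connectedness argument. In
an orthonormal frame (e_0, J e_0, e_2, J e_2) the connection form splits into self-dual components A
= ω_12 + ω_03, A' = ω_13 - ω_02, B = ω_01 + ω_23 and anti-self-dual components P = ω_03 - ω_12, Q =
ω_02 + ω_13, B̄ = ω_01 - ω_23. The tensor ∇J consists of A and A', and closedness of Ω determines A'
by A. So ∇J is one vector W: its kernel is the orthogonal complement of W and JW. Where W ≠ 0, a
special frame has e_0 along W and e_2 along (∇_{e_0} J) e_0. There A = r e^0 and A' = -r e^1 with r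
≠ 0, and the nullity is spanned by e_2, e_3.

The second Gray condition makes φ = e^12 + e^03 and ψ = e^13 - e^02 eigenforms of the curvature
operator with one eigenvalue λ (`GrayRelations.phi_psi`). The structure equations become dA = -λφ +
B ∧ A' and dA' = -λψ - B ∧ A. Their components (`IsSpecialFrame.first_order`) give λ = -r²/2 and
express dr, and P, Q on the plane of e_0, e_1, through the connection. Applying d once more to A and
to A' gives two values for each of e_0 r, e_1 r, e_3 r; the Gray condition or a sign makes them
opposite, or they agree and their curvature parts cancel, while e_2 r vanishes outright. Hence dr =
0 (`frameDeriv_formA_zero`).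

Consequently |∇J|² = 8r² is locally constant where it is nonzero. By connectedness it vanishes
nowhere or everywhere; the latter would make J parallel, hence integrable. So special frames exist
near every point.

With dr = 0 the first-order relations say that P and Q vanish on e_0, e_1, that P_2 = Q_3 and P_3 =
-Q_2, and that B̄ = -3B. Since ∇J̄ consists of P and Q, this is ∇J̄ = 0 along the orthogonal
complement of the nullity together with closedness of Ω̄. Comparing dB̄ with -3 dB kills the
curvature components pairing e_0 ∧ e_1 and e_2 ∧ e_3 with mixed planes (`curvatureCoeff_mixed`).
What remains is linear algebra: Ric is scalar on each of the two planes, W^- has no block exchanging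
the two summands, and the Bianchi identity with λ = -r²/2 identifies κ. -/

open scoped Topology

set_option linter.unusedSectionVars false

noncomputable section

namespace AKFour

/-! ### Brackets and derivations of smooth fields on an open set -/

section FrameCalculus

variable {E : Type*} [NormedAddCommGroup E] [NormedSpace ℝ E]
  {H : Type*} [TopologicalSpace H] {I : ModelWithCorners ℝ E H}
  {M : Type*} [TopologicalSpace M] [ChartedSpace H M]

theorem mvfderiv_congr {f g : M → ℝ} {x : M} (h : f =ᶠ[𝓝 x] g) : d% f x = d% g x := by
  simp only [mvfderiv, h.mfderiv_eq]
  rw [h.eq_of_nhds]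

theorem mvfderiv_congr_of_eqOn {U : Set M} (hU : IsOpen U) {f g : M → ℝ} {x : M} (hx : x ∈ U)
    (h : ∀ y ∈ U, f y = g y) : d% f x = d% g x :=
  mvfderiv_congr (Filter.eventuallyEq_of_mem (hU.mem_nhds hx) h)

theorem mdiffAt_of_smoothOn {U : Set M} (hU : IsOpen U) {f : M → ℝ} (hf : CMDiff[U] ∞ f)
    {x : M} (hx : x ∈ U) : MDiffAt f x :=
  (hf.contMDiffAt (hU.mem_nhds hx)).mdifferentiableAt (by simp)

variable [IsManifold I ∞ M]

theorem mdiffAt_field_of_smoothOn {U : Set M} (hU : IsOpen U) {X : Π x : M, TangentSpace I x}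
    (hX : CMDiff[U] ∞ (T% X)) {x : M} (hx : x ∈ U) : MDiffAt (T% X) x :=
  (hX.contMDiffAt (hU.mem_nhds hx)).mdifferentiableAt (by simp)

variable [FiniteDimensional ℝ E]

theorem smoothOn_mlieBracket {U : Set M} (hU : IsOpen U) {X Y : Π x : M, TangentSpace I x}
    (hX : CMDiff[U] ∞ (T% X)) (hY : CMDiff[U] ∞ (T% Y)) :
    CMDiff[U] ∞ (T% (mlieBracket I X Y)) := by
  have : IsManifold I (minSmoothness ℝ 2) M := by
    rw [minSmoothness_of_isRCLikeNormedField]; infer_instance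
  have : IsManifold I (((⊤ : ℕ∞) : ℕ∞ω) + 1) M := by simpa using ‹IsManifold I ∞ M›
  have : CompleteSpace E := FiniteDimensional.complete ℝ E
  intro x hx
  refine ContMDiffAt.contMDiffWithinAt ?_
  exact ContMDiffAt.mlieBracket_vectorField (m := ⊤) (n := ⊤) (hX.contMDiffAt (hU.mem_nhds hx))
    (hY.contMDiffAt (hU.mem_nhds hx)) (by simp [minSmoothness_of_isRCLikeNormedField])

theorem jacobi_mlieBracket {U : Set M} (hU : IsOpen U) {X Y Z : Π x : M, TangentSpace I x}
    (hX : CMDiff[U] ∞ (T% X)) (hY : CMDiff[U] ∞ (T% Y)) (hZ : CMDiff[U] ∞ (T% Z)) {x : M}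
    (hx : x ∈ U) :
    mlieBracket I X (mlieBracket I Y Z) x =
      mlieBracket I (mlieBracket I X Y) Z x + mlieBracket I Y (mlieBracket I X Z) x := by
  have : IsManifold I (minSmoothness ℝ 3) M := by
    rw [minSmoothness_of_isRCLikeNormedField]
    infer_instance
  have : CompleteSpace E := FiniteDimensional.complete ℝ E
  have h2 : minSmoothness ℝ 2 ≤ (∞ : ℕ∞ω) := by
    rw [minSmoothness_of_isRCLikeNormedField]; exact ENat.LEInfty.out
  exact leibniz_identity_mlieBracket_apply
    ((hX.contMDiffAt (hU.mem_nhds hx)).of_le h2) ((hY.contMDiffAt (hU.mem_nhds hx)).of_le h2)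
    ((hZ.contMDiffAt (hU.mem_nhds hx)).of_le h2)

theorem mlieBracket_smul_right_of_smoothOn {U : Set M} (hU : IsOpen U) {f : M → ℝ}
    {X Y : Π x : M, TangentSpace I x} (hf : CMDiff[U] ∞ f) (hY : CMDiff[U] ∞ (T% Y)) {x : M}
    (hx : x ∈ U) :
    mlieBracket I X (f • Y) x = d% f x (X x) • Y x + f x • mlieBracket I X Y x :=
  have : CompleteSpace E := FiniteDimensional.complete ℝ E
  mlieBracket_smul_right (mdiffAt_of_smoothOn hU hf hx) (mdiffAt_field_of_smoothOn hU hY hx)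

variable [RiemannianBundle (fun x : M => TangentSpace I x)]
  [IsContMDiffRiemannianBundle I ∞ E (fun x : M => TangentSpace I x)]

theorem smoothOn_inner {U : Set M} {X Y : Π x : M, TangentSpace I x}
    (hX : CMDiff[U] ∞ (T% X)) (hY : CMDiff[U] ∞ (T% Y)) :
    CMDiff[U] ∞ (fun x => (inner ℝ (X x) (Y x) : ℝ)) :=
  ContMDiffOn.inner_bundle (IB := I) (F := E) (E := fun x : M => TangentSpace I x)
    (b := fun x => x) hX hY

/-- An orthonormal frame of smooth vector fields on an open subset of a four-manifold. -/
structure IsOrthonormalFrame (U : Set M) (e : Fin 4 → Π x : M, TangentSpace I x) : Prop where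
  isOpen : IsOpen U
  smooth : ∀ i, CMDiff[U] ∞ (T% (e i))
  inner_eq : ∀ x ∈ U, ∀ i j, (inner ℝ (e i x) (e j x) : ℝ) = if i = j then 1 else 0
  expand : ∀ x ∈ U, ∀ v : TangentSpace I x, v = ∑ i, (inner ℝ (e i x) v : ℝ) • e i x

namespace IsOrthonormalFrame

variable {U : Set M} {e : Fin 4 → Π x : M, TangentSpace I x} (he : IsOrthonormalFrame U e)
include he

theorem mono {V : Set M} (hV : IsOpen V) (hVU : V ⊆ U) : IsOrthonormalFrame V e where
  isOpen := hV
  smooth i := (he.smooth i).mono hVU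
  inner_eq x hx := he.inner_eq x (hVU hx)
  expand x hx := he.expand x (hVU hx)

theorem mdiffAt (i : Fin 4) {x : M} (hx : x ∈ U) : MDiffAt (T% (e i)) x :=
  mdiffAt_field_of_smoothOn he.isOpen (he.smooth i) hx

theorem ne_zero {x : M} (hx : x ∈ U) : e 0 x ≠ 0 := by
  intro h
  simpa [h] using he.inner_eq x hx 0 0

/-- The derivative of a smooth function along a smooth vector field is smooth. -/
theorem smoothOn_deriv {f : M → ℝ} {X : Π x : M, TangentSpace I x} (hf : CMDiff[U] ∞ f)
    (hX : CMDiff[U] ∞ (T% X)) : CMDiff[U] ∞ (fun y => d% f y (X y)) := by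
  -- [X, f e_0] - f [X, e_0] = (Xf) e_0, so pairing with the unit field e_0 recovers Xf from
  -- brackets, whose smoothness is known.
  have h1 := smoothOn_inner (smoothOn_mlieBracket he.isOpen hX (hf.smul_section (he.smooth 0)))
    (he.smooth 0)
  have h2 := hf.mul (smoothOn_inner (smoothOn_mlieBracket he.isOpen hX (he.smooth 0))
    (he.smooth 0))
  refine (h1.sub h2).congr fun y hy => ?_
  change _ = inner ℝ (mlieBracket I X (f • e 0) y) (e 0 y) -
    f y * inner ℝ (mlieBracket I X (e 0) y) (e 0 y)
  rw [mlieBracket_smul_right_of_smoothOn he.isOpen hf (he.smooth 0) hy, inner_add_left,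
    inner_smul_left, inner_smul_left, he.inner_eq y hy]
  simp

/-- The Lie bracket of vector fields is the commutator of derivations. -/
theorem mvfderiv_mlieBracket {f : M → ℝ} {X Y : Π x : M, TangentSpace I x}
    (hf : CMDiff[U] ∞ f) (hX : CMDiff[U] ∞ (T% X)) (hY : CMDiff[U] ∞ (T% Y)) {x : M}
    (hx : x ∈ U) :
    d% f x (mlieBracket I X Y x) =
      d% (fun y => d% f y (Y y)) x (X x) - d% (fun y => d% f y (X y)) x (Y x) := by
  have hU := he.isOpen
  set Z := e 0
  have hZ : CMDiff[U] ∞ (T% Z) := he.smooth 0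
  have hb : ∀ {X Y : Π x : M, TangentSpace I x}, CMDiff[U] ∞ (T% X) → CMDiff[U] ∞ (T% Y) →
      mlieBracket I X (mlieBracket I Y (f • Z)) x =
        d% (fun y => d% f y (Y y)) x (X x) • Z x + d% f x (Y x) • mlieBracket I X Z x
        + (d% f x (X x) • mlieBracket I Y Z x
          + f x • mlieBracket I X (mlieBracket I Y Z) x) := by
    intro X Y hX hY
    have hYf := he.smoothOn_deriv hf hY
    have hYZ := smoothOn_mlieBracket hU hY hZ
    have h1 : mlieBracket I Y (f • Z) =ᶠ[𝓝 x]
        ((fun y => d% f y (Y y)) • Z + f • mlieBracket I Y Z) :=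
      Filter.eventuallyEq_of_mem (hU.mem_nhds hx) fun y hy => by
        rw [mlieBracket_smul_right_of_smoothOn hU hf hZ hy]; rfl
    have : CompleteSpace E := FiniteDimensional.complete ℝ E
    rw [Filter.EventuallyEq.mlieBracket_vectorField_eq (Filter.EventuallyEq.refl _ X) h1,
      mlieBracket_add_right (mdiffAt_field_of_smoothOn hU (hYf.smul_section hZ) hx)
        (mdiffAt_field_of_smoothOn hU (hf.smul_section hYZ) hx),
      mlieBracket_smul_right_of_smoothOn hU hYf hZ hx,
      mlieBracket_smul_right_of_smoothOn hU hf hYZ hx]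
  -- The Jacobi identity for X, Y, fZ minus f times the one for X, Y, Z leaves only a multiple of Z.
  -- Since Z is nonzero, the coefficient, which is the claimed difference, vanishes.
  have hJ := jacobi_mlieBracket hU hX hY (hf.smul_section hZ) hx
  rw [hb hX hY, hb hY hX,
    mlieBracket_smul_right_of_smoothOn hU hf hZ hx, jacobi_mlieBracket hU hX hY hZ hx] at hJ
  have h0 : (d% (fun y => d% f y (Y y)) x (X x) - d% (fun y => d% f y (X y)) x (Y x)
      - d% f x (mlieBracket I X Y x)) • Z x = 0 := by
    rw [sub_smul, sub_smul, ← sub_eq_zero.2 hJ]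
    module
  have := (smul_eq_zero.1 h0).resolve_right (he.ne_zero hx)
  linarith

end IsOrthonormalFrame

end FrameCalculus

/-! ### The Levi-Civita connection on fields; tensoriality of the curvature -/

section Connection

variable {E : Type*} [NormedAddCommGroup E] [NormedSpace ℝ E]
  {H : Type*} [TopologicalSpace H] {I : ModelWithCorners ℝ E H}
  {M : Type*} [TopologicalSpace M] [ChartedSpace H M] [IsManifold I ∞ M]
  [FiniteDimensional ℝ E] [RiemannianBundle (fun x : M => TangentSpace I x)]
  [IsContMDiffRiemannianBundle I ∞ E (fun x : M => TangentSpace I x)]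

/-- The vector field `∇_X Y` for the Levi-Civita connection. -/
def nabla (X Y : Π x : M, TangentSpace I x) (x : M) : TangentSpace I x :=
  leviCivita I M Y x (X x)

theorem nabla_add_left (X X' Y : Π x : M, TangentSpace I x) :
    nabla (X + X') Y = nabla X Y + nabla X' Y := by
  ext x; simp [nabla]

theorem nabla_smul_left (f : M → ℝ) (X Y : Π x : M, TangentSpace I x) :
    nabla (f • X) Y = f • nabla X Y := by
  ext x; simp [nabla]

theorem nabla_add_right {X Y Y' : Π x : M, TangentSpace I x} {x : M} (hY : MDiffAt (T% Y) x)
    (hY' : MDiffAt (T% Y') x) : nabla X (Y + Y') x = nabla X Y x + nabla X Y' x := by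
  simp [nabla, (leviCivita I M).isCovariantDerivativeOnUniv.add hY hY']

theorem nabla_smul_right {f : M → ℝ} {X Y : Π x : M, TangentSpace I x} {x : M}
    (hf : MDiffAt f x) (hY : MDiffAt (T% Y) x) :
    nabla X (f • Y) x = f x • nabla X Y x + d% f x (X x) • Y x := by
  simp [nabla, (leviCivita I M).isCovariantDerivativeOnUniv.leibniz hY hf]

theorem leviCivita_congr {U : Set M} (hU : IsOpen U) {Y Y' : Π x : M, TangentSpace I x} {x : M}
    (hY : MDiffAt (T% Y) x) (hY' : MDiffAt (T% Y') x) (hx : x ∈ U)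
    (h : ∀ y ∈ U, Y y = Y' y) : leviCivita I M Y x = leviCivita I M Y' x :=
  (leviCivita I M).isCovariantDerivativeOn (s := U) |>.congr_of_eqOn hY hY' (hU.mem_nhds hx) h

theorem nabla_congr_right {U : Set M} (hU : IsOpen U) {X Y Y' : Π x : M, TangentSpace I x} {x : M}
    (hY : MDiffAt (T% Y) x) (hY' : MDiffAt (T% Y') x) (hx : x ∈ U)
    (h : ∀ y ∈ U, Y y = Y' y) : nabla X Y x = nabla X Y' x := by
  simp only [nabla, leviCivita_congr hU hY hY' hx h]

theorem nabla_sub_nabla {X Y : Π x : M, TangentSpace I x} {x : M} (hX : MDiffAt (T% X) x)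
    (hY : MDiffAt (T% Y) x) : nabla X Y x - nabla Y X x = mlieBracket I X Y x :=
  (CovariantDerivative.torsion_eq_zero_iff _).1 (leviCivita_torsion (I := I) (M := M)) hX hY

theorem mvfderiv_inner {X Y Z : Π x : M, TangentSpace I x} {x : M} (hX : MDiffAt (T% X) x)
    (hY : MDiffAt (T% Y) x) (hZ : MDiffAt (T% Z) x) :
    d% (fun y => (inner ℝ (Y y) (Z y) : ℝ)) x (X x)
      = inner ℝ (nabla X Y x) (Z x) + inner ℝ (Y x) (nabla X Z x) :=
  leviCivita_metric hX hY hZ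

/-- The curvature operator `∇_X ∇_Y Z - ∇_Y ∇_X Z - ∇_[X, Y] Z` of vector fields. -/
def riem (X Y Z : Π x : M, TangentSpace I x) (x : M) : TangentSpace I x :=
  nabla X (nabla Y Z) x - nabla Y (nabla X Z) x - nabla (mlieBracket I X Y) Z x

theorem curvatureEnd_eq_riem (x : M) (u v w : TangentSpace I x) :
    curvatureEnd x u v w = riem (extend E u) (extend E v) (extend E w) x := by
  simp [curvatureEnd, riem, nabla, extend_apply_self]
  rfl

theorem riem_swap (X Y Z : Π x : M, TangentSpace I x) (x : M) :
    riem X Y Z x = - riem Y X Z x := by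
  have h : nabla (mlieBracket I X Y) Z x = - nabla (mlieBracket I Y X) Z x := by
    simp only [nabla]
    rw [mlieBracket_swap_apply, map_neg]
  rw [riem, riem, h]
  abel

namespace IsOrthonormalFrame

variable {U : Set M} {e : Fin 4 → Π x : M, TangentSpace I x} (he : IsOrthonormalFrame U e)
include he

theorem smoothOn_koszul {X Y Z : Π x : M, TangentSpace I x} (hX : CMDiff[U] ∞ (T% X))
    (hY : CMDiff[U] ∞ (T% Y)) (hZ : CMDiff[U] ∞ (T% Z)) :
    CMDiff[U] ∞ (fun x => koszul X Y Z x) := by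
  have hU := he.isOpen
  exact (((((he.smoothOn_deriv (smoothOn_inner hY hZ) hX).add
    (he.smoothOn_deriv (smoothOn_inner hZ hX) hY)).sub
    (he.smoothOn_deriv (smoothOn_inner hX hY) hZ)).add
    (smoothOn_inner (smoothOn_mlieBracket hU hX hY) hZ)).sub
    (smoothOn_inner (smoothOn_mlieBracket hU hY hZ) hX)).add
    (smoothOn_inner (smoothOn_mlieBracket hU hZ hX) hY)

theorem inner_nabla {X Y Z : Π x : M, TangentSpace I x} (hX : CMDiff[U] ∞ (T% X))
    (hY : CMDiff[U] ∞ (T% Y)) (hZ : CMDiff[U] ∞ (T% Z)) {x : M} (hx : x ∈ U) :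
    (inner ℝ (nabla X Y x) (Z x) : ℝ) = (1 / 2 : ℝ) * koszul X Y Z x :=
  inner_leviCivitaFun (mdiffAt_field_of_smoothOn he.isOpen hX hx)
    (mdiffAt_field_of_smoothOn he.isOpen hY hx) (mdiffAt_field_of_smoothOn he.isOpen hZ hx)

theorem smoothOn_sum {f : Fin 4 → M → ℝ} (hf : ∀ i, CMDiff[U] ∞ (f i)) :
    CMDiff[U] ∞ (T% (fun x => ∑ i, f i x • e i x)) :=
  ContMDiffOn.sum_section (t := fun i => f i • e i) fun i _ => (hf i).smul_section (he.smooth i)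

theorem smoothOn_of_inner {X : Π x : M, TangentSpace I x}
    (h : ∀ i, CMDiff[U] ∞ (fun x => (inner ℝ (e i x) (X x) : ℝ))) : CMDiff[U] ∞ (T% X) := by
  refine (he.smoothOn_sum h).congr fun x hx => ?_
  rw [← he.expand x hx]

/-- Koszul's formula writes every frame component of ∇_X Y through brackets and derivatives of inner
products. -/
theorem smoothOn_nabla {X Y : Π x : M, TangentSpace I x} (hX : CMDiff[U] ∞ (T% X))
    (hY : CMDiff[U] ∞ (T% Y)) : CMDiff[U] ∞ (T% (nabla X Y)) := by
  refine he.smoothOn_of_inner fun i => ?_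
  have h := (contMDiffOn_const (c := (1 / 2 : ℝ))).mul (he.smoothOn_koszul hX hY (he.smooth i))
  refine h.congr fun x hx => ?_
  rw [real_inner_comm, he.inner_nabla hX hY (he.smooth i) hx]
  rfl

/-- An operation on smooth vector fields which is linear over smooth functions is determined by
its values on the frame. -/
theorem eq_sum_of_linear {A : Type*} [AddCommGroup A] [Module ℝ A]
    {Φ : (Π x : M, TangentSpace I x) → A} {x : M} (hx : x ∈ U)
    (hadd : ∀ X Y : Π x : M, TangentSpace I x, CMDiff[U] ∞ (T% X) → CMDiff[U] ∞ (T% Y) →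
      Φ (X + Y) = Φ X + Φ Y)
    (hsmul : ∀ (f : M → ℝ) (X : Π x : M, TangentSpace I x), CMDiff[U] ∞ f → CMDiff[U] ∞ (T% X) →
      Φ (f • X) = f x • Φ X)
    {X : Π x : M, TangentSpace I x} (hX : CMDiff[U] ∞ (T% X)) :
    Φ X = ∑ i, (inner ℝ (e i x) (X x) : ℝ) • Φ (e i) := by
  classical
  have hf : ∀ i, CMDiff[U] ∞ (fun y => (inner ℝ (e i y) (X y) : ℝ)) := fun i =>
    smoothOn_inner (he.smooth i) hX
  set X' : Π x : M, TangentSpace I x := ∑ i, (fun y => (inner ℝ (e i y) (X y) : ℝ)) • e i with hX'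
  have hXe : ∀ y ∈ U, X y = X' y := fun y hy => by
    rw [hX', Finset.sum_apply]
    exact he.expand y hy (X y)
  have hX's : CMDiff[U] ∞ (T% X') := hX.congr fun y hy => by rw [hXe y hy]
  have hloc : Φ X = Φ X' := by
    -- No bump function is needed: smoothness is required only on U, where the indicator of U is
    -- constant. Multiplying by it makes X and X' equal everywhere, and linearity over functions
    -- makes Φ local.
    let ψ : M → ℝ := fun y => if y ∈ U then 1 else 0
    have hψ : CMDiff[U] ∞ ψ :=
      (contMDiffOn_const (c := (1 : ℝ))).congr fun y hy => by simp [ψ, hy]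
    have h1 : ψ • X = ψ • X' := by
      ext y
      by_cases hy : y ∈ U
      · simp [ψ, hy, hXe y hy]
      · simp [ψ, hy]
    have h2 := hsmul ψ X hψ hX
    have h3 := hsmul ψ X' hψ hX's
    rw [h1, h3] at h2
    simpa [ψ, hx] using h2.symm
  rw [hloc, hX']
  simp only [Fin.sum_univ_four]
  have hs : ∀ i, CMDiff[U] ∞ (T% ((fun y => (inner ℝ (e i y) (X y) : ℝ)) • e i)) := fun i =>
    (hf i).smul_section (he.smooth i)
  rw [hadd _ _ (((hs 0).add_section (hs 1)).add_section (hs 2)) (hs 3),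
    hadd _ _ ((hs 0).add_section (hs 1)) (hs 2), hadd _ _ (hs 0) (hs 1)]
  simp only [hsmul _ _ (hf _) (he.smooth _)]

theorem riem_add_left {X X' Y Z : Π x : M, TangentSpace I x} (hX : CMDiff[U] ∞ (T% X))
    (hX' : CMDiff[U] ∞ (T% X')) (hZ : CMDiff[U] ∞ (T% Z)) {x : M}
    (hx : x ∈ U) : riem (X + X') Y Z x = riem X Y Z x + riem X' Y Z x := by
  have hU := he.isOpen
  have : CompleteSpace E := FiniteDimensional.complete ℝ E
  have h : nabla (mlieBracket I (X + X') Y) Z x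
      = nabla (mlieBracket I X Y) Z x + nabla (mlieBracket I X' Y) Z x := by
    simp only [nabla]
    rw [mlieBracket_add_left (mdiffAt_field_of_smoothOn hU hX hx)
      (mdiffAt_field_of_smoothOn hU hX' hx), map_add]
  simp only [riem, h, nabla_add_left]
  rw [nabla_add_right (mdiffAt_field_of_smoothOn hU (he.smoothOn_nabla hX hZ) hx)
    (mdiffAt_field_of_smoothOn hU (he.smoothOn_nabla hX' hZ) hx)]
  simp only [Pi.add_apply]
  abel

theorem riem_smul_left {f : M → ℝ} {X Y Z : Π x : M, TangentSpace I x} (hf : CMDiff[U] ∞ f)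
    (hX : CMDiff[U] ∞ (T% X)) (hZ : CMDiff[U] ∞ (T% Z)) {x : M}
    (hx : x ∈ U) : riem (f • X) Y Z x = f x • riem X Y Z x := by
  have hU := he.isOpen
  have : CompleteSpace E := FiniteDimensional.complete ℝ E
  have h : nabla (mlieBracket I (f • X) Y) Z x
      = f x • nabla (mlieBracket I X Y) Z x - d% f x (Y x) • nabla X Z x := by
    simp only [nabla]
    rw [mlieBracket_smul_left (mdiffAt_of_smoothOn hU hf hx)
      (mdiffAt_field_of_smoothOn hU hX hx), map_add]
    simp
    abel
  simp only [riem, h, nabla_smul_left]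
  rw [nabla_smul_right (mdiffAt_of_smoothOn hU hf hx)
    (mdiffAt_field_of_smoothOn hU (he.smoothOn_nabla hX hZ) hx)]
  simp only [Pi.smul_apply']
  module

theorem riem_add_right {X Y Z Z' : Π x : M, TangentSpace I x} (hX : CMDiff[U] ∞ (T% X))
    (hY : CMDiff[U] ∞ (T% Y)) (hZ : CMDiff[U] ∞ (T% Z)) (hZ' : CMDiff[U] ∞ (T% Z')) {x : M}
    (hx : x ∈ U) : riem X Y (Z + Z') x = riem X Y Z x + riem X Y Z' x := by
  have hU := he.isOpen
  have key : ∀ {X Y : Π x : M, TangentSpace I x}, CMDiff[U] ∞ (T% X) → CMDiff[U] ∞ (T% Y) →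
      nabla X (nabla Y (Z + Z')) x = nabla X (nabla Y Z) x + nabla X (nabla Y Z') x := by
    intro X Y hX hY
    have h1 := he.smoothOn_nabla hY hZ
    have h2 := he.smoothOn_nabla hY hZ'
    rw [nabla_congr_right hU (mdiffAt_field_of_smoothOn hU
        (he.smoothOn_nabla hY (hZ.add_section hZ')) hx)
      (mdiffAt_field_of_smoothOn hU (h1.add_section h2) hx) hx
      fun y hy => nabla_add_right (mdiffAt_field_of_smoothOn hU hZ hy)
        (mdiffAt_field_of_smoothOn hU hZ' hy)]
    exact nabla_add_right (mdiffAt_field_of_smoothOn hU h1 hx)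
      (mdiffAt_field_of_smoothOn hU h2 hx)
  rw [riem, key hX hY, key hY hX, nabla_add_right (mdiffAt_field_of_smoothOn hU hZ hx)
    (mdiffAt_field_of_smoothOn hU hZ' hx), riem, riem]
  abel

/-- The first derivatives of f multiply ∇_X Z and ∇_Y Z symmetrically and cancel. The second
derivatives form a commutator, which the term ∇_[X,Y] removes. -/
theorem riem_smul_right {f : M → ℝ} {X Y Z : Π x : M, TangentSpace I x} (hf : CMDiff[U] ∞ f)
    (hX : CMDiff[U] ∞ (T% X)) (hY : CMDiff[U] ∞ (T% Y)) (hZ : CMDiff[U] ∞ (T% Z)) {x : M}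
    (hx : x ∈ U) : riem X Y (f • Z) x = f x • riem X Y Z x := by
  have hU := he.isOpen
  have key : ∀ {X Y : Π x : M, TangentSpace I x}, CMDiff[U] ∞ (T% X) → CMDiff[U] ∞ (T% Y) →
      nabla X (nabla Y (f • Z)) x = f x • nabla X (nabla Y Z) x + d% f x (X x) • nabla Y Z x
        + (d% f x (Y x) • nabla X Z x + d% (fun y => d% f y (Y y)) x (X x) • Z x) := by
    intro X Y hX hY
    have h1 := he.smoothOn_nabla hY hZ
    have h2 := he.smoothOn_deriv hf hY
    rw [nabla_congr_right (Y' := f • nabla Y Z + (fun y => d% f y (Y y)) • Z) hU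
      (mdiffAt_field_of_smoothOn hU (he.smoothOn_nabla hY (hf.smul_section hZ)) hx)
      (mdiffAt_field_of_smoothOn hU
        ((hf.smul_section h1).add_section (h2.smul_section hZ)) hx) hx
      fun y hy => nabla_smul_right (mdiffAt_of_smoothOn hU hf hy)
        (mdiffAt_field_of_smoothOn hU hZ hy)]
    rw [nabla_add_right (mdiffAt_field_of_smoothOn hU (hf.smul_section h1) hx)
      (mdiffAt_field_of_smoothOn hU (h2.smul_section hZ) hx),
      nabla_smul_right (mdiffAt_of_smoothOn hU hf hx) (mdiffAt_field_of_smoothOn hU h1 hx),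
      nabla_smul_right (mdiffAt_of_smoothOn hU h2 hx) (mdiffAt_field_of_smoothOn hU hZ hx)]
  rw [riem, key hX hY, key hY hX, nabla_smul_right (mdiffAt_of_smoothOn hU hf hx)
    (mdiffAt_field_of_smoothOn hU hZ hx), he.mvfderiv_mlieBracket hf hX hY hx, riem]
  module

theorem riem_eq_sum {X Y Z : Π x : M, TangentSpace I x} (hX : CMDiff[U] ∞ (T% X))
    (hY : CMDiff[U] ∞ (T% Y)) (hZ : CMDiff[U] ∞ (T% Z)) {x : M} (hx : x ∈ U) :
    riem X Y Z x = ∑ i, ∑ j, ∑ k, ((inner ℝ (e i x) (X x) : ℝ) * (inner ℝ (e j x) (Y x) : ℝ)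
      * (inner ℝ (e k x) (Z x) : ℝ)) • riem (e i) (e j) (e k) x := by
  rw [he.eq_sum_of_linear (Φ := fun X => riem X Y Z x) hx
    (fun X X' h h' => he.riem_add_left h h' hZ hx)
    (fun f X hf h => he.riem_smul_left hf h hZ hx) hX]
  refine Finset.sum_congr rfl fun i _ => ?_
  have h1 := he.eq_sum_of_linear (Φ := fun Y => riem (e i) Y Z x) hx
    (fun Y Y' h h' => by
      simp only [riem_swap (e i)]; rw [he.riem_add_left h h' hZ hx]; abel)
    (fun f Y hf h => by
      simp only [riem_swap (e i)]; rw [he.riem_smul_left hf h hZ hx]; simp) hY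
  rw [h1, Finset.smul_sum]
  refine Finset.sum_congr rfl fun j _ => ?_
  have h2 := he.eq_sum_of_linear (Φ := fun Z => riem (e i) (e j) Z x) hx
    (fun Z Z' h h' => he.riem_add_right (he.smooth i) (he.smooth j) h h' hx)
    (fun f Z hf h => he.riem_smul_right hf (he.smooth i) (he.smooth j) h hx) hZ
  rw [h2, Finset.smul_sum, Finset.smul_sum]
  refine Finset.sum_congr rfl fun k _ => ?_
  rw [smul_smul, smul_smul, mul_assoc]

/-- The extensions used to define the curvature are smooth only near x. After shrinking the open
set, tensoriality shows that their choice does not matter and that frame fields may be used instead.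
-/
theorem curvatureEnd_eq_sum {x : M} (hx : x ∈ U) (u v w : TangentSpace I x) :
    curvatureEnd x u v w = ∑ i, ∑ j, ∑ k, ((inner ℝ (e i x) u : ℝ) * (inner ℝ (e j x) v : ℝ)
      * (inner ℝ (e k x) w : ℝ)) • riem (e i) (e j) (e k) x := by
  have h : ∀ u : TangentSpace I x, ∃ V ∈ 𝓝 x, CMDiff[V] ∞ (T% (extend E u)) := fun u =>
    exists_contMDiffOn_extend I E u
  obtain ⟨V₁, h₁, s₁⟩ := h u
  obtain ⟨V₂, h₂, s₂⟩ := h v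
  obtain ⟨V₃, h₃, s₃⟩ := h w
  obtain ⟨V, hV, hVo, hxV⟩ := mem_nhds_iff.1
    (Filter.inter_mem (he.isOpen.mem_nhds hx) (Filter.inter_mem h₁ (Filter.inter_mem h₂ h₃)))
  have hf := he.mono hVo fun y hy => (hV hy).1
  rw [curvatureEnd_eq_riem, hf.riem_eq_sum (s₁.mono fun y hy => (hV hy).2.1)
    (s₂.mono fun y hy => (hV hy).2.2.1) (s₃.mono fun y hy => (hV hy).2.2.2) hxV]
  simp only [extend_apply_self]

theorem curvatureEnd_frame {x : M} (hx : x ∈ U) (i j k : Fin 4) :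
    curvatureEnd x (e i x) (e j x) (e k x) = riem (e i) (e j) (e k) x := by
  rw [he.curvatureEnd_eq_sum hx]
  simp [he.inner_eq x hx]

/-- The first Bianchi identity. -/
theorem riem_cyclic {X Y Z : Π x : M, TangentSpace I x} (hX : CMDiff[U] ∞ (T% X))
    (hY : CMDiff[U] ∞ (T% Y)) (hZ : CMDiff[U] ∞ (T% Z)) {x : M} (hx : x ∈ U) :
    riem X Y Z x + riem Y Z X x + riem Z X Y x = 0 := by
  have hU := he.isOpen
  -- Torsion-freeness, used twice, turns the cyclic sum of second derivatives into the cyclic sum of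
  -- double brackets.
  have key : ∀ {X Y Z : Π x : M, TangentSpace I x}, CMDiff[U] ∞ (T% X) →
      CMDiff[U] ∞ (T% Y) → CMDiff[U] ∞ (T% Z) → nabla X (nabla Y Z) x - nabla X (nabla Z Y) x
        - nabla (mlieBracket I Y Z) X x = mlieBracket I X (mlieBracket I Y Z) x := by
    intro X Y Z hX hY hZ
    have h1 := he.smoothOn_nabla hY hZ
    have h2 := he.smoothOn_nabla hZ hY
    have h3 := smoothOn_mlieBracket hU hY hZ
    rw [← nabla_sub_nabla (mdiffAt_field_of_smoothOn hU hX hx)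
      (mdiffAt_field_of_smoothOn hU h3 hx)]
    have h4 : nabla X (nabla Y Z) x = nabla X (nabla Z Y) x + nabla X (mlieBracket I Y Z) x := by
      rw [← nabla_add_right (mdiffAt_field_of_smoothOn hU h2 hx)
        (mdiffAt_field_of_smoothOn hU h3 hx)]
      refine nabla_congr_right hU (mdiffAt_field_of_smoothOn hU h1 hx)
        (mdiffAt_field_of_smoothOn hU (h2.add_section h3) hx) hx fun y hy => ?_
      rw [Pi.add_apply, ← nabla_sub_nabla (mdiffAt_field_of_smoothOn hU hY hy)
        (mdiffAt_field_of_smoothOn hU hZ hy)]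
      abel
    rw [h4]
    abel
  have hb : mlieBracket I X (mlieBracket I Y Z) x + mlieBracket I Y (mlieBracket I Z X) x
      + mlieBracket I Z (mlieBracket I X Y) x = 0 := by
    have h1 : mlieBracket I Y (mlieBracket I Z X) x = - mlieBracket I Y (mlieBracket I X Z) x := by
      rw [mlieBracket_swap (V := Z), ← neg_one_smul ℝ (mlieBracket I X Z),
        VectorField.mlieBracket_const_smul_right (mdiffAt_field_of_smoothOn hU
          (smoothOn_mlieBracket hU hX hZ) hx)]
      simp
    rw [h1, jacobi_mlieBracket hU hX hY hZ hx, mlieBracket_swap_apply (V := Z)]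
    abel
  rw [← key hX hY hZ, ← key hY hZ hX, ← key hZ hX hY] at hb
  rw [← hb, riem, riem, riem]
  abel

end IsOrthonormalFrame

end Connection

/-! ### Structure functions, d² = 0 and curvature components in a frame -/

section Components

variable {E : Type*} [NormedAddCommGroup E] [NormedSpace ℝ E]
  {H : Type*} [TopologicalSpace H] {I : ModelWithCorners ℝ E H}
  {M : Type*} [TopologicalSpace M] [ChartedSpace H M] [IsManifold I ∞ M]
  [FiniteDimensional ℝ E] [RiemannianBundle (fun x : M => TangentSpace I x)]
  [IsContMDiffRiemannianBundle I ∞ E (fun x : M => TangentSpace I x)]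

/-- The connection coefficients `g(∇_{e_i} e_j, e_k)` of a frame. -/
def christoffel (e : Fin 4 → Π x : M, TangentSpace I x) (i j k : Fin 4) (x : M) : ℝ :=
  inner ℝ (nabla (e i) (e j) x) (e k x)

/-- The derivative of a function along a frame field. -/
def frameDeriv (e : Fin 4 → Π x : M, TangentSpace I x) (i : Fin 4) (f : M → ℝ) (x : M) : ℝ :=
  d% f x (e i x)

/-- The structure functions `g([e_i, e_j], e_k)` of an orthonormal frame. -/
def bracketCoeff (e : Fin 4 → Π x : M, TangentSpace I x) (i j k : Fin 4) (x : M) : ℝ :=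
  christoffel e i j k x - christoffel e j i k x

/-- The components of the curvature tensor in a frame. -/
def curvatureCoeff (e : Fin 4 → Π x : M, TangentSpace I x) (i j k l : Fin 4) (x : M) : ℝ :=
  curvatureTensor x (e i x) (e j x) (e k x) (e l x)

/-- The components of the exterior derivative of the one-form with components `η`. -/
def dOneForm (e : Fin 4 → Π x : M, TangentSpace I x) (η : Fin 4 → M → ℝ) (i j : Fin 4) (x : M) :
    ℝ :=
  frameDeriv e i (η j) x - frameDeriv e j (η i) x - ∑ m, bracketCoeff e i j m x * η m x

namespace IsOrthonormalFrame

variable {U : Set M} {e : Fin 4 → Π x : M, TangentSpace I x} (he : IsOrthonormalFrame U e)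
include he

theorem inner_sum_frame {x : M} (hx : x ∈ U) (c : Fin 4 → ℝ) (k : Fin 4) :
    (inner ℝ (e k x) (∑ i, c i • e i x) : ℝ) = c k := by
  simp [inner_sum, inner_smul_right, he.inner_eq x hx]

theorem inner_eq_sum {x : M} (hx : x ∈ U) (u v : TangentSpace I x) :
    (inner ℝ u v : ℝ) = ∑ i, (inner ℝ (e i x) u : ℝ) * inner ℝ (e i x) v := by
  conv_lhs => rw [he.expand x hx u]
  simp [sum_inner, inner_smul_left]

theorem smoothOn_christoffel (i j k : Fin 4) : CMDiff[U] ∞ (christoffel e i j k) :=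
  smoothOn_inner (he.smoothOn_nabla (he.smooth i) (he.smooth j)) (he.smooth k)

theorem smoothOn_frameDeriv (i : Fin 4) {f : M → ℝ} (hf : CMDiff[U] ∞ f) :
    CMDiff[U] ∞ (frameDeriv e i f) :=
  he.smoothOn_deriv hf (he.smooth i)

theorem smoothOn_bracketCoeff (i j k : Fin 4) : CMDiff[U] ∞ (bracketCoeff e i j k) :=
  (he.smoothOn_christoffel i j k).sub (he.smoothOn_christoffel j i k)

theorem frameDeriv_congr (i : Fin 4) {f g : M → ℝ} (h : ∀ y ∈ U, f y = g y) {x : M}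
    (hx : x ∈ U) : frameDeriv e i f x = frameDeriv e i g x := by
  rw [frameDeriv, mvfderiv_congr_of_eqOn he.isOpen hx h, frameDeriv]

theorem frameDeriv_add (i : Fin 4) {f g : M → ℝ} (hf : CMDiff[U] ∞ f) (hg : CMDiff[U] ∞ g)
    {x : M} (hx : x ∈ U) :
    frameDeriv e i (fun y => f y + g y) x = frameDeriv e i f x + frameDeriv e i g x := by
  simp [frameDeriv, mvfderiv_fun_add (mdiffAt_of_smoothOn he.isOpen hf hx)
    (mdiffAt_of_smoothOn he.isOpen hg hx)]

theorem frameDeriv_sub (i : Fin 4) {f g : M → ℝ} (hf : CMDiff[U] ∞ f) (hg : CMDiff[U] ∞ g)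
    {x : M} (hx : x ∈ U) :
    frameDeriv e i (fun y => f y - g y) x = frameDeriv e i f x - frameDeriv e i g x := by
  simp [frameDeriv, mvfderiv_fun_sub (mdiffAt_of_smoothOn he.isOpen hf hx)
    (mdiffAt_of_smoothOn he.isOpen hg hx)]

theorem frameDeriv_mul (i : Fin 4) {f g : M → ℝ} (hf : CMDiff[U] ∞ f) (hg : CMDiff[U] ∞ g)
    {x : M} (hx : x ∈ U) :
    frameDeriv e i (fun y => f y * g y) x
      = f x * frameDeriv e i g x + g x * frameDeriv e i f x := by
  simp [frameDeriv, mvfderiv_fun_mul (mdiffAt_of_smoothOn he.isOpen hf hx)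
    (mdiffAt_of_smoothOn he.isOpen hg hx)]

omit he in
theorem _root_.AKFour.frameDeriv_const (e : Fin 4 → Π x : M, TangentSpace I x) (i : Fin 4) (c : ℝ)
    (x : M) : frameDeriv e i (fun _ => c) x = 0 := by
  rw [frameDeriv, mvfderiv_const]
  rfl

theorem frameDeriv_neg (i : Fin 4) {f : M → ℝ} (hf : CMDiff[U] ∞ f)
    {x : M} (hx : x ∈ U) : frameDeriv e i (fun y => -f y) x = -frameDeriv e i f x := by
  have h := he.frameDeriv_sub i (contMDiffOn_const (c := (0 : ℝ))) hf hx
  simpa [frameDeriv_const] using h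

theorem christoffel_skew (i j k : Fin 4) {x : M} (hx : x ∈ U) :
    christoffel e i j k x = - christoffel e i k j x := by
  have h := mvfderiv_inner (he.mdiffAt i hx) (he.mdiffAt j hx) (he.mdiffAt k hx)
  rw [mvfderiv_congr_of_eqOn he.isOpen hx (fun y hy => he.inner_eq y hy j k)] at h
  rw [mvfderiv_const, real_inner_comm (nabla (e i) (e k) x)] at h
  simp only [zero_apply] at h
  rw [christoffel, christoffel]
  linarith

theorem christoffel_self (i j : Fin 4) {x : M} (hx : x ∈ U) : christoffel e i j j x = 0 := by
  have := he.christoffel_skew i j j hx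
  linarith

theorem nabla_frame (i j : Fin 4) {x : M} (hx : x ∈ U) :
    nabla (e i) (e j) x = ∑ k, christoffel e i j k x • e k x := by
  rw [he.expand x hx (nabla (e i) (e j) x)]
  simp only [christoffel, real_inner_comm]

theorem mlieBracket_frame (i j : Fin 4) {x : M} (hx : x ∈ U) :
    mlieBracket I (e i) (e j) x = ∑ k, bracketCoeff e i j k x • e k x := by
  rw [← nabla_sub_nabla (he.mdiffAt i hx) (he.mdiffAt j hx), he.nabla_frame i j hx,
    he.nabla_frame j i hx, ← Finset.sum_sub_distrib]
  simp only [bracketCoeff, sub_smul]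

theorem frameDeriv_comm (i j : Fin 4) {f : M → ℝ} (hf : CMDiff[U] ∞ f) {x : M} (hx : x ∈ U) :
    frameDeriv e i (frameDeriv e j f) x - frameDeriv e j (frameDeriv e i f) x
      = ∑ m, bracketCoeff e i j m x * frameDeriv e m f x := by
  have h := he.mvfderiv_mlieBracket hf (he.smooth i) (he.smooth j) hx
  rw [he.mlieBracket_frame i j hx, map_sum] at h
  simp only [map_smul, smul_eq_mul] at h
  exact h.symm

theorem bracketCoeff_eq_inner (i j k : Fin 4) {x : M} (hx : x ∈ U) :
    bracketCoeff e i j k x = inner ℝ (e k x) (mlieBracket I (e i) (e j) x) := by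
  rw [he.mlieBracket_frame i j hx, he.inner_sum_frame hx]

/-- The outer bracket is written as a difference of covariant derivatives, the first computed by the
metric property. Skewness of the coefficients then recombines them into structure functions. -/
theorem inner_mlieBracket_mlieBracket (i j k n : Fin 4) {x : M} (hx : x ∈ U) :
    (inner ℝ (e n x) (mlieBracket I (e k) (mlieBracket I (e i) (e j)) x) : ℝ)
      = frameDeriv e k (bracketCoeff e i j n) x
        + ∑ m, bracketCoeff e i j m x * bracketCoeff e k m n x := by
  have hU := he.isOpen
  have : CompleteSpace E := FiniteDimensional.complete ℝ E
  have hs : CMDiff[U] ∞ (T% (mlieBracket I (e i) (e j))) :=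
    smoothOn_mlieBracket hU (he.smooth i) (he.smooth j)
  rw [← nabla_sub_nabla (he.mdiffAt k hx) (mdiffAt_field_of_smoothOn hU hs hx), inner_sub_right]
  have h1 := mvfderiv_inner (he.mdiffAt k hx) (he.mdiffAt n hx)
    (mdiffAt_field_of_smoothOn hU hs hx)
  rw [mvfderiv_congr_of_eqOn hU hx (g := bracketCoeff e i j n)
    (fun y hy => (he.bracketCoeff_eq_inner i j n hy).symm)] at h1
  have h2 : (inner ℝ (nabla (e k) (e n) x) (mlieBracket I (e i) (e j) x) : ℝ)
      = ∑ m, bracketCoeff e i j m x * christoffel e k n m x := by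
    rw [he.mlieBracket_frame i j hx, inner_sum]
    simp only [inner_smul_right, christoffel]
  have h3 : (inner ℝ (e n x) (nabla (mlieBracket I (e i) (e j)) (e k) x) : ℝ)
      = ∑ m, bracketCoeff e i j m x * christoffel e m k n x := by
    rw [nabla, he.mlieBracket_frame i j hx, map_sum, inner_sum]
    simp only [map_smul, inner_smul_right, christoffel, nabla, real_inner_comm]
  rw [h3]
  rw [h2] at h1
  have h4 : (inner ℝ (e n x) (nabla (e k) (mlieBracket I (e i) (e j)) x) : ℝ)
      = frameDeriv e k (bracketCoeff e i j n) x
        - ∑ m, bracketCoeff e i j m x * christoffel e k n m x := by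
    rw [frameDeriv]; linarith
  rw [h4, sub_sub, ← Finset.sum_add_distrib, sub_eq_add_neg, ← Finset.sum_neg_distrib]
  congr 1
  refine Finset.sum_congr rfl fun m _ => ?_
  rw [bracketCoeff, bracketCoeff, he.christoffel_skew k n m hx]
  ring

/-- The Jacobi identity in components; it supplies the zeroth-order part of d² = 0. -/
theorem bracketCoeff_jacobi (i j k n : Fin 4) {x : M} (hx : x ∈ U) :
    frameDeriv e k (bracketCoeff e i j n) x + frameDeriv e i (bracketCoeff e j k n) x
      + frameDeriv e j (bracketCoeff e k i n) x
      + ∑ m, (bracketCoeff e i j m x * bracketCoeff e k m n x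
        + bracketCoeff e j k m x * bracketCoeff e i m n x
        + bracketCoeff e k i m x * bracketCoeff e j m n x) = 0 := by
  have hU := he.isOpen
  have hJ := jacobi_mlieBracket hU (he.smooth k) (he.smooth i) (he.smooth j) hx
  have h1 : mlieBracket I (e i) (mlieBracket I (e k) (e j)) x
      = - mlieBracket I (e i) (mlieBracket I (e j) (e k)) x := by
    rw [mlieBracket_swap (V := e k), ← neg_one_smul ℝ (mlieBracket I (e j) (e k)),
      VectorField.mlieBracket_const_smul_right (mdiffAt_field_of_smoothOn hU
        (smoothOn_mlieBracket hU (he.smooth j) (he.smooth k)) hx)]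
    simp
  rw [h1, mlieBracket_swap_apply (W := e j)] at hJ
  have h := congrArg (fun v => (inner ℝ (e n x) v : ℝ)) hJ
  simp only [inner_add_right, inner_neg_right] at h
  rw [he.inner_mlieBracket_mlieBracket i j k n hx, he.inner_mlieBracket_mlieBracket j k i n hx,
    he.inner_mlieBracket_mlieBracket k i j n hx] at h
  simp only [Finset.sum_add_distrib]
  linarith

theorem smoothOn_finsum {f : Fin 4 → M → ℝ} (hf : ∀ i, CMDiff[U] ∞ (f i)) :
    CMDiff[U] ∞ (fun y => ∑ i, f i y) := by
  simp only [Fin.sum_univ_four]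
  exact (((hf 0).add (hf 1)).add (hf 2)).add (hf 3)

theorem smoothOn_dOneForm {η : Fin 4 → M → ℝ} (hη : ∀ m, CMDiff[U] ∞ (η m)) (i j : Fin 4) :
    CMDiff[U] ∞ (dOneForm e η i j) :=
  ((he.smoothOn_frameDeriv i (hη j)).sub (he.smoothOn_frameDeriv j (hη i))).sub
    (he.smoothOn_finsum fun m => (he.smoothOn_bracketCoeff i j m).mul (hη m))

theorem frameDeriv_dOneForm {η : Fin 4 → M → ℝ} (hη : ∀ m, CMDiff[U] ∞ (η m)) (i j k : Fin 4)
    {x : M} (hx : x ∈ U) :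
    frameDeriv e k (dOneForm e η i j) x =
      frameDeriv e k (frameDeriv e i (η j)) x - frameDeriv e k (frameDeriv e j (η i)) x
      - ∑ m, (bracketCoeff e i j m x * frameDeriv e k (η m) x
        + η m x * frameDeriv e k (bracketCoeff e i j m) x) := by
  have h1 := he.smoothOn_frameDeriv i (hη j)
  have h2 := he.smoothOn_frameDeriv j (hη i)
  have h3 : ∀ m, CMDiff[U] ∞ (fun y => bracketCoeff e i j m y * η m y) := fun m =>
    (he.smoothOn_bracketCoeff i j m).mul (hη m)
  have h4 := he.frameDeriv_sub k (h1.sub h2) (he.smoothOn_finsum h3) hx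
  have h5 := he.frameDeriv_sub k h1 h2 hx
  have h6 : frameDeriv e k (fun y => ∑ m, bracketCoeff e i j m y * η m y) x
      = ∑ m, frameDeriv e k (fun y => bracketCoeff e i j m y * η m y) x := by
    simp only [Fin.sum_univ_four]
    have a1 := he.frameDeriv_add k (((h3 0).add (h3 1)).add (h3 2)) (h3 3) hx
    have a2 := he.frameDeriv_add k ((h3 0).add (h3 1)) (h3 2) hx
    have a3 := he.frameDeriv_add k (h3 0) (h3 1) hx
    exact a1.trans (by rw [← a3]; exact congrArg (· + _) a2)
  refine h4.trans ?_
  rw [h6]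
  simp only [he.frameDeriv_mul k (he.smoothOn_bracketCoeff i j _) (hη _) hx]
  congr 1

/-- The exterior derivative squares to zero on one-forms. -/
theorem d_dOneForm {η : Fin 4 → M → ℝ} (hη : ∀ m, CMDiff[U] ∞ (η m)) (i j k : Fin 4)
    {x : M} (hx : x ∈ U) :
    frameDeriv e k (dOneForm e η i j) x + frameDeriv e i (dOneForm e η j k) x
      + frameDeriv e j (dOneForm e η k i) x
      - ∑ m, (bracketCoeff e k i m x * dOneForm e η m j x
        + bracketCoeff e i j m x * dOneForm e η m k x
        + bracketCoeff e j k m x * dOneForm e η m i x) = 0 := by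
  rw [he.frameDeriv_dOneForm hη i j k hx, he.frameDeriv_dOneForm hη j k i hx,
    he.frameDeriv_dOneForm hη k i j hx]
  have c1 := he.frameDeriv_comm k i (hη j) hx
  have c2 := he.frameDeriv_comm i j (hη k) hx
  have c3 := he.frameDeriv_comm j k (hη i) hx
  have J := fun n => he.bracketCoeff_jacobi i j k n hx
  have s : ∀ m n, ∀ p, bracketCoeff e m n p x = - bracketCoeff e n m p x := fun m n p => by
    simp [bracketCoeff]
  simp only [dOneForm, Fin.sum_univ_four] at c1 c2 c3 J ⊢
  have J0 := J 0
  have J1 := J 1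
  have J2 := J 2
  have J3 := J 3
  rw [s k 0, s k 1, s k 2, s k 3, s i 0, s i 1, s i 2, s i 3, s j 0, s j 1, s j 2, s j 3]
    at J0 J1 J2 J3
  -- The commutators cancel the second derivatives of η against first ones; the remaining
  -- coefficient of each η_n is a Jacobi relation for the structure functions.
  linear_combination c1 + c2 + c3 - η 0 x * J0 - η 1 x * J1 - η 2 x * J2 - η 3 x * J3

theorem inner_nabla_nabla (i j k l : Fin 4) {x : M} (hx : x ∈ U) :
    (inner ℝ (nabla (e i) (nabla (e j) (e k)) x) (e l x) : ℝ)
      = frameDeriv e i (christoffel e j k l) x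
        - ∑ m, christoffel e j k m x * christoffel e i l m x := by
  have hs := mdiffAt_field_of_smoothOn he.isOpen (he.smoothOn_nabla (he.smooth j) (he.smooth k)) hx
  have h1 := mvfderiv_inner (he.mdiffAt i hx) hs (he.mdiffAt l hx)
  have h2 : (inner ℝ (nabla (e j) (e k) x) (nabla (e i) (e l) x) : ℝ)
      = ∑ m, christoffel e j k m x * christoffel e i l m x := by
    rw [he.inner_eq_sum hx]
    simp only [christoffel, real_inner_comm]
  rw [h2] at h1
  change frameDeriv e i (christoffel e j k l) x = _ at h1
  linarith

/-- The structure equation: the curvature in terms of the connection coefficients. -/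
theorem curvatureCoeff_eq (i j k l : Fin 4) {x : M} (hx : x ∈ U) :
    curvatureCoeff e i j k l x =
      -(frameDeriv e i (christoffel e j k l) x - frameDeriv e j (christoffel e i k l) x
        - ∑ m, (christoffel e j k m x * christoffel e i l m x
          - christoffel e i k m x * christoffel e j l m x
          + bracketCoeff e i j m x * christoffel e m k l x)) := by
  have h3 : (inner ℝ (nabla (mlieBracket I (e i) (e j)) (e k) x) (e l x) : ℝ)
      = ∑ m, bracketCoeff e i j m x * christoffel e m k l x := by
    rw [nabla, he.mlieBracket_frame i j hx, map_sum, sum_inner]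
    simp [inner_smul_left, christoffel, nabla]
  rw [curvatureCoeff, curvatureTensor, he.curvatureEnd_frame hx, riem, inner_sub_left,
    inner_sub_left, he.inner_nabla_nabla i j k l hx, he.inner_nabla_nabla j i k l hx, h3]
  simp only [Finset.sum_add_distrib, Finset.sum_sub_distrib]
  ring

theorem curvatureCoeff_skew_left (i j k l : Fin 4) {x : M} (hx : x ∈ U) :
    curvatureCoeff e i j k l x = - curvatureCoeff e j i k l x := by
  simp only [curvatureCoeff, curvatureTensor, he.curvatureEnd_frame hx]
  rw [riem_swap, inner_neg_left]

theorem curvatureCoeff_skew_right (i j k l : Fin 4) {x : M} (hx : x ∈ U) :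
    curvatureCoeff e i j k l x = - curvatureCoeff e i j l k x := by
  have h : ∀ i j, frameDeriv e i (christoffel e j k l) x
      = - frameDeriv e i (christoffel e j l k) x := fun i j => by
    rw [← he.frameDeriv_neg i (he.smoothOn_christoffel j l k) hx]
    exact he.frameDeriv_congr i (fun y hy => he.christoffel_skew j k l hy) hx
  rw [he.curvatureCoeff_eq i j k l hx, he.curvatureCoeff_eq i j l k hx, h, h]
  simp only [he.christoffel_skew _ k l hx, Finset.sum_add_distrib, Finset.sum_sub_distrib,
    mul_neg, Finset.sum_neg_distrib, mul_comm (christoffel e i k _ x)]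
  simp only [mul_comm]
  ring

theorem curvatureCoeff_cyclic (i j k l : Fin 4) {x : M} (hx : x ∈ U) :
    curvatureCoeff e i j k l x + curvatureCoeff e j k i l x + curvatureCoeff e k i j l x = 0 := by
  simp only [curvatureCoeff, curvatureTensor, he.curvatureEnd_frame hx]
  rw [← neg_add, ← neg_add, ← inner_add_left, ← inner_add_left,
    he.riem_cyclic (he.smooth i) (he.smooth j) (he.smooth k) hx]
  simp

/-- The usual octahedron argument: four instances of the Bianchi identity combined with both skew
symmetries. -/
theorem curvatureCoeff_pair (i j k l : Fin 4) {x : M} (hx : x ∈ U) :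
    curvatureCoeff e i j k l x = curvatureCoeff e k l i j x := by
  have b := fun i j k l => he.curvatureCoeff_cyclic i j k l hx
  have s := fun i j k l => he.curvatureCoeff_skew_left i j k l hx
  have t := fun i j k l => he.curvatureCoeff_skew_right i j k l hx
  linarith [b i j k l, b j k l i, b k l i j, b l i j k, s i j k l, s j k i l, s k i j l,
    s j k l i, s k l j i, s l j k i, s k l i j, s l i k j, s i k l j, s l i j k, s i j l k,
    s j l i k, t i j k l, t j k i l, t k i j l, t j k l i, t k l j i, t l j k i, t k l i j,
    t l i k j, t i k l j, t l i j k, t i j l k, t j l i k]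

theorem curvatureTensor_eq_sum {x : M} (hx : x ∈ U) (u v w z : TangentSpace I x) :
    curvatureTensor x u v w z = ∑ i, ∑ j, ∑ k, ∑ l, (inner ℝ (e i x) u : ℝ) * inner ℝ (e j x) v
      * inner ℝ (e k x) w * inner ℝ (e l x) z * curvatureCoeff e i j k l x := by
  rw [curvatureTensor, he.curvatureEnd_eq_sum hx]
  simp only [sum_inner, ← Finset.sum_neg_distrib]
  refine Finset.sum_congr rfl fun i _ => Finset.sum_congr rfl fun j _ =>
    Finset.sum_congr rfl fun k _ => ?_
  rw [he.inner_eq_sum hx, ← Finset.sum_neg_distrib]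
  refine Finset.sum_congr rfl fun l _ => ?_
  simp only [curvatureCoeff, curvatureTensor, he.curvatureEnd_frame hx, inner_smul_right,
    real_inner_comm]
  ring

end IsOrthonormalFrame

end Components

/-! ### Smooth endomorphism fields and their covariant derivatives -/

section Endomorphisms

variable {E : Type*} [NormedAddCommGroup E] [NormedSpace ℝ E]
  {H : Type*} [TopologicalSpace H] {I : ModelWithCorners ℝ E H}
  {M : Type*} [TopologicalSpace M] [ChartedSpace H M] [IsManifold I ∞ M]
  [FiniteDimensional ℝ E]

/-- A smooth field of endomorphisms maps smooth vector fields to smooth vector fields. -/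
theorem smoothOn_apply {A : Π x : M, TangentSpace I x →L[ℝ] TangentSpace I x}
    (hA : ContMDiff I (I.prod 𝓘(ℝ, E →L[ℝ] E)) ∞
      (fun x => TotalSpace.mk' (E →L[ℝ] E)
        (E := fun x : M => TangentSpace I x →L[ℝ] TangentSpace I x) x (A x)))
    {U : Set M} {X : Π x : M, TangentSpace I x} (hX : CMDiff[U] ∞ (T% X)) :
    CMDiff[U] ∞ (T% (fun x => A x (X x))) :=
  ContMDiffOn.clm_bundle_apply (E₁ := fun x : M => TangentSpace I x)
    (E₂ := fun x : M => TangentSpace I x) (b := fun x => x) hA.contMDiffOn hX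

theorem mdiffAt_apply {A : Π x : M, TangentSpace I x →L[ℝ] TangentSpace I x}
    (hA : ContMDiff I (I.prod 𝓘(ℝ, E →L[ℝ] E)) ∞
      (fun x => TotalSpace.mk' (E →L[ℝ] E)
        (E := fun x : M => TangentSpace I x →L[ℝ] TangentSpace I x) x (A x)))
    {x : M} {X : Π x : M, TangentSpace I x} (hX : MDiffAt (T% X) x) :
    MDiffAt (T% (fun x => A x (X x))) x :=
  MDifferentiableAt.clm_bundle_apply (E₁ := fun x : M => TangentSpace I x)
    (E₂ := fun x : M => TangentSpace I x) (b := fun x => x)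
    (hA.mdifferentiableAt (by simp)) hX

variable [RiemannianBundle (fun x : M => TangentSpace I x)]
  [IsContMDiffRiemannianBundle I ∞ E (fun x : M => TangentSpace I x)]

/-- A field of endomorphisms is smooth as soon as it maps a smooth local frame to smooth
fields. -/
theorem IsOrthonormalFrame.contMDiffAt_hom {U : Set M} {e : Fin 4 → Π x : M, TangentSpace I x}
    (he : IsOrthonormalFrame U e) {A : Π x : M, TangentSpace I x →L[ℝ] TangentSpace I x}
    (hA : ∀ i, CMDiff[U] ∞ (T% (fun x => A x (e i x)))) {x : M} (hx : x ∈ U) :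
    ContMDiffAt I (I.prod 𝓘(ℝ, E →L[ℝ] E)) ∞
      (fun x => TotalSpace.mk' (E →L[ℝ] E)
        (E := fun x : M => TangentSpace I x →L[ℝ] TangentSpace I x) x (A x)) x := by
  rw [contMDiffAt_hom_bundle]
  refine ⟨contMDiffAt_id, ?_⟩
  set t := trivializationAt E (fun x : M => TangentSpace I x) x
  have hxt : x ∈ t.baseSet := FiberBundle.mem_baseSet_trivializationAt' x
  -- In the trivialization at x, the field `extend E w` is the constant vector v. So this column of
  -- the coordinate matrix is the coordinate expression of `A` applied to that field, which is
  -- smooth by expansion in the frame.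
  have key : ∀ v : E, ContMDiffAt I 𝓘(ℝ, E) ∞ (fun y =>
      ContinuousLinearMap.inCoordinates E (fun x : M => TangentSpace I x) E
        (fun x : M => TangentSpace I x) x y x y (A y) v) x := by
    intro v
    set w : TangentSpace I x := t.symm x v
    obtain ⟨V, hV, hs⟩ := exists_contMDiffOn_extend (k := ∞) I E w
    have h1 : CMDiffAt ∞ (T% (fun y => A y (extend E w y))) x := by
      have h2 : ∀ i, CMDiffAt ∞ (fun y => (inner ℝ (e i y) (extend E w y) : ℝ)) x := fun i =>
        ContMDiffAt.inner_bundle (IB := I) (F := E) (E := fun x : M => TangentSpace I x)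
          (b := fun x => x) ((he.smooth i).contMDiffAt (he.isOpen.mem_nhds hx))
          (contMDiffAt_extend I E w)
      have h3 : CMDiffAt ∞ (T% (fun y => ∑ i,
          (inner ℝ (e i y) (extend E w y) : ℝ) • A y (e i y))) x :=
        ContMDiffAt.sum_section (t := fun i y =>
          (inner ℝ (e i y) (extend E w y) : ℝ) • A y (e i y)) fun i _ =>
          (h2 i).smul_section ((hA i).contMDiffAt (he.isOpen.mem_nhds hx))
      refine h3.congr_of_eventuallyEq (Filter.eventuallyEq_of_mem (he.isOpen.mem_nhds hx) ?_)
      intro y hy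
      have : A y (extend E w y) = ∑ i, (inner ℝ (e i y) (extend E w y) : ℝ) • A y (e i y) := by
        conv_lhs => rw [he.expand y hy (extend E w y), map_sum]
        simp only [map_smul]
      simp only [this]
    rw [contMDiffAt_section] at h1
    refine h1.congr_of_eventuallyEq
      (Filter.eventuallyEq_of_mem (t.open_baseSet.mem_nhds hxt) fun y hy => ?_)
    have h4 : (t ⟨x, w⟩).2 = v := by
      simpa [w] using congrArg Prod.snd (t.apply_mk_symm hxt v)
    rw [ContinuousLinearMap.inCoordinates_eq hy hy]
    simp [extend, h4, t]
  let b := Module.finBasis ℝ E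
  -- A linear map depends linearly, hence smoothly, on its finitely many columns.
  have hsum : ∀ L : E →L[ℝ] E, L = ∑ i, ContinuousLinearMap.smulRightL ℝ E E
      (LinearMap.toContinuousLinearMap (b.coord i)) (L (b i)) := by
    intro L
    ext v
    conv_lhs => rw [← b.sum_repr v, map_sum]
    simp
  have h5 : ContMDiffAt I 𝓘(ℝ, E →L[ℝ] E) ∞ (fun y => ∑ i, ContinuousLinearMap.smulRightL ℝ E E
      (LinearMap.toContinuousLinearMap (b.coord i))
      (ContinuousLinearMap.inCoordinates E (fun x : M => TangentSpace I x) E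
        (fun x : M => TangentSpace I x) x y x y (A y) (b i))) x :=
    contMDiffAt_finsetSum fun i _ =>
      (ContinuousLinearMap.contMDiff _).contMDiffAt.comp x (key (b i))
  refine h5.congr_of_eventuallyEq (Filter.Eventually.of_forall fun y => ?_)
  exact hsum _

theorem tensorialAt_covDerivEnd {A : Π x : M, TangentSpace I x →L[ℝ] TangentSpace I x} {x : M}
    (hA : ContMDiff I (I.prod 𝓘(ℝ, E →L[ℝ] E)) ∞
      (fun x => TotalSpace.mk' (E →L[ℝ] E)
        (E := fun x : M => TangentSpace I x →L[ℝ] TangentSpace I x) x (A x))) :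
    TensorialAt I E (fun Y : Π x : M, TangentSpace I x =>
      leviCivita I M (fun y => A y (Y y)) x - A x ∘L leviCivita I M Y x) x where
  smul {f Y} hf hY := by
    have h1 : (fun y => A y ((f • Y) y)) = f • (fun y => A y (Y y)) := by ext y; simp
    rw [h1, (leviCivita I M).isCovariantDerivativeOnUniv.leibniz hY hf,
      (leviCivita I M).isCovariantDerivativeOnUniv.leibniz (mdiffAt_apply hA hY) hf]
    ext v
    simp
    module
  add {Y Y'} hY hY' := by
    have h1 : (fun y => A y ((Y + Y') y)) = (fun y => A y (Y y)) + (fun y => A y (Y' y)) := by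
      ext y; simp
    rw [h1, (leviCivita I M).isCovariantDerivativeOnUniv.add hY hY',
      (leviCivita I M).isCovariantDerivativeOnUniv.add (mdiffAt_apply hA hY)
        (mdiffAt_apply hA hY')]
    ext v
    simp
    abel

/-- `w ↦ (u ↦ (∇_u A) w)` as a linear map. -/
def covDerivHom {A : Π x : M, TangentSpace I x →L[ℝ] TangentSpace I x}
    (hA : ContMDiff I (I.prod 𝓘(ℝ, E →L[ℝ] E)) ∞
      (fun x => TotalSpace.mk' (E →L[ℝ] E)
        (E := fun x : M => TangentSpace I x →L[ℝ] TangentSpace I x) x (A x))) (x : M) :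
    TangentSpace I x →L[ℝ] TangentSpace I x →L[ℝ] TangentSpace I x :=
  TensorialAt.mkHom _ x (tensorialAt_covDerivEnd hA)

theorem covDerivHom_apply {A : Π x : M, TangentSpace I x →L[ℝ] TangentSpace I x}
    (hA : ContMDiff I (I.prod 𝓘(ℝ, E →L[ℝ] E)) ∞
      (fun x => TotalSpace.mk' (E →L[ℝ] E)
        (E := fun x : M => TangentSpace I x →L[ℝ] TangentSpace I x) x (A x))) (x : M)
    (w : TangentSpace I x) : covDerivHom hA x w = covDerivEnd A x w :=
  rfl

theorem covDerivEnd_apply {A : Π x : M, TangentSpace I x →L[ℝ] TangentSpace I x} {x : M}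
    (hA : ContMDiff I (I.prod 𝓘(ℝ, E →L[ℝ] E)) ∞
      (fun x => TotalSpace.mk' (E →L[ℝ] E)
        (E := fun x : M => TangentSpace I x →L[ℝ] TangentSpace I x) x (A x)))
    (X : Π x : M, TangentSpace I x) {Y : Π x : M, TangentSpace I x} (hY : MDiffAt (T% Y) x) :
    covDerivEnd A x (Y x) (X x) = nabla X (fun y => A y (Y y)) x - A x (nabla X Y x) := by
  rw [← covDerivHom_apply hA, covDerivHom, TensorialAt.mkHom_apply _ hY]
  simp [nabla]

/-- The exterior derivative of `g(A·, ·)` in terms of `∇A`, for skew-adjoint `A`. -/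
theorem dTwoForm_fundForm {A : Π x : M, TangentSpace I x →L[ℝ] TangentSpace I x} {x : M}
    (hA : ContMDiff I (I.prod 𝓘(ℝ, E →L[ℝ] E)) ∞
      (fun x => TotalSpace.mk' (E →L[ℝ] E)
        (E := fun x : M => TangentSpace I x →L[ℝ] TangentSpace I x) x (A x)))
    (hskew : ∀ u v : TangentSpace I x, (inner ℝ (A x u) v : ℝ) = - inner ℝ (A x v) u)
    {X Y Z : Π x : M, TangentSpace I x} (hX : MDiffAt (T% X) x) (hY : MDiffAt (T% Y) x)
    (hZ : MDiffAt (T% Z) x) :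
    dTwoForm (fun y => fundForm (A y)) X Y Z x =
      inner ℝ (covDerivEnd A x (Y x) (X x)) (Z x) - inner ℝ (covDerivEnd A x (X x) (Y x)) (Z x)
        + inner ℝ (covDerivEnd A x (X x) (Z x)) (Y x) := by
  simp only [dTwoForm, fundForm]
  rw [mvfderiv_inner hX (mdiffAt_apply hA hY) hZ, mvfderiv_inner hY (mdiffAt_apply hA hX) hZ,
    mvfderiv_inner hZ (mdiffAt_apply hA hX) hY, covDerivEnd_apply hA X hY,
    covDerivEnd_apply hA Y hX, covDerivEnd_apply hA Z hX, ← nabla_sub_nabla hX hY,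
    ← nabla_sub_nabla hX hZ, ← nabla_sub_nabla hY hZ]
  simp only [map_sub, inner_sub_left]
  rw [hskew (Y x) (nabla X Z x), hskew (X x) (nabla Y Z x), hskew (X x) (nabla Z Y x)]
  ring

theorem skew_of_orthogonal {V : Type*} [NormedAddCommGroup V] [InnerProductSpace ℝ V]
    {A : V →L[ℝ] V} (hsq : ∀ u, A (A u) = -u)
    (ho : ∀ u v, (inner ℝ (A u) (A v) : ℝ) = inner ℝ u v) (u v : V) :
    (inner ℝ (A u) v : ℝ) = - inner ℝ (A v) u := by
  rw [← ho (A u) v, hsq, inner_neg_left, real_inner_comm]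

/-- The frame components `g((∇_{e_i} A) e_j, e_k)` for an endomorphism field whose matrix in the
frame is the constant matrix `c`. -/
def covDerivCoeff (e : Fin 4 → Π x : M, TangentSpace I x) (c : Fin 4 → Fin 4 → ℝ)
    (i j k : Fin 4) (x : M) : ℝ :=
  ∑ m, (c j m * christoffel e i m k x - christoffel e i j m x * c m k)

namespace IsOrthonormalFrame

variable {U : Set M} {e : Fin 4 → Π x : M, TangentSpace I x} (he : IsOrthonormalFrame U e)
include he

theorem nabla_sum (i : Fin 4) (a : Fin 4 → ℝ) {x : M} (hx : x ∈ U) :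
    nabla (e i) (fun y => ∑ m, a m • e m y) x = ∑ m, a m • nabla (e i) (e m) x := by
  have hs : ∀ m, MDiffAt (T% (fun y => a m • e m y)) x := fun m =>
    mdifferentiableAt_const.smul_section (he.mdiffAt m hx)
  have h : ∀ m, nabla (e i) (fun y => a m • e m y) x = a m • nabla (e i) (e m) x := fun m => by
    have := nabla_smul_right (X := e i) (f := fun _ : M => a m) mdifferentiableAt_const
      (he.mdiffAt m hx)
    rw [mvfderiv_const] at this
    refine this.trans ?_
    simp
  simp only [Fin.sum_univ_four]
  have a1 := nabla_add_right (X := e i)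
    (mdifferentiableAt_add_section (mdifferentiableAt_add_section (hs 0) (hs 1)) (hs 2)) (hs 3)
  have a2 := nabla_add_right (X := e i) (mdifferentiableAt_add_section (hs 0) (hs 1)) (hs 2)
  have a3 := nabla_add_right (X := e i) (hs 0) (hs 1)
  rw [a2, a3, h, h, h, h] at a1
  exact a1

theorem inner_covDerivEnd_frame {A : Π x : M, TangentSpace I x →L[ℝ] TangentSpace I x}
    (hA : ContMDiff I (I.prod 𝓘(ℝ, E →L[ℝ] E)) ∞
      (fun x => TotalSpace.mk' (E →L[ℝ] E)
        (E := fun x : M => TangentSpace I x →L[ℝ] TangentSpace I x) x (A x)))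
    {c : Fin 4 → Fin 4 → ℝ} (hc : ∀ x ∈ U, ∀ j, A x (e j x) = ∑ m, c j m • e m x)
    (i j k : Fin 4) {x : M} (hx : x ∈ U) :
    (inner ℝ (covDerivEnd A x (e j x) (e i x)) (e k x) : ℝ) = covDerivCoeff e c i j k x := by
  rw [covDerivEnd_apply hA (e i) (he.mdiffAt j hx),
    nabla_congr_right he.isOpen (mdiffAt_apply hA (he.mdiffAt j hx))
      (mdiffAt_field_of_smoothOn he.isOpen (he.smoothOn_sum (f := fun m _ => c j m)
        fun m => contMDiffOn_const) hx) hx (fun y hy => hc y hy j),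
    he.nabla_sum i (c j) hx, he.nabla_frame i j hx, inner_sub_left, map_sum, sum_inner, sum_inner,
    covDerivCoeff, Finset.sum_sub_distrib]
  congr 1
  · simp [inner_smul_left, christoffel]
  · refine Finset.sum_congr rfl fun m _ => ?_
    rw [map_smul, inner_smul_left, hc x hx, real_inner_comm, he.inner_sum_frame hx (c m)]
    simp

theorem inner_covDerivEnd {A : Π x : M, TangentSpace I x →L[ℝ] TangentSpace I x}
    (hA : ContMDiff I (I.prod 𝓘(ℝ, E →L[ℝ] E)) ∞
      (fun x => TotalSpace.mk' (E →L[ℝ] E)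
        (E := fun x : M => TangentSpace I x →L[ℝ] TangentSpace I x) x (A x)))
    {c : Fin 4 → Fin 4 → ℝ} (hc : ∀ x ∈ U, ∀ j, A x (e j x) = ∑ m, c j m • e m x)
    {x : M} (hx : x ∈ U) (u v w : TangentSpace I x) :
    (inner ℝ (covDerivEnd A x v u) w : ℝ) = ∑ i, ∑ j, ∑ k, (inner ℝ (e i x) u : ℝ)
      * inner ℝ (e j x) v * inner ℝ (e k x) w * covDerivCoeff e c i j k x := by
  rw [← covDerivHom_apply hA]
  conv_lhs => rw [he.expand x hx v, he.expand x hx u, he.expand x hx w]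
  simp only [map_sum, map_smul, sum_apply, smul_apply,
    sum_inner, inner_sum, inner_smul_left, inner_smul_right, covDerivHom_apply,
    he.inner_covDerivEnd_frame hA hc _ _ _ hx, Finset.smul_sum]
  simp only [Fin.sum_univ_four, starRingEnd_apply, star_trivial]
  ring

theorem dTwoForm_eq_sum {A : Π x : M, TangentSpace I x →L[ℝ] TangentSpace I x}
    (hA : ContMDiff I (I.prod 𝓘(ℝ, E →L[ℝ] E)) ∞
      (fun x => TotalSpace.mk' (E →L[ℝ] E)
        (E := fun x : M => TangentSpace I x →L[ℝ] TangentSpace I x) x (A x)))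
    {c : Fin 4 → Fin 4 → ℝ} (hc : ∀ x ∈ U, ∀ j, A x (e j x) = ∑ m, c j m • e m x)
    {x : M} (hx : x ∈ U)
    (hskew : ∀ u v : TangentSpace I x, (inner ℝ (A x u) v : ℝ) = - inner ℝ (A x v) u)
    {X Y Z : Π x : M, TangentSpace I x} (hX : MDiffAt (T% X) x) (hY : MDiffAt (T% Y) x)
    (hZ : MDiffAt (T% Z) x) :
    dTwoForm (fun y => fundForm (A y)) X Y Z x = ∑ i, ∑ j, ∑ k, (inner ℝ (e i x) (X x) : ℝ)
      * inner ℝ (e j x) (Y x) * inner ℝ (e k x) (Z x) * (covDerivCoeff e c i j k x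
        - covDerivCoeff e c j i k x + covDerivCoeff e c k i j x) := by
  rw [dTwoForm_fundForm hA hskew hX hY hZ, he.inner_covDerivEnd hA hc hx,
    he.inner_covDerivEnd hA hc hx, he.inner_covDerivEnd hA hc hx]
  simp only [Fin.sum_univ_four]
  ring

end IsOrthonormalFrame

end Endomorphisms

/-! ### Frames adapted to the almost complex structure -/

section AdaptedFrames

variable {E : Type*} [NormedAddCommGroup E] [NormedSpace ℝ E]
  {H : Type*} [TopologicalSpace H] {I : ModelWithCorners ℝ E H}
  {M : Type*} [TopologicalSpace M] [ChartedSpace H M] [IsManifold I ∞ M]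
  [FiniteDimensional ℝ E] [RiemannianBundle (fun x : M => TangentSpace I x)]
  [IsContMDiffRiemannianBundle I ∞ E (fun x : M => TangentSpace I x)]

/-- An orthonormal frame of the form `(e_0, J e_0, e_2, J e_2)`. -/
structure IsAdaptedFrame (J : Π x : M, TangentSpace I x →L[ℝ] TangentSpace I x) (U : Set M)
    (e : Fin 4 → Π x : M, TangentSpace I x) : Prop extends IsOrthonormalFrame U e where
  map_zero : ∀ x ∈ U, J x (e 0 x) = e 1 x
  map_two : ∀ x ∈ U, J x (e 2 x) = e 3 x

/-- The matrix of `J` in a `J`-adapted frame. -/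
def adaptedMatrix : Fin 4 → Fin 4 → ℝ :=
  ![![0, 1, 0, 0], ![-1, 0, 0, 0], ![0, 0, 0, 1], ![0, 0, -1, 0]]

theorem isOpen_nonvanishing {U : Set M} (hU : IsOpen U) {X : Π x : M, TangentSpace I x}
    (hX : CMDiff[U] ∞ (T% X)) : IsOpen {x | x ∈ U ∧ X x ≠ 0} := by
  have h := (smoothOn_inner hX hX).continuousOn.isOpen_inter_preimage hU
    (isOpen_compl_singleton (x := (0 : ℝ)))
  convert h using 1
  ext x
  simp

theorem smoothOn_inv_norm {U : Set M} {X : Π x : M, TangentSpace I x}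
    (hX : CMDiff[U] ∞ (T% X)) (h0 : ∀ x ∈ U, X x ≠ 0) : CMDiff[U] ∞ (fun x => ‖X x‖⁻¹) := by
  intro x hx
  have h1 := smoothOn_inner hX hX x hx
  have hne : (inner ℝ (X x) (X x) : ℝ) ≠ 0 := inner_self_ne_zero.2 (h0 x hx)
  have h2 : ContDiffAt ℝ ∞ (fun t : ℝ => (√t)⁻¹) (inner ℝ (X x) (X x)) :=
    (Real.contDiffAt_sqrt hne).inv (by
      rw [Real.sqrt_ne_zero']
      exact lt_of_le_of_ne real_inner_self_nonneg hne.symm)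
  have h3 := h2.contMDiffAt.comp_contMDiffWithinAt x h1
  exact h3.congr (fun y _ => congrArg _ (norm_eq_sqrt_real_inner (X y)))
    (congrArg _ (norm_eq_sqrt_real_inner (X x)))

theorem smoothOn_normalize {U : Set M} {X : Π x : M, TangentSpace I x}
    (hX : CMDiff[U] ∞ (T% X)) (h0 : ∀ x ∈ U, X x ≠ 0) :
    CMDiff[U] ∞ (T% (fun x => ‖X x‖⁻¹ • X x)) :=
  (smoothOn_inv_norm hX h0).smul_section hX

theorem inner_normalize_self {V : Type*} [NormedAddCommGroup V] [InnerProductSpace ℝ V]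
    {v : V} (hv : v ≠ 0) : (inner ℝ (‖v‖⁻¹ • v) (‖v‖⁻¹ • v) : ℝ) = 1 := by
  rw [inner_smul_left, inner_smul_right, real_inner_self_eq_norm_sq]
  have := norm_ne_zero_iff.2 hv
  simp
  field_simp

theorem inner_quadruple {V : Type*} [NormedAddCommGroup V] [InnerProductSpace ℝ V]
    {a b c d : V} (haa : (inner ℝ a a : ℝ) = 1) (hbb : (inner ℝ b b : ℝ) = 1)
    (hcc : (inner ℝ c c : ℝ) = 1) (hdd : (inner ℝ d d : ℝ) = 1) (hab : (inner ℝ a b : ℝ) = 0)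
    (hac : (inner ℝ a c : ℝ) = 0) (had : (inner ℝ a d : ℝ) = 0) (hbc : (inner ℝ b c : ℝ) = 0)
    (hbd : (inner ℝ b d : ℝ) = 0) (hcd : (inner ℝ c d : ℝ) = 0) (i j : Fin 4) :
    (inner ℝ (![a, b, c, d] i) (![a, b, c, d] j) : ℝ) = if i = j then 1 else 0 := by
  have s : ∀ u v : V, (inner ℝ u v : ℝ) = 0 → (inner ℝ v u : ℝ) = 0 := fun u v h => by
    rw [real_inner_comm]; exact h
  fin_cases i <;> fin_cases j
  exacts [haa, hab, hac, had, s _ _ hab, hbb, hbc, hbd, s _ _ hac, s _ _ hbc, hcc, hcd,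
    s _ _ had, s _ _ hbd, s _ _ hcd, hdd]

/-- Two orthogonal complex directions give an adapted frame. -/
theorem isAdaptedFrame_of_pair {J : Π x : M, TangentSpace I x →L[ℝ] TangentSpace I x}
    (hJ : IsAlmostKahler J) (hE : Module.finrank ℝ E = 4) {U : Set M} (hU : IsOpen U)
    {X Y : Π x : M, TangentSpace I x} (hX : CMDiff[U] ∞ (T% X)) (hY : CMDiff[U] ∞ (T% Y))
    (hX1 : ∀ x ∈ U, (inner ℝ (X x) (X x) : ℝ) = 1) (hY1 : ∀ x ∈ U, (inner ℝ (Y x) (Y x) : ℝ) = 1)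
    (hXY : ∀ x ∈ U, (inner ℝ (X x) (Y x) : ℝ) = 0)
    (hJXY : ∀ x ∈ U, (inner ℝ (J x (X x)) (Y x) : ℝ) = 0) :
    IsAdaptedFrame J U ![X, fun x => J x (X x), Y, fun x => J x (Y x)] := by
  have hort : ∀ x ∈ U, ∀ i j, (inner ℝ ((![X, fun x => J x (X x), Y, fun x => J x (Y x)] :
      Fin 4 → Π x : M, TangentSpace I x) i x) ((![X, fun x => J x (X x), Y, fun x => J x (Y x)] :
      Fin 4 → Π x : M, TangentSpace I x) j x) : ℝ) = if i = j then 1 else 0 := by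
    intro x hx i j
    have hs := skew_of_orthogonal (hJ.sq x) (hJ.orthogonal x)
    have ho := hJ.orthogonal x
    have h1 := hX1 x hx
    have h2 := hY1 x hx
    have h3 := hXY x hx
    have h4 := hJXY x hx
    have h5 : (inner ℝ (X x) (J x (X x)) : ℝ) = 0 := by
      have := hs (X x) (X x); rw [real_inner_comm]; linarith
    have h6 : (inner ℝ (Y x) (J x (Y x)) : ℝ) = 0 := by
      have := hs (Y x) (Y x); rw [real_inner_comm]; linarith
    have h7 : (inner ℝ (X x) (J x (Y x)) : ℝ) = 0 := by
      have := hs (Y x) (X x); rw [real_inner_comm, this, h4, neg_zero]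
    have h8 : ∀ i, (![X, fun x => J x (X x), Y, fun x => J x (Y x)] :
        Fin 4 → Π x : M, TangentSpace I x) i x = ![X x, J x (X x), Y x, J x (Y x)] i := by
      intro i; fin_cases i <;> rfl
    rw [h8, h8]
    exact inner_quadruple h1 ((ho _ _).trans h1) h2 ((ho _ _).trans h2) h5 h3 h7 h4
      ((ho _ _).trans h3) h6 i j
  refine { isOpen := hU, smooth := ?_, inner_eq := hort, expand := ?_,
           map_zero := fun x _ => rfl, map_two := fun x _ => rfl }
  · intro i
    fin_cases i
    · exact hX
    · exact smoothOn_apply hJ.smooth hX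
    · exact hY
    · exact smoothOn_apply hJ.smooth hY
  · intro x hx v
    have hon : Orthonormal ℝ (fun i => (![X, fun x => J x (X x), Y, fun x => J x (Y x)] :
        Fin 4 → Π x : M, TangentSpace I x) i x) := by
      rw [orthonormal_iff_ite]; exact hort x hx
    have hcard : Fintype.card (Fin 4) = Module.finrank ℝ (TangentSpace I x) := by
      rw [Fintype.card_fin]; exact hE.symm
    have := ((basisOfOrthonormalOfCardEqFinrank hon hcard).toOrthonormalBasis
      (by simpa using hon)).sum_repr' v
    simpa using this.symm

theorem exists_orthogonal_vector {V : Type*} [NormedAddCommGroup V] [InnerProductSpace ℝ V]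
    [FiniteDimensional ℝ V] (hV : Module.finrank ℝ V = 4) (a b : V) :
    ∃ v : V, v ≠ 0 ∧ (inner ℝ a v : ℝ) = 0 ∧ (inner ℝ b v : ℝ) = 0 := by
  have h1 : Module.finrank ℝ (Submodule.span ℝ {a, b}) ≤ 2 := by
    classical
    have := finrank_span_le_card (R := ℝ) ({a, b} : Set V)
    exact this.trans (by simpa using Finset.card_le_two (a := a) (b := b))
  have h2 := Submodule.finrank_add_finrank_orthogonal (Submodule.span ℝ {a, b})
  have h3 : (Submodule.span ℝ {a, b})ᗮ ≠ ⊥ := by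
    intro h
    rw [h, finrank_bot] at h2
    omega
  obtain ⟨v, hv, hv0⟩ := Submodule.exists_mem_ne_zero_of_ne_bot h3
  rw [Submodule.mem_orthogonal] at hv
  exact ⟨v, hv0, hv a (Submodule.subset_span (by simp)), hv b (Submodule.subset_span (by simp))⟩

/-- Adapted frames exist near every point. -/
theorem exists_adaptedFrame {J : Π x : M, TangentSpace I x →L[ℝ] TangentSpace I x}
    (hJ : IsAlmostKahler J) (hE : Module.finrank ℝ E = 4) (x : M) :
    ∃ U : Set M, ∃ e : Fin 4 → Π x : M, TangentSpace I x, x ∈ U ∧ IsAdaptedFrame J U e := by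
  have hT : Module.finrank ℝ (TangentSpace I x) = 4 := hE
  obtain ⟨u, hu, -, -⟩ := exists_orthogonal_vector hT 0 0
  obtain ⟨v, hv, huv, hJuv⟩ := exists_orthogonal_vector hT u (J x u)
  obtain ⟨V₁, h₁, s₁⟩ := exists_contMDiffOn_extend (k := ∞) I E u
  obtain ⟨V₂, h₂, s₂⟩ := exists_contMDiffOn_extend (k := ∞) I E v
  obtain ⟨V, hV, hVo, hxV⟩ := mem_nhds_iff.1 (Filter.inter_mem h₁ h₂)
  replace s₁ := s₁.mono fun y hy => (hV hy).1
  replace s₂ := s₂.mono fun y hy => (hV hy).2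
  set V' : Set M := {y | y ∈ V ∧ extend E u y ≠ 0}
  have hV' : IsOpen V' := isOpen_nonvanishing hVo s₁
  have hxV' : x ∈ V' := ⟨hxV, by rw [extend_apply_self]; exact hu⟩
  replace s₁ := s₁.mono (s := V) (t := V') fun y hy => hy.1
  replace s₂ := s₂.mono (s := V) (t := V') fun y hy => hy.1
  set X : Π x : M, TangentSpace I x := fun y => ‖extend E u y‖⁻¹ • extend E u y with hXdef
  have hX : CMDiff[V'] ∞ (T% X) := smoothOn_normalize s₁ fun y hy => hy.2
  have hJX : CMDiff[V'] ∞ (T% (fun y => J y (X y))) := smoothOn_apply hJ.smooth hX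
  have hX1 : ∀ y ∈ V', (inner ℝ (X y) (X y) : ℝ) = 1 := fun y hy => inner_normalize_self hy.2
  -- Gram–Schmidt against the complex line of X. The vector v is already orthogonal to that line at
  -- x, so Z x = v and Z stays nonzero nearby.
  set Z : Π x : M, TangentSpace I x := extend E v
    - ((fun y => (inner ℝ (X y) (extend E v y) : ℝ)) • X
      + (fun y => (inner ℝ (J y (X y)) (extend E v y) : ℝ)) • (fun y => J y (X y))) with hZdef
  have hZ : CMDiff[V'] ∞ (T% Z) := s₂.sub_section
    (((smoothOn_inner hX s₂).smul_section hX).add_section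
      ((smoothOn_inner hJX s₂).smul_section hJX))
  have hXx : X x = ‖u‖⁻¹ • u := by simp [hXdef, extend_apply_self]
  have hZx : Z x = v := by
    simp [hZdef, hXx, extend_apply_self, inner_smul_left, huv, hJuv]
  set W : Set M := {y | y ∈ V' ∧ Z y ≠ 0}
  have hW : IsOpen W := isOpen_nonvanishing hV' hZ
  replace hZ := hZ.mono (s := V') (t := W) fun y hy => hy.1
  replace hX := hX.mono (s := V') (t := W) fun y hy => hy.1
  refine ⟨W, _, ⟨hxV', by rw [hZx]; exact hv⟩,
    isAdaptedFrame_of_pair hJ hE hW hX (smoothOn_normalize hZ fun y hy => hy.2)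
      (fun y hy => hX1 y hy.1) (fun y hy => inner_normalize_self hy.2) (fun y hy => ?_)
      fun y hy => ?_⟩
  all_goals
    have h1 := hX1 y hy.1
    have h2 : (inner ℝ (J y (X y)) (J y (X y)) : ℝ) = 1 := by rw [hJ.orthogonal, h1]
    have h3 : (inner ℝ (J y (X y)) (X y) : ℝ) = 0 := by
      have := skew_of_orthogonal (hJ.sq y) (hJ.orthogonal y) (X y) (X y); linarith
    have h4 : (inner ℝ (X y) (J y (X y)) : ℝ) = 0 := by rw [real_inner_comm]; exact h3
    rw [inner_smul_right]
    simp only [hZdef, Pi.sub_apply, Pi.add_apply, Pi.smul_apply', inner_sub_right,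
      inner_add_right, inner_smul_right, h1, h2, h3, h4]
    ring

namespace IsAdaptedFrame

variable {J : Π x : M, TangentSpace I x →L[ℝ] TangentSpace I x} {U : Set M}
  {e : Fin 4 → Π x : M, TangentSpace I x} (he : IsAdaptedFrame J U e) (hJ : IsAlmostKahler J)
include he hJ

theorem map_one {x : M} (hx : x ∈ U) : J x (e 1 x) = - e 0 x := by
  rw [← he.map_zero x hx, hJ.sq]

theorem map_three {x : M} (hx : x ∈ U) : J x (e 3 x) = - e 2 x := by
  rw [← he.map_two x hx, hJ.sq]

theorem map_eq_sum {x : M} (hx : x ∈ U) (j : Fin 4) :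
    J x (e j x) = ∑ m, adaptedMatrix j m • e m x := by
  fin_cases j <;>
    simp [adaptedMatrix, Fin.sum_univ_four, he.map_zero x hx, he.map_two x hx,
      he.map_one hJ hx, he.map_three hJ hx]

omit hJ in
/-- The components of `∇J` in an adapted frame. -/
theorem covDerivCoeff_eq {x : M} (hx : x ∈ U) (i j k : Fin 4) :
    covDerivCoeff e adaptedMatrix i j k x =
      (![![0, 0, christoffel e i 1 2 x + christoffel e i 0 3 x,
          christoffel e i 1 3 x - christoffel e i 0 2 x],
        ![0, 0, christoffel e i 1 3 x - christoffel e i 0 2 x,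
          -(christoffel e i 1 2 x + christoffel e i 0 3 x)],
        ![-(christoffel e i 1 2 x + christoffel e i 0 3 x),
          -(christoffel e i 1 3 x - christoffel e i 0 2 x), 0, 0],
        ![-(christoffel e i 1 3 x - christoffel e i 0 2 x),
          christoffel e i 1 2 x + christoffel e i 0 3 x, 0, 0]] : Fin 4 → Fin 4 → ℝ) j k := by
  have s := fun j k => he.christoffel_skew i j k hx
  have d := fun j => he.christoffel_self i j hx
  fin_cases j <;> fin_cases k <;>
    simp [covDerivCoeff, adaptedMatrix, Fin.sum_univ_four, d] <;>
    linarith [s 0 1, s 0 2, s 0 3, s 1 2, s 1 3, s 2 3]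

theorem closed_coeff {x : M} (hx : x ∈ U) (i j k : Fin 4) :
    covDerivCoeff e adaptedMatrix i j k x - covDerivCoeff e adaptedMatrix j i k x
      + covDerivCoeff e adaptedMatrix k i j x = 0 := by
  have h := hJ.closed x (e i) (e j) (e k) ((he.smooth i).contMDiffAt (he.isOpen.mem_nhds hx))
    ((he.smooth j).contMDiffAt (he.isOpen.mem_nhds hx))
    ((he.smooth k).contMDiffAt (he.isOpen.mem_nhds hx))
  rw [he.dTwoForm_eq_sum hJ.smooth (fun y hy => he.map_eq_sum hJ hy) hx
    (skew_of_orthogonal (hJ.sq x) (hJ.orthogonal x)) (he.mdiffAt i hx) (he.mdiffAt j hx)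
    (he.mdiffAt k hx)] at h
  simpa [he.inner_eq x hx] using h

/-- Closedness of the fundamental form in an adapted frame: `∇Ω = a ⊗ φ + (a ∘ J) ⊗ Jφ`. -/
theorem closed_relations {x : M} (hx : x ∈ U) :
    christoffel e 0 1 3 x - christoffel e 0 0 2 x
      = christoffel e 1 1 2 x + christoffel e 1 0 3 x ∧
    christoffel e 1 1 3 x - christoffel e 1 0 2 x
      = -(christoffel e 0 1 2 x + christoffel e 0 0 3 x) ∧
    christoffel e 2 1 3 x - christoffel e 2 0 2 x
      = christoffel e 3 1 2 x + christoffel e 3 0 3 x ∧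
    christoffel e 3 1 3 x - christoffel e 3 0 2 x
      = -(christoffel e 2 1 2 x + christoffel e 2 0 3 x) := by
  have h1 := he.closed_coeff hJ hx 0 1 2
  have h2 := he.closed_coeff hJ hx 0 1 3
  have h3 := he.closed_coeff hJ hx 0 2 3
  have h4 := he.closed_coeff hJ hx 1 2 3
  simp only [he.covDerivCoeff_eq hx] at h1 h2 h3 h4
  simp at h1 h2 h3 h4
  refine ⟨?_, ?_, ?_, ?_⟩ <;> linarith

end IsAdaptedFrame

end AdaptedFrames

/-! ### Frames in which ∇J has a single coefficient -/

section SpecialFrames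

variable {E : Type*} [NormedAddCommGroup E] [NormedSpace ℝ E]
  {H : Type*} [TopologicalSpace H] {I : ModelWithCorners ℝ E H}
  {M : Type*} [TopologicalSpace M] [ChartedSpace H M] [IsManifold I ∞ M]
  [FiniteDimensional ℝ E] [RiemannianBundle (fun x : M => TangentSpace I x)]
  [IsContMDiffRiemannianBundle I ∞ E (fun x : M => TangentSpace I x)]

/-- An adapted frame in which `∇J` only has the components forced by
`(∇_{e_0} J) e_0 = r e_2` with `r ≠ 0`; then `(e_2, e_3)` spans the Kähler nullity. -/
structure IsSpecialFrame (J : Π x : M, TangentSpace I x →L[ℝ] TangentSpace I x) (U : Set M)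
    (e : Fin 4 → Π x : M, TangentSpace I x) : Prop extends IsAdaptedFrame J U e where
  ne_zero' : ∀ x ∈ U, christoffel e 0 1 2 x + christoffel e 0 0 3 x ≠ 0
  eq_one : ∀ x ∈ U, christoffel e 1 1 2 x + christoffel e 1 0 3 x = 0
  eq_two : ∀ x ∈ U, christoffel e 2 1 2 x + christoffel e 2 0 3 x = 0
  eq_three : ∀ x ∈ U, christoffel e 3 1 2 x + christoffel e 3 0 3 x = 0

/-- The vector field dual to the one-form `X ↦ g((∇_X J) e_0, e_2)`. -/
def torsionField (e : Fin 4 → Π x : M, TangentSpace I x) (x : M) : TangentSpace I x :=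
  ∑ i, covDerivCoeff e adaptedMatrix i 0 2 x • e i x

namespace IsAdaptedFrame

variable {J : Π x : M, TangentSpace I x →L[ℝ] TangentSpace I x} {U : Set M}
  {e : Fin 4 → Π x : M, TangentSpace I x} (he : IsAdaptedFrame J U e)
include he

theorem covDerivCoeff_zero_two {x : M} (hx : x ∈ U) (i : Fin 4) :
    covDerivCoeff e adaptedMatrix i 0 2 x = christoffel e i 1 2 x + christoffel e i 0 3 x := by
  rw [he.covDerivCoeff_eq hx]; rfl

theorem smoothOn_torsionField : CMDiff[U] ∞ (T% (torsionField e)) := by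
  refine he.smoothOn_sum fun i => ?_
  exact ((he.smoothOn_christoffel i 1 2).add (he.smoothOn_christoffel i 0 3)).congr
    fun y hy => he.covDerivCoeff_zero_two hy i

theorem inner_frame_map (hJ : IsAlmostKahler J) {x : M} (hx : x ∈ U) (u : TangentSpace I x) :
    (inner ℝ (e 0 x) (J x u) : ℝ) = - inner ℝ (e 1 x) u ∧
    (inner ℝ (e 1 x) (J x u) : ℝ) = inner ℝ (e 0 x) u ∧
    (inner ℝ (e 2 x) (J x u) : ℝ) = - inner ℝ (e 3 x) u ∧
    (inner ℝ (e 3 x) (J x u) : ℝ) = inner ℝ (e 2 x) u := by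
  have hs : ∀ v, (inner ℝ v (J x u) : ℝ) = - inner ℝ (J x v) u := fun v => by
    rw [real_inner_comm, skew_of_orthogonal (hJ.sq x) (hJ.orthogonal x)]
  refine ⟨?_, ?_, ?_, ?_⟩
  · rw [hs, he.map_zero x hx]
  · rw [hs, he.map_one hJ hx, inner_neg_left, neg_neg]
  · rw [hs, he.map_two x hx]
  · rw [hs, he.map_three hJ hx, inner_neg_left, neg_neg]

/-- Closedness of Ω makes the second coefficient form of ∇J the dual of -JW, where W is
`torsionField e x`. Thus W alone carries ∇J, and directions orthogonal to W and JW lie in the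
nullity. -/
theorem inner_covDerivEnd_eq (hJ : IsAlmostKahler J) {x : M} (hx : x ∈ U)
    (u v w : TangentSpace I x) :
    (inner ℝ (covDerivEnd J x v u) w : ℝ) =
      inner ℝ (torsionField e x) u *
        (inner ℝ (e 0 x) v * inner ℝ (e 2 x) w - inner ℝ (e 1 x) v * inner ℝ (e 3 x) w
          - inner ℝ (e 2 x) v * inner ℝ (e 0 x) w + inner ℝ (e 3 x) v * inner ℝ (e 1 x) w)
      - inner ℝ (J x (torsionField e x)) u *
        (inner ℝ (e 0 x) v * inner ℝ (e 3 x) w + inner ℝ (e 1 x) v * inner ℝ (e 2 x) w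
          - inner ℝ (e 2 x) v * inner ℝ (e 1 x) w - inner ℝ (e 3 x) v * inner ℝ (e 0 x) w) := by
  obtain ⟨r0, r1, r2, r3⟩ := he.closed_relations hJ hx
  have h1 : (inner ℝ (torsionField e x) u : ℝ) =
      ∑ i, (christoffel e i 1 2 x + christoffel e i 0 3 x) * inner ℝ (e i x) u := by
    simp only [torsionField, sum_inner, inner_smul_left, he.covDerivCoeff_zero_two hx]
    rfl
  have h2 : (inner ℝ (J x (torsionField e x)) u : ℝ) =
      -∑ i, (christoffel e i 1 3 x - christoffel e i 0 2 x) * inner ℝ (e i x) u := by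
    simp only [torsionField, map_add, map_smul, inner_add_left, inner_smul_left,
      he.covDerivCoeff_zero_two hx, Fin.sum_univ_four, he.map_zero x hx, he.map_two x hx,
      he.map_one hJ hx, he.map_three hJ hx, inner_neg_left, r0, r1, r2, r3,
      starRingEnd_apply, star_trivial]
    ring
  rw [h1, h2, he.inner_covDerivEnd hJ.smooth (fun y hy => he.map_eq_sum hJ hy) hx]
  simp only [he.covDerivCoeff_eq hx, Fin.sum_univ_four]
  simp
  ring

/-- Special frames exist near every point where `∇J ≠ 0`. -/
theorem exists_specialFrame (hJ : IsAlmostKahler J) (hE : Module.finrank ℝ E = 4) {x : M}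
    (hx : x ∈ U) (hne : ∃ v u : TangentSpace I x, covDerivEnd J x v u ≠ 0) :
    ∃ V : Set M, ∃ f : Fin 4 → Π x : M, TangentSpace I x, x ∈ V ∧ IsSpecialFrame J V f := by
  set W : Π x : M, TangentSpace I x := torsionField e with hWdef
  have hW : CMDiff[U] ∞ (T% W) := he.smoothOn_torsionField
  have hWx : W x ≠ 0 := by
    intro h0
    obtain ⟨v, u, h⟩ := hne
    refine h (ext_inner_right ℝ fun w => ?_)
    rw [he.inner_covDerivEnd_eq hJ hx, ← hWdef, h0]
    simp
  set V : Set M := {y | y ∈ U ∧ W y ≠ 0}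
  have hV : IsOpen V := isOpen_nonvanishing he.isOpen hW
  have hVU : V ⊆ U := fun y hy => hy.1
  set X : Π x : M, TangentSpace I x := fun y => ‖W y‖⁻¹ • W y with hXdef
  have hX : CMDiff[V] ∞ (T% X) := smoothOn_normalize (hW.mono hVU) fun y hy => hy.2
  have hWX : ∀ y ∈ V, W y = ‖W y‖ • X y := fun y hy => by
    rw [hXdef]
    simp only
    rw [smul_smul, mul_inv_cancel₀ (norm_ne_zero_iff.2 hy.2), one_smul]
  have hX1 : ∀ y ∈ V, (inner ℝ (X y) (X y) : ℝ) = 1 := fun y hy => inner_normalize_self hy.2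
  have hJX1 : ∀ y, (inner ℝ (J y (X y)) (X y) : ℝ) = 0 := fun y => by
    have := skew_of_orthogonal (hJ.sq y) (hJ.orthogonal y) (X y) (X y); linarith
  have hV' : IsOrthonormalFrame V e := he.toIsOrthonormalFrame.mono hV hVU
  -- N = (∇_X J) X. As W is |W| X and JW is orthogonal to X, it is dual to |W| φ(X, ·) with φ = e^02
  -- - e^13 in the original frame. This φ is nondegenerate, so N ≠ 0; it is skew and
  -- J-anti-invariant, so N is orthogonal to X and JX. Hence N can be normalized to the third
  -- vector.
  set N : Π x : M, TangentSpace I x :=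
    nabla X (fun y => J y (X y)) - (fun y => J y (nabla X X y)) with hNdef
  have hN : CMDiff[V] ∞ (T% N) := (hV'.smoothOn_nabla hX (smoothOn_apply hJ.smooth hX)).sub_section
    (smoothOn_apply hJ.smooth (hV'.smoothOn_nabla hX hX))
  have hNeq : ∀ y ∈ V, covDerivEnd J y (X y) (X y) = N y := fun y hy =>
    covDerivEnd_apply hJ.smooth X (mdiffAt_field_of_smoothOn hV hX hy)
  have hNw : ∀ y ∈ V, ∀ w, (inner ℝ (N y) w : ℝ) = ‖W y‖ *
      (inner ℝ (e 0 y) (X y) * inner ℝ (e 2 y) w - inner ℝ (e 1 y) (X y) * inner ℝ (e 3 y) w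
        - inner ℝ (e 2 y) (X y) * inner ℝ (e 0 y) w
        + inner ℝ (e 3 y) (X y) * inner ℝ (e 1 y) w) := by
    intro y hy w
    have h1 : (inner ℝ (W y) (X y) : ℝ) = ‖W y‖ := by
      conv_lhs => rw [hWX y hy]
      rw [inner_smul_left, hX1 y hy]; simp
    have h2 : (inner ℝ (J y (W y)) (X y) : ℝ) = 0 := by
      rw [hWX y hy, map_smul, inner_smul_left, hJX1, mul_zero]
    rw [← hNeq y hy, he.inner_covDerivEnd_eq hJ (hVU hy), ← hWdef, h1, h2]
    ring
  have hN0 : ∀ y ∈ V, N y ≠ 0 := by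
    intro y hy h0
    have hW0 : ‖W y‖ ≠ 0 := norm_ne_zero_iff.2 hy.2
    have h := hNw y hy
    simp only [h0, inner_zero_left, zero_eq_mul, hW0, false_or] at h
    have hX0 : X y = 0 := by
      rw [he.expand y (hVU hy) (X y), Fin.sum_univ_four]
      have a := h (e 0 y)
      have b := h (e 1 y)
      have c := h (e 2 y)
      have d := h (e 3 y)
      simp only [he.inner_eq y (hVU hy)] at a b c d
      simp at a b c d
      rw [a, b, c, d]
      simp
    simpa [hX0] using hX1 y hy
  have hNX : ∀ y ∈ V, (inner ℝ (N y) (X y) : ℝ) = 0 := fun y hy => by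
    rw [hNw y hy]; ring
  have hNJX : ∀ y ∈ V, (inner ℝ (N y) (J y (X y)) : ℝ) = 0 := fun y hy => by
    obtain ⟨r0, r1, r2, r3⟩ := he.inner_frame_map hJ (hVU hy) (X y)
    rw [hNw y hy, r0, r1, r2, r3]; ring
  set Y : Π x : M, TangentSpace I x := fun y => ‖N y‖⁻¹ • N y with hYdef
  have hY1 : ∀ y ∈ V, (inner ℝ (Y y) (Y y) : ℝ) = 1 := fun y hy => inner_normalize_self (hN0 y hy)
  have hNY : ∀ y ∈ V, N y = ‖N y‖ • Y y := fun y hy => by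
    rw [hYdef]
    simp only
    rw [smul_smul, mul_inv_cancel₀ (norm_ne_zero_iff.2 (hN0 y hy)), one_smul]
  have hf := isAdaptedFrame_of_pair hJ hE hV hX (smoothOn_normalize hN hN0) hX1 hY1
    (fun y hy => by rw [real_inner_comm, inner_smul_left, hNX y hy, mul_zero])
    (fun y hy => by rw [real_inner_comm, inner_smul_left, hNJX y hy, mul_zero])
  set f : Fin 4 → Π x : M, TangentSpace I x := ![X, fun y => J y (X y), Y, fun y => J y (Y y)]
    with hfdef
  have hT : ∀ y ∈ V, ∀ i j k, (inner ℝ (covDerivEnd J y (f j y) (f i y)) (f k y) : ℝ)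
      = covDerivCoeff f adaptedMatrix i j k y := fun y hy i j k =>
    hf.inner_covDerivEnd_frame hJ.smooth (fun z hz => hf.map_eq_sum hJ hz) i j k hy
  have hperp : ∀ y ∈ V, ∀ i, i ≠ 0 → i ≠ 1 → covDerivCoeff f adaptedMatrix i 0 2 y = 0 := by
    intro y hy i h0 h1
    have e1 : (inner ℝ (W y) (f i y) : ℝ) = 0 := by
      rw [hWX y hy, inner_smul_left]
      have := hf.inner_eq y hy 0 i
      rw [if_neg (Ne.symm h0)] at this
      rw [show (inner ℝ (X y) (f i y) : ℝ) = 0 from this, mul_zero]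
    have e2 : (inner ℝ (J y (W y)) (f i y) : ℝ) = 0 := by
      rw [hWX y hy, map_smul, inner_smul_left]
      have := hf.inner_eq y hy 1 i
      rw [if_neg (Ne.symm h1)] at this
      rw [show (inner ℝ (J y (X y)) (f i y) : ℝ) = 0 from this, mul_zero]
    rw [← hT y hy, he.inner_covDerivEnd_eq hJ (hVU hy), ← hWdef, e1, e2]
    ring
  refine ⟨V, f, ⟨hx, hWx⟩, { hf with ne_zero' := ?_, eq_one := ?_, eq_two := ?_, eq_three := ?_ }⟩
  · intro y hy
    rw [← hf.covDerivCoeff_zero_two hy, ← hT y hy]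
    change (inner ℝ (covDerivEnd J y (X y) (X y)) (Y y) : ℝ) ≠ 0
    rw [hNeq y hy, hNY y hy, inner_smul_left, hY1 y hy]
    simpa using hN0 y hy
  · intro y hy
    -- Closedness identifies this coefficient with the f_3-component of (∇_{f_0} J) f_0, which is
    -- zero because that vector points along f_2.
    rw [← (hf.closed_relations hJ hy).1]
    have h1 := hT y hy 0 0 3
    rw [hf.covDerivCoeff_eq hy] at h1
    change (inner ℝ (covDerivEnd J y (X y) (X y)) (J y (Y y)) : ℝ) =
      christoffel f 0 1 3 y - christoffel f 0 0 2 y at h1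
    rw [← h1, hNeq y hy, hNY y hy, inner_smul_left]
    have h2 := hf.inner_eq y hy 2 3
    rw [show (inner ℝ (Y y) (J y (Y y)) : ℝ) = 0 from h2, mul_zero]
  · intro y hy
    rw [← hf.covDerivCoeff_zero_two hy, hperp y hy 2 (by decide) (by decide)]
  · intro y hy
    rw [← hf.covDerivCoeff_zero_two hy, hperp y hy 3 (by decide) (by decide)]

end IsAdaptedFrame

end SpecialFrames

/-! ### Structure equations and the second Gray condition in components -/

section StructureEquations

variable {E : Type*} [NormedAddCommGroup E] [NormedSpace ℝ E]
  {H : Type*} [TopologicalSpace H] {I : ModelWithCorners ℝ E H}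
  {M : Type*} [TopologicalSpace M] [ChartedSpace H M] [IsManifold I ∞ M]
  [FiniteDimensional ℝ E] [RiemannianBundle (fun x : M => TangentSpace I x)]
  [IsContMDiffRiemannianBundle I ∞ E (fun x : M => TangentSpace I x)]

/-- The self-dual connection form `ω_{12} + ω_{03}`. -/
def formA (e : Fin 4 → Π x : M, TangentSpace I x) (i : Fin 4) (x : M) : ℝ :=
  christoffel e i 1 2 x + christoffel e i 0 3 x

/-- The self-dual connection form `ω_{13} - ω_{02}`. -/
def formA' (e : Fin 4 → Π x : M, TangentSpace I x) (i : Fin 4) (x : M) : ℝ :=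
  christoffel e i 1 3 x - christoffel e i 0 2 x

/-- The self-dual connection form `ω_{01} + ω_{23}`. -/
def formB (e : Fin 4 → Π x : M, TangentSpace I x) (i : Fin 4) (x : M) : ℝ :=
  christoffel e i 0 1 x + christoffel e i 2 3 x

/-- The anti-self-dual connection form `ω_{03} - ω_{12}`. -/
def formP (e : Fin 4 → Π x : M, TangentSpace I x) (i : Fin 4) (x : M) : ℝ :=
  christoffel e i 0 3 x - christoffel e i 1 2 x

/-- The anti-self-dual connection form `ω_{02} + ω_{13}`. -/
def formQ (e : Fin 4 → Π x : M, TangentSpace I x) (i : Fin 4) (x : M) : ℝ :=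
  christoffel e i 0 2 x + christoffel e i 1 3 x

/-- The anti-self-dual connection form `ω_{01} - ω_{23}`. -/
def formBbar (e : Fin 4 → Π x : M, TangentSpace I x) (i : Fin 4) (x : M) : ℝ :=
  christoffel e i 0 1 x - christoffel e i 2 3 x

theorem dOneForm_swap (e : Fin 4 → Π x : M, TangentSpace I x) (η : Fin 4 → M → ℝ) (i j : Fin 4)
    (x : M) : dOneForm e η i j x = - dOneForm e η j i x := by
  simp only [dOneForm, bracketCoeff, Fin.sum_univ_four]
  ring

theorem dOneForm_self (e : Fin 4 → Π x : M, TangentSpace I x) (η : Fin 4 → M → ℝ) (i : Fin 4)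
    (x : M) : dOneForm e η i i x = 0 := by
  simp [dOneForm, bracketCoeff]

namespace IsOrthonormalFrame

variable {U : Set M} {e : Fin 4 → Π x : M, TangentSpace I x} (he : IsOrthonormalFrame U e)
include he

theorem smoothOn_formA (i : Fin 4) : CMDiff[U] ∞ (formA e i) :=
  (he.smoothOn_christoffel i 1 2).add (he.smoothOn_christoffel i 0 3)

theorem smoothOn_formA' (i : Fin 4) : CMDiff[U] ∞ (formA' e i) :=
  (he.smoothOn_christoffel i 1 3).sub (he.smoothOn_christoffel i 0 2)

theorem smoothOn_formB (i : Fin 4) : CMDiff[U] ∞ (formB e i) :=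
  (he.smoothOn_christoffel i 0 1).add (he.smoothOn_christoffel i 2 3)

theorem dOneForm_congr {η θ : Fin 4 → M → ℝ} (h : ∀ y ∈ U, ∀ m, η m y = θ m y) (i j : Fin 4)
    {x : M} (hx : x ∈ U) : dOneForm e η i j x = dOneForm e θ i j x := by
  rw [dOneForm, dOneForm, he.frameDeriv_congr i (fun y hy => h y hy j) hx,
    he.frameDeriv_congr j (fun y hy => h y hy i) hx]
  simp only [h x hx]

theorem dOneForm_christoffel (i j k l : Fin 4) {x : M} (hx : x ∈ U) :
    dOneForm e (fun m => christoffel e m k l) i j x =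
      -curvatureCoeff e i j k l x
        + ∑ m, (christoffel e j k m x * christoffel e i l m x
          - christoffel e i k m x * christoffel e j l m x) := by
  rw [he.curvatureCoeff_eq i j k l hx, dOneForm]
  simp only [Finset.sum_add_distrib]
  ring

theorem dOneForm_add {η θ : Fin 4 → M → ℝ} (hη : ∀ m, CMDiff[U] ∞ (η m))
    (hθ : ∀ m, CMDiff[U] ∞ (θ m)) (i j : Fin 4) {x : M} (hx : x ∈ U) :
    dOneForm e (fun m y => η m y + θ m y) i j x = dOneForm e η i j x + dOneForm e θ i j x := by
  simp only [dOneForm]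
  rw [he.frameDeriv_add i (hη j) (hθ j) hx, he.frameDeriv_add j (hη i) (hθ i) hx]
  simp only [mul_add, Finset.sum_add_distrib]
  ring

theorem dOneForm_sub {η θ : Fin 4 → M → ℝ} (hη : ∀ m, CMDiff[U] ∞ (η m))
    (hθ : ∀ m, CMDiff[U] ∞ (θ m)) (i j : Fin 4) {x : M} (hx : x ∈ U) :
    dOneForm e (fun m y => η m y - θ m y) i j x = dOneForm e η i j x - dOneForm e θ i j x := by
  simp only [dOneForm]
  rw [he.frameDeriv_sub i (hη j) (hθ j) hx, he.frameDeriv_sub j (hη i) (hθ i) hx]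
  simp only [mul_sub, Finset.sum_sub_distrib]
  ring

theorem christoffel_normalize {x : M} (hx : x ∈ U) :
    (∀ i j, christoffel e i j j x = 0) ∧
    (∀ i, christoffel e i 1 0 x = -christoffel e i 0 1 x) ∧
    (∀ i, christoffel e i 2 0 x = -christoffel e i 0 2 x) ∧
    (∀ i, christoffel e i 3 0 x = -christoffel e i 0 3 x) ∧
    (∀ i, christoffel e i 2 1 x = -christoffel e i 1 2 x) ∧
    (∀ i, christoffel e i 3 1 x = -christoffel e i 1 3 x) ∧
    (∀ i, christoffel e i 3 2 x = -christoffel e i 2 3 x) :=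
  ⟨fun i j => he.christoffel_self i j hx, fun i => he.christoffel_skew i 1 0 hx,
    fun i => he.christoffel_skew i 2 0 hx, fun i => he.christoffel_skew i 3 0 hx,
    fun i => he.christoffel_skew i 2 1 hx, fun i => he.christoffel_skew i 3 1 hx,
    fun i => he.christoffel_skew i 3 2 hx⟩

/-- Since so(4) is a sum of two commuting copies of so(3), the quadratic terms of the structure
equation for a self-dual component involve only the other two self-dual components. The same holds
for A', B and, on the anti-self-dual side, for B̄. -/
theorem dOneForm_formA (i j : Fin 4) {x : M} (hx : x ∈ U) :
    dOneForm e (formA e) i j x = -(curvatureCoeff e i j 1 2 x + curvatureCoeff e i j 0 3 x)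
      + (formB e i x * formA' e j x - formB e j x * formA' e i x) := by
  have h := he.dOneForm_add (fun m => he.smoothOn_christoffel m 1 2)
    (fun m => he.smoothOn_christoffel m 0 3) i j hx
  rw [he.dOneForm_christoffel i j 1 2 hx, he.dOneForm_christoffel i j 0 3 hx] at h
  obtain ⟨d, s1, s2, s3, s4, s5, s6⟩ := he.christoffel_normalize hx
  refine h.trans ?_
  simp only [Fin.sum_univ_four, formB, formA', d, s1, s2, s3, s4, s5, s6]
  ring

theorem dOneForm_formA' (i j : Fin 4) {x : M} (hx : x ∈ U) :
    dOneForm e (formA' e) i j x = -(curvatureCoeff e i j 1 3 x - curvatureCoeff e i j 0 2 x)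
      - (formB e i x * formA e j x - formB e j x * formA e i x) := by
  have h := he.dOneForm_sub (fun m => he.smoothOn_christoffel m 1 3)
    (fun m => he.smoothOn_christoffel m 0 2) i j hx
  rw [he.dOneForm_christoffel i j 1 3 hx, he.dOneForm_christoffel i j 0 2 hx] at h
  obtain ⟨d, s1, s2, s3, s4, s5, s6⟩ := he.christoffel_normalize hx
  refine h.trans ?_
  simp only [Fin.sum_univ_four, formB, formA, d, s1, s2, s3, s4, s5, s6]
  ring

theorem dOneForm_formB (i j : Fin 4) {x : M} (hx : x ∈ U) :
    dOneForm e (formB e) i j x = -(curvatureCoeff e i j 0 1 x + curvatureCoeff e i j 2 3 x)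
      - (formA e i x * formA' e j x - formA e j x * formA' e i x) := by
  have h := he.dOneForm_add (fun m => he.smoothOn_christoffel m 0 1)
    (fun m => he.smoothOn_christoffel m 2 3) i j hx
  rw [he.dOneForm_christoffel i j 0 1 hx, he.dOneForm_christoffel i j 2 3 hx] at h
  obtain ⟨d, s1, s2, s3, s4, s5, s6⟩ := he.christoffel_normalize hx
  refine h.trans ?_
  simp only [Fin.sum_univ_four, formA, formA', d, s1, s2, s3, s4, s5, s6]
  ring

theorem dOneForm_formBbar (i j : Fin 4) {x : M} (hx : x ∈ U) :
    dOneForm e (formBbar e) i j x = -(curvatureCoeff e i j 0 1 x - curvatureCoeff e i j 2 3 x)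
      - (formP e i x * formQ e j x - formP e j x * formQ e i x) := by
  have h := he.dOneForm_sub (fun m => he.smoothOn_christoffel m 0 1)
    (fun m => he.smoothOn_christoffel m 2 3) i j hx
  rw [he.dOneForm_christoffel i j 0 1 hx, he.dOneForm_christoffel i j 2 3 hx] at h
  obtain ⟨d, s1, s2, s3, s4, s5, s6⟩ := he.christoffel_normalize hx
  refine h.trans ?_
  simp only [Fin.sum_univ_four, formP, formQ, d, s1, s2, s3, s4, s5, s6]
  ring

theorem curvatureTensor_neg {x : M} (hx : x ∈ U) (u v w z : TangentSpace I x) :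
    curvatureTensor x (-u) v w z = -curvatureTensor x u v w z ∧
    curvatureTensor x u (-v) w z = -curvatureTensor x u v w z ∧
    curvatureTensor x u v (-w) z = -curvatureTensor x u v w z ∧
    curvatureTensor x u v w (-z) = -curvatureTensor x u v w z := by
  simp only [he.curvatureTensor_eq_sum hx, inner_neg_right, ← Finset.sum_neg_distrib]
  refine ⟨?_, ?_, ?_, ?_⟩ <;>
  · refine Finset.sum_congr rfl fun i _ => Finset.sum_congr rfl fun j _ =>
      Finset.sum_congr rfl fun k _ => Finset.sum_congr rfl fun l _ => ?_
    ring

end IsOrthonormalFrame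

/-- The curvature symmetries and the second Gray condition in an adapted frame, for the
components `K` of the curvature tensor. -/
structure GrayRelations (K : Fin 4 → Fin 4 → Fin 4 → Fin 4 → ℝ) : Prop where
  skew_left : ∀ i j k l, K i j k l = -K j i k l
  skew_right : ∀ i j k l, K i j k l = -K i j l k
  pair : ∀ i j k l, K i j k l = K k l i j
  cyclic : ∀ i j k l, K i j k l + K j k i l + K k i j l = 0
  g0201 : K 0 2 0 1 = K 1 3 0 1
  g0223 : K 0 2 2 3 = K 1 3 2 3
  g0301 : K 0 3 0 1 = -K 1 2 0 1
  g0323 : K 0 3 2 3 = -K 1 2 2 3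
  g0203 : K 0 2 0 3 = K 1 3 0 3
  g0212 : K 0 2 1 2 = -K 0 2 0 3
  g1312 : K 1 3 1 2 = -K 0 2 0 3
  g0202 : K 0 2 0 2 = K 1 3 1 3
  g0303 : K 0 3 0 3 = K 1 2 1 2
  g0213 : K 0 2 0 2 - K 0 2 1 3 = K 0 3 0 3 + K 0 3 1 2

/-- Since J permutes the frame up to sign, each instance of the Gray condition is a linear relation
between components. The eleven quadruples chosen imply every listed relation, modulo the curvature
symmetries. -/
theorem IsAdaptedFrame.grayRelations {J : Π x : M, TangentSpace I x →L[ℝ] TangentSpace I x}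
    {U : Set M} {e : Fin 4 → Π x : M, TangentSpace I x} (he : IsAdaptedFrame J U e)
    (hJ : IsAlmostKahler J) {x : M} (hx : x ∈ U)
    (hG : SecondGrayAt (J x) (curvatureTensor x)) :
    GrayRelations (fun i j k l => curvatureCoeff e i j k l x) := by
  have n2 := fun u v w z => (he.curvatureTensor_neg hx u v w z).2.1
  have n3 := fun u v w z => (he.curvatureTensor_neg hx u v w z).2.2.1
  have n4 := fun u v w z => (he.curvatureTensor_neg hx u v w z).2.2.2
  have g : ∀ i j k l, _ := fun i j k l => hG (e i x) (e j x) (e k x) (e l x)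
  have s := fun i j k l => he.curvatureCoeff_skew_left i j k l hx
  have t := fun i j k l => he.curvatureCoeff_skew_right i j k l hx
  have p := fun i j k l => he.curvatureCoeff_pair i j k l hx
  have g1 := g 0 2 0 1
  have g2 := g 0 2 2 3
  have g3 := g 0 3 0 1
  have g4 := g 0 3 2 3
  have g5 := g 0 2 0 3
  have g6 := g 0 2 1 2
  have g7 := g 0 3 1 3
  have g8 := g 0 2 0 2
  have g9 := g 0 2 1 3
  have g10 := g 0 3 0 3
  have g11 := g 0 3 1 2
  simp only [he.map_zero x hx, he.map_one hJ hx, he.map_two x hx, he.map_three hJ hx, n2, n3, n4]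
    at g1 g2 g3 g4 g5 g6 g7 g8 g9 g10 g11
  have r : ∀ i j k l, curvatureTensor x (e i x) (e j x) (e k x) (e l x)
      = curvatureCoeff e i j k l x := fun i j k l => rfl
  simp only [r] at g1 g2 g3 g4 g5 g6 g7 g8 g9 g10 g11
  refine ⟨s, t, p, fun i j k l => he.curvatureCoeff_cyclic i j k l hx, ?_, ?_, ?_, ?_, ?_, ?_, ?_,
    ?_, ?_, ?_⟩
  · linarith [t 1 2 1 1, t 1 2 0 0]
  · linarith [t 1 2 2 2, t 1 2 3 3]
  · linarith [t 1 3 1 1, t 1 3 0 0]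
  · linarith [t 1 3 2 2, t 1 3 3 3]
  all_goals linarith [p 0 2 0 3, p 0 2 1 2, p 0 2 1 3, p 0 3 1 2, p 0 3 1 3, p 1 2 1 3]

end StructureEquations

/-- The content of the second Gray condition used below: the forms φ = e^12 + e^03 and ψ = e^13 -
e^02, which span the J-anti-invariant forms, are eigenforms of the curvature operator with the
common eigenvalue λ = K_0202 - K_0213. The twelve equations are the components of R(φ) = λφ and R(ψ)
= λψ. -/
theorem GrayRelations.phi_psi {K : Fin 4 → Fin 4 → Fin 4 → Fin 4 → ℝ} (g : GrayRelations K) :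
    (K 0 1 1 2 + K 0 1 0 3 = 0 ∧ K 0 2 1 2 + K 0 2 0 3 = 0 ∧
      K 0 3 1 2 + K 0 3 0 3 = K 0 2 0 2 - K 0 2 1 3 ∧
      K 1 2 1 2 + K 1 2 0 3 = K 0 2 0 2 - K 0 2 1 3 ∧ K 1 3 1 2 + K 1 3 0 3 = 0 ∧
      K 2 3 1 2 + K 2 3 0 3 = 0) ∧
    (K 0 1 1 3 - K 0 1 0 2 = 0 ∧ K 0 2 1 3 - K 0 2 0 2 = -(K 0 2 0 2 - K 0 2 1 3) ∧
      K 0 3 1 3 - K 0 3 0 2 = 0 ∧ K 1 2 1 3 - K 1 2 0 2 = 0 ∧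
      K 1 3 1 3 - K 1 3 0 2 = K 0 2 0 2 - K 0 2 1 3 ∧ K 2 3 1 3 - K 2 3 0 2 = 0) := by
  have p := g.pair
  have := g.g0201; have := g.g0223; have := g.g0301; have := g.g0323; have := g.g0203
  have := g.g0212; have := g.g1312; have := g.g0202; have := g.g0303; have := g.g0213
  refine ⟨⟨?_, ?_, ?_, ?_, ?_, ?_⟩, ?_, ?_, ?_, ?_, ?_, ?_⟩ <;>
    linarith [p 0 1 1 2, p 0 1 0 3, p 0 3 1 2, p 2 3 1 2, p 2 3 0 3, p 0 1 1 3, p 0 1 0 2,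
      p 0 3 1 3, p 0 3 0 2, p 1 2 1 3, p 1 2 0 2, p 1 3 0 2, p 2 3 1 3, p 2 3 0 2]

/-! ### First-order consequences in a special frame -/

section SpecialFrameCalculus

variable {E : Type*} [NormedAddCommGroup E] [NormedSpace ℝ E]
  {H : Type*} [TopologicalSpace H] {I : ModelWithCorners ℝ E H}
  {M : Type*} [TopologicalSpace M] [ChartedSpace H M] [IsManifold I ∞ M]
  [FiniteDimensional ℝ E] [RiemannianBundle (fun x : M => TangentSpace I x)]
  [IsContMDiffRiemannianBundle I ∞ E (fun x : M => TangentSpace I x)]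

namespace IsSpecialFrame

variable {J : Π x : M, TangentSpace I x →L[ℝ] TangentSpace I x} {U : Set M}
  {e : Fin 4 → Π x : M, TangentSpace I x} (he : IsSpecialFrame J U e)
  (hJ : IsAlmostKahler J)
include he

theorem formA_eq {x : M} (hx : x ∈ U) :
    formA e 0 x ≠ 0 ∧ formA e 1 x = 0 ∧ formA e 2 x = 0 ∧ formA e 3 x = 0 :=
  ⟨he.ne_zero' x hx, he.eq_one x hx, he.eq_two x hx, he.eq_three x hx⟩

include hJ in
theorem formA'_eq {x : M} (hx : x ∈ U) :
    formA' e 0 x = 0 ∧ formA' e 1 x = -formA e 0 x ∧ formA' e 2 x = 0 ∧ formA' e 3 x = 0 := by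
  obtain ⟨r0, r1, r2, r3⟩ := he.closed_relations hJ hx
  refine ⟨r0.trans (he.eq_one x hx), r1, r2.trans (he.eq_three x hx), r3.trans ?_⟩
  rw [he.eq_two x hx, neg_zero]

theorem frameDeriv_formA {x : M} (hx : x ∈ U) (i : Fin 4) :
    frameDeriv e i (formA e 1) x = 0 ∧ frameDeriv e i (formA e 2) x = 0 ∧
      frameDeriv e i (formA e 3) x = 0 := by
  refine ⟨?_, ?_, ?_⟩
  · rw [he.frameDeriv_congr i (fun y hy => (he.formA_eq hy).2.1) hx, frameDeriv_const]
  · rw [he.frameDeriv_congr i (fun y hy => (he.formA_eq hy).2.2.1) hx, frameDeriv_const]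
  · rw [he.frameDeriv_congr i (fun y hy => (he.formA_eq hy).2.2.2) hx, frameDeriv_const]

include hJ in
theorem frameDeriv_formA' {x : M} (hx : x ∈ U) (i : Fin 4) :
    frameDeriv e i (formA' e 0) x = 0 ∧
      frameDeriv e i (formA' e 1) x = -frameDeriv e i (formA e 0) x ∧
      frameDeriv e i (formA' e 2) x = 0 ∧ frameDeriv e i (formA' e 3) x = 0 := by
  refine ⟨?_, ?_, ?_, ?_⟩
  · rw [he.frameDeriv_congr i (fun y hy => (he.formA'_eq hJ hy).1) hx, frameDeriv_const]
  · rw [he.frameDeriv_congr i (fun y hy => (he.formA'_eq hJ hy).2.1) hx,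
      he.frameDeriv_neg i (he.smoothOn_formA 0) hx]
  · rw [he.frameDeriv_congr i (fun y hy => (he.formA'_eq hJ hy).2.2.1) hx, frameDeriv_const]
  · rw [he.frameDeriv_congr i (fun y hy => (he.formA'_eq hJ hy).2.2.2) hx, frameDeriv_const]

include hJ in
/-- In a special frame the connection coefficients are determined by the components with
indices `01`, `23`, `02`, `03` and the function `r`. -/
theorem christoffel_special {x : M} (hx : x ∈ U) :
    (christoffel e 0 1 2 x = formA e 0 x - christoffel e 0 0 3 x ∧
      christoffel e 1 1 2 x = -christoffel e 1 0 3 x ∧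
      christoffel e 2 1 2 x = -christoffel e 2 0 3 x ∧
      christoffel e 3 1 2 x = -christoffel e 3 0 3 x) ∧
    (christoffel e 0 1 3 x = christoffel e 0 0 2 x ∧
      christoffel e 1 1 3 x = christoffel e 1 0 2 x - formA e 0 x ∧
      christoffel e 2 1 3 x = christoffel e 2 0 2 x ∧
      christoffel e 3 1 3 x = christoffel e 3 0 2 x) := by
  obtain ⟨a0, a1, a2, a3⟩ := he.formA_eq hx
  obtain ⟨b0, b1, b2, b3⟩ := he.formA'_eq hJ hx
  simp only [formA, formA'] at *
  refine ⟨⟨?_, ?_, ?_, ?_⟩, ?_, ?_, ?_, ?_⟩ <;> linarith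

include hJ in
/-- The exterior derivatives of the self-dual connection forms, and the first order relations
between the connection coefficients that they imply. -/
theorem first_order {x : M} (hx : x ∈ U) (hG : SecondGrayAt (J x) (curvatureTensor x)) :
    curvatureCoeff e 0 2 0 2 x - curvatureCoeff e 0 2 1 3 x = -(formA e 0 x) ^ 2 / 2 ∧
    frameDeriv e 1 (formA e 0) x
      = formA e 0 x * (2 * christoffel e 0 0 1 x + christoffel e 0 2 3 x) ∧
    frameDeriv e 0 (formA e 0) x
      = -formA e 0 x * (2 * christoffel e 1 0 1 x + christoffel e 1 2 3 x) ∧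
    frameDeriv e 3 (formA e 0) x
      = formA e 0 x * (2 * christoffel e 2 0 1 x + christoffel e 2 2 3 x) ∧
    frameDeriv e 2 (formA e 0) x
      = -formA e 0 x * (2 * christoffel e 3 0 1 x + christoffel e 3 2 3 x) ∧
    2 * frameDeriv e 2 (formA e 0) x = formA e 0 x * formQ e 0 x ∧
    2 * frameDeriv e 2 (formA e 0) x = -formA e 0 x * formP e 1 x ∧
    2 * frameDeriv e 3 (formA e 0) x = formA e 0 x * formP e 0 x ∧
    2 * frameDeriv e 3 (formA e 0) x = formA e 0 x * formQ e 1 x ∧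
    formA e 0 x * (formP e 2 x - formQ e 3 x) = 0 ∧
    formA e 0 x * (formP e 3 x + formQ e 2 x) = 0 := by
  obtain ⟨⟨k1, k2, k3, k4, k5, k6⟩, l1, l2, l3, l4, l5, l6⟩ := (he.grayRelations hJ hx hG).phi_psi
  obtain ⟨-, a1, a2, a3⟩ := he.formA_eq hx
  obtain ⟨b0, b1, b2, b3⟩ := he.formA'_eq hJ hx
  have A := fun i j => he.dOneForm_formA i j hx
  have B := fun i j => he.dOneForm_formA' i j hx
  have A01 := A 0 1; have A02 := A 0 2; have A03 := A 0 3; have A12 := A 1 2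
  have A13 := A 1 3; have A23 := A 2 3
  have B01 := B 0 1; have B02 := B 0 2; have B03 := B 0 3; have B12 := B 1 2
  have B13 := B 1 3; have B23 := B 2 3
  rw [k1] at A01; rw [k2] at A02; rw [k3] at A03; rw [k4] at A12; rw [k5] at A13; rw [k6] at A23
  rw [l1] at B01; rw [l2] at B02; rw [l3] at B03; rw [l4] at B12; rw [l5] at B13; rw [l6] at B23
  obtain ⟨d, s1, s2, s3, s4, s5, s6⟩ := he.christoffel_normalize hx
  obtain ⟨⟨u0, u1, u2, u3⟩, v0, v1, v2, v3⟩ := he.christoffel_special hJ hx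
  have fA := fun i => he.frameDeriv_formA hx i
  have fB := fun i => he.frameDeriv_formA' hJ hx i
  have f1 := fun i => (fA i).1; have f2 := fun i => (fA i).2.1; have f3 := fun i => (fA i).2.2
  have h0 := fun i => (fB i).1; have h1 := fun i => (fB i).2.1
  have h2 := fun i => (fB i).2.2.1; have h3 := fun i => (fB i).2.2.2
  simp only [dOneForm, bracketCoeff, Fin.sum_univ_four, f1, f2, f3, h0, h1, h2, h3, a1, a2, a3, b0,
    b1, b2, b3, d, s1, s2, s3, s4, s5, s6, u0, u1, u2, u3, v0, v1, v2, v3, formB]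
    at A01 A02 A03 A12 A13 A23 B01 B02 B03 B12 B13 B23
  simp only [formP, formQ, u0, u1, u2, u3, v0, v1, v2, v3]
  -- Put r = A_0 and t = r (2 ω_01 + ω_23)(e_2). The components dA_03 and dA'_02 both compute r
  -- ω_03(e_0), and dA_12 and dA'_13 both compute r ω_02(e_1). Comparison gives e_3 r - t = r² + 2λ
  -- and t - e_3 r = r² + 2λ, whence λ = -r²/2 and e_3 r = t. The other components yield the
  -- remaining relations directly.
  refine ⟨?_, ?_, ?_, ?_, ?_, ?_, ?_, ?_, ?_, ?_, ?_⟩ <;> linarith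

end IsSpecialFrame

end SpecialFrameCalculus

/-! ### Second-order consequences: r is constant, mixed curvature vanishes -/

section SecondOrder

variable {E : Type*} [NormedAddCommGroup E] [NormedSpace ℝ E]
  {H : Type*} [TopologicalSpace H] {I : ModelWithCorners ℝ E H}
  {M : Type*} [TopologicalSpace M] [ChartedSpace H M] [IsManifold I ∞ M]
  [FiniteDimensional ℝ E] [RiemannianBundle (fun x : M => TangentSpace I x)]
  [IsContMDiffRiemannianBundle I ∞ E (fun x : M => TangentSpace I x)]

theorem IsOrthonormalFrame.frameDeriv_quadratic {U : Set M}
    {e : Fin 4 → Π x : M, TangentSpace I x} (he : IsOrthonormalFrame U e) (k : Fin 4) (c d : ℝ)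
    {r b : M → ℝ} (hr : CMDiff[U] ∞ r) (hb : CMDiff[U] ∞ b) {x : M} (hx : x ∈ U) :
    frameDeriv e k (fun y => c * (r y * b y) + d * (r y * r y)) x
      = c * (r x * frameDeriv e k b x + b x * frameDeriv e k r x)
        + 2 * d * r x * frameDeriv e k r x := by
  have hc : ∀ c : ℝ, CMDiff[U] ∞ (fun _ : M => c) := fun c => contMDiffOn_const
  have h1 := he.frameDeriv_add k ((hc c).mul (hr.mul hb)) ((hc d).mul (hr.mul hr)) hx
  have h2 := he.frameDeriv_mul k (hc c) (hr.mul hb) hx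
  have h3 := he.frameDeriv_mul k (hc d) (hr.mul hr) hx
  have h4 := he.frameDeriv_mul k hr hb hx
  have h5 := he.frameDeriv_mul k hr hr hx
  rw [frameDeriv_const] at h2 h3
  refine (h1.trans (congrArg₂ (· + ·) (h2.trans (congrArg₂ (· + ·)
    (congrArg (c * ·) h4) rfl)) (h3.trans (congrArg₂ (· + ·) (congrArg (d * ·) h5) rfl)))).trans ?_
  ring

namespace IsSpecialFrame

variable {J : Π x : M, TangentSpace I x →L[ℝ] TangentSpace I x} {U : Set M}
  {e : Fin 4 → Π x : M, TangentSpace I x} (he : IsSpecialFrame J U e)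
  (hJ : IsAlmostKahler J)
include he hJ

/-- With λ = -r²/2 every component has the shape c r B_m + d r². The zero coefficients are kept so
that `frameDeriv_dOneForm_special` differentiates all of them in the same way. -/
theorem dOneForm_special {x : M} (hx : x ∈ U) (hG : SecondGrayAt (J x) (curvatureTensor x)) :
    (dOneForm e (formA e) 0 1 x
        = -1 * (formA e 0 x * formB e 0 x) + 0 * (formA e 0 x * formA e 0 x) ∧
      dOneForm e (formA e) 0 2 x
        = 0 * (formA e 0 x * formB e 0 x) + 0 * (formA e 0 x * formA e 0 x) ∧
      dOneForm e (formA e) 0 3 x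
        = 0 * (formA e 0 x * formB e 0 x) + 1 / 2 * (formA e 0 x * formA e 0 x) ∧
      dOneForm e (formA e) 1 2 x
        = 1 * (formA e 0 x * formB e 2 x) + 1 / 2 * (formA e 0 x * formA e 0 x) ∧
      dOneForm e (formA e) 1 3 x
        = 1 * (formA e 0 x * formB e 3 x) + 0 * (formA e 0 x * formA e 0 x) ∧
      dOneForm e (formA e) 2 3 x
        = 0 * (formA e 0 x * formB e 0 x) + 0 * (formA e 0 x * formA e 0 x)) ∧
    dOneForm e (formA' e) 0 1 x
        = 1 * (formA e 0 x * formB e 1 x) + 0 * (formA e 0 x * formA e 0 x) ∧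
      dOneForm e (formA' e) 0 2 x
        = 1 * (formA e 0 x * formB e 2 x) + (-1 / 2) * (formA e 0 x * formA e 0 x) ∧
      dOneForm e (formA' e) 0 3 x
        = 1 * (formA e 0 x * formB e 3 x) + 0 * (formA e 0 x * formA e 0 x) ∧
      dOneForm e (formA' e) 1 2 x
        = 0 * (formA e 0 x * formB e 0 x) + 0 * (formA e 0 x * formA e 0 x) ∧
      dOneForm e (formA' e) 1 3 x
        = 0 * (formA e 0 x * formB e 0 x) + 1 / 2 * (formA e 0 x * formA e 0 x) ∧
      dOneForm e (formA' e) 2 3 x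
        = 0 * (formA e 0 x * formB e 0 x) + 0 * (formA e 0 x * formA e 0 x) := by
  have hl := (he.first_order hJ hx hG).1
  obtain ⟨⟨k1, k2, k3, k4, k5, k6⟩, l1, l2, l3, l4, l5, l6⟩ := (he.grayRelations hJ hx hG).phi_psi
  obtain ⟨-, a1, a2, a3⟩ := he.formA_eq hx
  obtain ⟨b0, b1, b2, b3⟩ := he.formA'_eq hJ hx
  simp only [he.dOneForm_formA _ _ hx, he.dOneForm_formA' _ _ hx, k1, k2, k3, k4, k5, k6, l1, l2,
    l3, l4, l5, l6, hl, a1, a2, a3, b0, b1, b2, b3]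
  refine ⟨⟨?_, ?_, ?_, ?_, ?_, ?_⟩, ?_, ?_, ?_, ?_, ?_, ?_⟩ <;> ring

/-- The connection coefficients expressed through those with indices `01`, `23`. -/
theorem christoffel_reduced {x : M} (hx : x ∈ U) (hG : SecondGrayAt (J x) (curvatureTensor x)) :
    christoffel e 0 0 2 x = -(2 * christoffel e 3 0 1 x + christoffel e 3 2 3 x) ∧
    christoffel e 1 0 3 x = 2 * christoffel e 3 0 1 x + christoffel e 3 2 3 x ∧
    christoffel e 0 0 3 x = 2 * christoffel e 2 0 1 x + christoffel e 2 2 3 x + formA e 0 x / 2 ∧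
    christoffel e 1 0 2 x = 2 * christoffel e 2 0 1 x + christoffel e 2 2 3 x + formA e 0 x / 2 ∧
    christoffel e 3 0 2 x = christoffel e 2 0 3 x ∧
    christoffel e 3 0 3 x = -christoffel e 2 0 2 x := by
  obtain ⟨-, -, -, d3, d2, p1, p2, p3, p4, p5, p6⟩ := he.first_order hJ hx hG
  have hr := (he.formA_eq hx).1
  obtain ⟨⟨u0, u1, u2, u3⟩, v0, v1, v2, v3⟩ := he.christoffel_special hJ hx
  simp only [formP, formQ, u0, u1, u2, u3, v0, v1, v2, v3, d2, d3] at p1 p2 p3 p4 p5 p6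
  refine ⟨?_, ?_, ?_, ?_, ?_, ?_⟩ <;> refine mul_left_cancel₀ hr ?_ <;> linarith

variable (hG : ∀ x, SecondGrayAt (J x) (curvatureTensor x))
include hG

theorem frameDeriv_dOneForm_special {x : M} (hx : x ∈ U) (k : Fin 4) {η : Fin 4 → M → ℝ}
    {i j m : Fin 4} {c d : ℝ}
    (h : ∀ y ∈ U, dOneForm e η i j y
      = c * (formA e 0 y * formB e m y) + d * (formA e 0 y * formA e 0 y)) :
    frameDeriv e k (dOneForm e η i j) x
      = c * (formA e 0 x * frameDeriv e k (formB e m) x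
          + formB e m x * frameDeriv e k (formA e 0) x)
        + 2 * d * formA e 0 x * frameDeriv e k (formA e 0) x := by
  rw [he.frameDeriv_congr k h hx,
    he.frameDeriv_quadratic k c d (he.smoothOn_formA 0) (he.smoothOn_formB m) hx]

/-- These are the four components of d(dA) = 0. Derivatives of B enter only through dB, which the
structure equation replaces by curvature; the reduced connection coefficients cancel the rest. -/
theorem second_order_formA {x : M} (hx : x ∈ U) :
    formA e 0 x * (frameDeriv e 0 (formA e 0) x
      - (curvatureCoeff e 0 2 0 1 x + curvatureCoeff e 0 2 2 3 x)) = 0 ∧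
    formA e 0 x * (frameDeriv e 1 (formA e 0) x
      + (curvatureCoeff e 0 3 0 1 x + curvatureCoeff e 0 3 2 3 x)) = 0 ∧
    formA e 0 x * frameDeriv e 2 (formA e 0) x = 0 ∧
    formA e 0 x * (frameDeriv e 3 (formA e 0) x + (formA e 0 x ^ 2 / 2
      + (curvatureCoeff e 2 3 0 1 x + curvatureCoeff e 2 3 2 3 x))) = 0 := by
  have D := fun i j k => he.d_dOneForm he.smoothOn_formA i j k hx
  have F := fun y (hy : y ∈ U) => (he.dOneForm_special hJ hy (hG y)).1
  have F01 := fun y hy => (F y hy).1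
  have F02 := fun y hy => (F y hy).2.1
  have F03 := fun y hy => (F y hy).2.2.1
  have F12 := fun y hy => (F y hy).2.2.2.1
  have F13 := fun y hy => (F y hy).2.2.2.2.1
  have F23 := fun y hy => (F y hy).2.2.2.2.2
  have sw : ∀ k i j, frameDeriv e k (dOneForm e (formA e) i j) x
      = -frameDeriv e k (dOneForm e (formA e) j i) x := fun k i j => by
    rw [← he.frameDeriv_neg k (he.smoothOn_dOneForm he.smoothOn_formA j i) hx]
    exact he.frameDeriv_congr k (fun y _ => dOneForm_swap e _ i j y) hx
  have D1 := D 0 1 2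
  have D2 := D 0 1 3
  have D3 := D 0 2 3
  have D4 := D 1 2 3
  rw [sw 1 2 0] at D1; rw [sw 1 3 0] at D2; rw [sw 2 3 0] at D3; rw [sw 2 3 1] at D4
  have S := fun i j => dOneForm_swap e (formA e) i j x
  simp only [he.frameDeriv_dOneForm_special hJ hG hx _ F01,
    he.frameDeriv_dOneForm_special hJ hG hx _ F02, he.frameDeriv_dOneForm_special hJ hG hx _ F03,
    he.frameDeriv_dOneForm_special hJ hG hx _ F12, he.frameDeriv_dOneForm_special hJ hG hx _ F13,
    he.frameDeriv_dOneForm_special hJ hG hx _ F23, Fin.sum_univ_four, dOneForm_self, S 1 0, S 2 0,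
    S 3 0, S 2 1, S 3 1, S 3 2, F01 x hx, F02 x hx, F03 x hx, F12 x hx, F13 x hx, F23 x hx]
    at D1 D2 D3 D4
  have B := fun i j => he.dOneForm_formB i j hx
  have B02 := B 0 2; have B03 := B 0 3; have B23 := B 2 3
  obtain ⟨-, a1, a2, a3⟩ := he.formA_eq hx
  obtain ⟨b0, b1, b2, b3⟩ := he.formA'_eq hJ hx
  obtain ⟨d, s1, s2, s3, s4, s5, s6⟩ := he.christoffel_normalize hx
  obtain ⟨⟨u0, u1, u2, u3⟩, v0, v1, v2, v3⟩ := he.christoffel_special hJ hx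
  obtain ⟨w1, w2, w3, w4, w5, w6⟩ := he.christoffel_reduced hJ hx (hG x)
  obtain ⟨-, r1, r0, r3, r2, -⟩ := he.first_order hJ hx (hG x)
  have hb : ∀ i, formB e i x = christoffel e i 0 1 x + christoffel e i 2 3 x := fun i => rfl
  simp only [dOneForm, bracketCoeff, Fin.sum_univ_four, hb, d, s1, s2, s3, s4, s5, s6, u0, u1, u2,
    u3, v0, v1, v2, v3, a2, a3, b0, b2, b3, w1, w2, w3, w4, w5, w6, r0, r1, r2, r3]
    at B02 B03 B23 D1 D2 D3 D4
  simp only [r0, r1, r2, r3]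
  refine ⟨?_, ?_, ?_, ?_⟩
  · linear_combination D1 - formA e 0 x * B02
  · linear_combination -D2 + formA e 0 x * B03
  · linear_combination -D3
  · linear_combination D4 + formA e 0 x * B23

/-- The counterpart d(dA') = 0. It evaluates the same derivatives of r with different curvature
terms, which makes a comparison with `second_order_formA` possible. -/
theorem second_order_formA' {x : M} (hx : x ∈ U) :
    formA e 0 x * (frameDeriv e 1 (formA e 0) x
      + (curvatureCoeff e 1 2 0 1 x + curvatureCoeff e 1 2 2 3 x)) = 0 ∧
    formA e 0 x * (frameDeriv e 0 (formA e 0) x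
      + (curvatureCoeff e 1 3 0 1 x + curvatureCoeff e 1 3 2 3 x)) = 0 ∧
    formA e 0 x * (frameDeriv e 3 (formA e 0) x - (formA e 0 x ^ 2 / 2
      + (curvatureCoeff e 2 3 0 1 x + curvatureCoeff e 2 3 2 3 x))) = 0 ∧
    formA e 0 x * frameDeriv e 2 (formA e 0) x = 0 := by
  have D := fun i j k => he.d_dOneForm he.smoothOn_formA' i j k hx
  have F := fun y (hy : y ∈ U) => (he.dOneForm_special hJ hy (hG y)).2
  have F01 := fun y hy => (F y hy).1
  have F02 := fun y hy => (F y hy).2.1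
  have F03 := fun y hy => (F y hy).2.2.1
  have F12 := fun y hy => (F y hy).2.2.2.1
  have F13 := fun y hy => (F y hy).2.2.2.2.1
  have F23 := fun y hy => (F y hy).2.2.2.2.2
  have sw : ∀ k i j, frameDeriv e k (dOneForm e (formA' e) i j) x
      = -frameDeriv e k (dOneForm e (formA' e) j i) x := fun k i j => by
    rw [← he.frameDeriv_neg k (he.smoothOn_dOneForm he.smoothOn_formA' j i) hx]
    exact he.frameDeriv_congr k (fun y _ => dOneForm_swap e _ i j y) hx
  have D1 := D 0 1 2
  have D2 := D 0 1 3
  have D3 := D 0 2 3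
  have D4 := D 1 2 3
  rw [sw 1 2 0] at D1; rw [sw 1 3 0] at D2; rw [sw 2 3 0] at D3; rw [sw 2 3 1] at D4
  have S := fun i j => dOneForm_swap e (formA' e) i j x
  simp only [he.frameDeriv_dOneForm_special hJ hG hx _ F01,
    he.frameDeriv_dOneForm_special hJ hG hx _ F02, he.frameDeriv_dOneForm_special hJ hG hx _ F03,
    he.frameDeriv_dOneForm_special hJ hG hx _ F12, he.frameDeriv_dOneForm_special hJ hG hx _ F13,
    he.frameDeriv_dOneForm_special hJ hG hx _ F23, Fin.sum_univ_four, dOneForm_self, S 1 0, S 2 0,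
    S 3 0, S 2 1, S 3 1, S 3 2, F01 x hx, F02 x hx, F03 x hx, F12 x hx, F13 x hx, F23 x hx]
    at D1 D2 D3 D4
  have B := fun i j => he.dOneForm_formB i j hx
  have B12 := B 1 2; have B13 := B 1 3; have B23 := B 2 3
  obtain ⟨-, a1, a2, a3⟩ := he.formA_eq hx
  obtain ⟨b0, b1, b2, b3⟩ := he.formA'_eq hJ hx
  obtain ⟨d, s1, s2, s3, s4, s5, s6⟩ := he.christoffel_normalize hx
  obtain ⟨⟨u0, u1, u2, u3⟩, v0, v1, v2, v3⟩ := he.christoffel_special hJ hx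
  obtain ⟨w1, w2, w3, w4, w5, w6⟩ := he.christoffel_reduced hJ hx (hG x)
  obtain ⟨-, r1, r0, r3, r2, -⟩ := he.first_order hJ hx (hG x)
  have hb : ∀ i, formB e i x = christoffel e i 0 1 x + christoffel e i 2 3 x := fun i => rfl
  simp only [dOneForm, bracketCoeff, Fin.sum_univ_four, hb, d, s1, s2, s3, s4, s5, s6, u0, u1, u2,
    u3, v0, v1, v2, v3, a1, a2, a3, b1, b2, b3, w1, w2, w3, w4, w5, w6, r0, r1, r2, r3]
    at B12 B13 B23 D1 D2 D3 D4
  simp only [r0, r1, r2, r3]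
  refine ⟨?_, ?_, ?_, ?_⟩
  · linear_combination D1 + formA e 0 x * B12
  · linear_combination D2 + formA e 0 x * B13
  · linear_combination -D3 - formA e 0 x * B23
  · linear_combination -D4

/-- The length of `∇J` has vanishing derivative, and so does part of the curvature. -/
theorem frameDeriv_formA_zero {x : M} (hx : x ∈ U) :
    (∀ i, frameDeriv e i (formA e 0) x = 0) ∧
    curvatureCoeff e 2 3 0 1 x + curvatureCoeff e 2 3 2 3 x = -(formA e 0 x) ^ 2 / 2 := by
  have hr := (he.formA_eq hx).1
  have g := he.grayRelations hJ hx (hG x)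
  obtain ⟨p1, p2, p3, p4⟩ := he.second_order_formA hJ hG hx
  obtain ⟨q1, q2, q3, -⟩ := he.second_order_formA' hJ hG hx
  have q1' := (mul_eq_zero.1 q1).resolve_left hr
  have q2' := (mul_eq_zero.1 q2).resolve_left hr
  have q3' := (mul_eq_zero.1 q3).resolve_left hr
  have p1' := (mul_eq_zero.1 p1).resolve_left hr
  have p2' := (mul_eq_zero.1 p2).resolve_left hr
  have p3' := (mul_eq_zero.1 p3).resolve_left hr
  have p4' := (mul_eq_zero.1 p4).resolve_left hr
  -- The two equations give e_0 r = K_0201 + K_0223 and e_0 r = -(K_1301 + K_1323), and these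
  -- curvature sums agree by the Gray condition; so e_0 r = 0. In the e_1 direction, e_1 r =
  -- -(K_0301 + K_0323) = -(K_1201 + K_1223), where the Gray condition makes the two right sides
  -- opposite. For e_3 r they are ∓(r²/2 + K_2301 + K_2323), so both e_3 r and this sum vanish.
  have g1 := g.g0201; have g2 := g.g0223; have g3 := g.g0301; have g4 := g.g0323
  refine ⟨fun i => ?_, by linarith⟩
  fin_cases i
  · change frameDeriv e 0 (formA e 0) x = 0; linarith
  · change frameDeriv e 1 (formA e 0) x = 0; linarith
  · exact p3'
  · change frameDeriv e 3 (formA e 0) x = 0; linarith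

/-- The anti-self-dual connection forms in a special frame. -/
theorem antiSelfDual_forms {x : M} (hx : x ∈ U) :
    (∀ i, formBbar e i x = -3 * formB e i x) ∧ formP e 0 x = 0 ∧ formP e 1 x = 0 ∧
      formQ e 0 x = 0 ∧ formQ e 1 x = 0 ∧ formP e 2 x = formQ e 3 x ∧
      formP e 3 x = -formQ e 2 x := by
  have hr := (he.formA_eq hx).1
  have h := (he.frameDeriv_formA_zero hJ hG hx).1
  obtain ⟨-, r1, r0, r3, r2, p1, p2, p3, p4, p5, p6⟩ := he.first_order hJ hx (hG x)
  rw [h] at r0 r1 r2 r3 p1 p2 p3 p4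
  have c : ∀ {t : ℝ}, formA e 0 x * t = 0 → t = 0 := fun h => (mul_eq_zero.1 h).resolve_left hr
  -- As dr = 0 and r ≠ 0, the form 2 ω_01 + ω_23 vanishes in every direction. So ω_23 = -2 ω_01,
  -- giving B = -ω_01 and B̄ = 3 ω_01: this is the factor -3.
  have r0' := c (r1.symm)
  have r1' := c (t := 2 * christoffel e 1 0 1 x + christoffel e 1 2 3 x) (by linarith)
  have r2' := c (r3.symm)
  have r3' := c (t := 2 * christoffel e 3 0 1 x + christoffel e 3 2 3 x) (by linarith)
  refine ⟨fun i => ?_, c (by linarith), c (by linarith), c (by linarith), c (by linarith),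
    by linarith [c p5], by linarith [c p6]⟩
  simp only [formBbar, formB]
  fin_cases i <;> simp <;> linarith

/-- The mixed curvature components on `Λ²D` and `Λ²Dᗮ` vanish in a special frame. -/
theorem curvatureCoeff_mixed {x : M} (hx : x ∈ U) :
    (curvatureCoeff e 0 2 0 1 x = 0 ∧ curvatureCoeff e 0 2 2 3 x = 0) ∧
    (curvatureCoeff e 0 3 0 1 x = 0 ∧ curvatureCoeff e 0 3 2 3 x = 0) ∧
    (curvatureCoeff e 1 2 0 1 x = 0 ∧ curvatureCoeff e 1 2 2 3 x = 0) ∧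
    (curvatureCoeff e 1 3 0 1 x = 0 ∧ curvatureCoeff e 1 3 2 3 x = 0) := by
  have hr := (he.formA_eq hx).1
  have h := (he.frameDeriv_formA_zero hJ hG hx).1
  have g := he.grayRelations hJ hx (hG x)
  obtain ⟨p1, p2, -, -⟩ := he.second_order_formA hJ hG hx
  obtain ⟨q1, q2, -, -⟩ := he.second_order_formA' hJ hG hx
  rw [h] at p1 p2 q1 q2
  have q1' := (mul_eq_zero.1 q1).resolve_left hr
  have q2' := (mul_eq_zero.1 q2).resolve_left hr
  have p1' := (mul_eq_zero.1 p1).resolve_left hr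
  have p2' := (mul_eq_zero.1 p2).resolve_left hr
  -- The relation B̄ = -3B holds on all of U, so it may be differentiated.
  have hd : ∀ i j, dOneForm e (formBbar e) i j x = -3 * dOneForm e (formB e) i j x := by
    intro i j
    have hc : CMDiff[U] ∞ (fun _ : M => (-3 : ℝ)) := contMDiffOn_const
    have hm : ∀ k m, frameDeriv e k (fun y => -3 * formB e m y) x
        = -3 * frameDeriv e k (formB e m) x := fun k m => by
      have := he.frameDeriv_mul k hc (he.smoothOn_formB m) hx
      rw [frameDeriv_const, mul_zero, add_zero] at this
      exact this
    rw [he.dOneForm_congr (θ := fun m y => -3 * formB e m y)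
      (fun y hy m => (he.antiSelfDual_forms hJ hG hy).1 m) i j hx, dOneForm, dOneForm, hm, hm,
      mul_sub, mul_sub, Finset.mul_sum]
    refine congrArg₂ _ rfl (Finset.sum_congr rfl fun m _ => by ring)
  obtain ⟨-, P0, P1, Q0, Q1, -, -⟩ := he.antiSelfDual_forms hJ hG hx
  obtain ⟨-, a1, a2, a3⟩ := he.formA_eq hx
  obtain ⟨b0, b1, b2, b3⟩ := he.formA'_eq hJ hx
  have d02 := hd 0 2; have d03 := hd 0 3; have d12 := hd 1 2; have d13 := hd 1 3
  rw [he.dOneForm_formB _ _ hx, he.dOneForm_formBbar _ _ hx] at d02 d03 d12 d13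
  rw [P0, Q0, a2, b2] at d02
  rw [P0, Q0, a3, b3] at d03
  rw [P1, Q1, a2, b2] at d12
  rw [P1, Q1, a3, b3] at d13
  -- For i in {0, 1} and j in {2, 3} the quadratic terms are gone, so K_ij01 - K_ij23 = -3 (K_ij01 +
  -- K_ij23). The sum on the right is zero by the second-order relations with dr = 0; hence both
  -- components vanish.
  refine ⟨⟨?_, ?_⟩, ⟨?_, ?_⟩, ⟨?_, ?_⟩, ?_, ?_⟩ <;> linarith

end IsSpecialFrame

end SecondOrder

/-! ### Constancy of |∇J| and global existence of special frames -/

section Global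

variable {E : Type*} [NormedAddCommGroup E] [NormedSpace ℝ E]
  {H : Type*} [TopologicalSpace H] {I : ModelWithCorners ℝ E H}
  {M : Type*} [TopologicalSpace M] [ChartedSpace H M] [IsManifold I ∞ M]

/-- A function with vanishing derivative near `x` is constant near `x`. -/
theorem eventually_eq_of_mvfderiv_eq_zero [I.Boundaryless] {U : Set M} (hU : IsOpen U) {f : M → ℝ}
    (hf : ∀ y ∈ U, MDiffAt f y) (hd : ∀ y ∈ U, d% f y = 0) {x : M} (hx : x ∈ U) :
    ∀ᶠ y in 𝓝 x, f y = f x := by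
  -- Without boundary the chart target is open, so it contains a ball around the image of x, where
  -- convexity turns a zero derivative into constancy.
  have hV : IsOpen ((extChartAt I x).target ∩ (extChartAt I x).symm ⁻¹' U) :=
    (continuousOn_extChartAt_symm x).isOpen_inter_preimage (isOpen_extChartAt_target x) hU
  have hxV : extChartAt I x x ∈ (extChartAt I x).target ∩ (extChartAt I x).symm ⁻¹' U :=
    ⟨mem_extChartAt_target x, by rwa [Set.mem_preimage, extChartAt_to_inv]⟩
  obtain ⟨ε, hε, hball⟩ := Metric.isOpen_iff.1 hV _ hxV
  have hg : ∀ z ∈ Metric.ball (extChartAt I x x) ε,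
      HasFDerivAt (f ∘ (extChartAt I x).symm) (0 : E →L[ℝ] ℝ) z := by
    intro z hz
    have hzV := hball hz
    have h1 : MDifferentiableAt 𝓘(ℝ, E) I (extChartAt I x).symm z :=
      ((contMDiffOn_extChartAt_symm (n := ∞) x).contMDiffAt
        ((isOpen_extChartAt_target x).mem_nhds hzV.1)).mdifferentiableAt (by simp)
    have h2 := (hf _ hzV.2).hasMFDerivAt
    have h3 : mfderiv I 𝓘(ℝ, ℝ) f ((extChartAt I x).symm z) = 0 := hd _ hzV.2
    rw [h3] at h2
    have h4 := h2.comp z h1.hasMFDerivAt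
    rw [ContinuousLinearMap.zero_comp] at h4
    exact h4.hasFDerivAt
  have hc : ∀ z ∈ Metric.ball (extChartAt I x x) ε,
      (f ∘ (extChartAt I x).symm) z = (f ∘ (extChartAt I x).symm) (extChartAt I x x) := by
    intro z hz
    refine (convex_ball (extChartAt I x x) ε).is_const_of_fderivWithin_eq_zero (𝕜 := ℝ)
      (fun w hw => (hg w hw).differentiableAt.differentiableWithinAt) (fun w hw => ?_) hz
      (Metric.mem_ball_self hε)
    rw [fderivWithin_of_isOpen Metric.isOpen_ball hw, (hg w hw).fderiv]
  have hn : ∀ᶠ y in 𝓝 x, extChartAt I x y ∈ Metric.ball (extChartAt I x x) ε :=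
    (continuousAt_extChartAt x).eventually (Metric.ball_mem_nhds _ hε)
  filter_upwards [hn, extChartAt_source_mem_nhds (I := I) x] with y hy hys
  have := hc _ hy
  rwa [Function.comp_apply, Function.comp_apply, extChartAt_to_inv,
    (extChartAt I x).left_inv hys] at this

variable [FiniteDimensional ℝ E] [RiemannianBundle (fun x : M => TangentSpace I x)]
  [IsContMDiffRiemannianBundle I ∞ E (fun x : M => TangentSpace I x)]

/-- The squared norm of `∇J`. -/
def torsionNormSq (J : Π x : M, TangentSpace I x →L[ℝ] TangentSpace I x) (x : M) : ℝ :=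
  ∑ i, ∑ j, ‖covDerivEnd J x (stdOrthonormalBasis ℝ (TangentSpace I x) j)
    (stdOrthonormalBasis ℝ (TangentSpace I x) i)‖ ^ 2

variable {J : Π x : M, TangentSpace I x →L[ℝ] TangentSpace I x}

theorem torsionNormSq_ne_zero {x : M} (h : torsionNormSq J x ≠ 0) :
    ∃ v u : TangentSpace I x, covDerivEnd J x v u ≠ 0 := by
  by_contra! hc
  refine h ?_
  simp [torsionNormSq, hc]

namespace IsAdaptedFrame

variable {U : Set M} {e : Fin 4 → Π x : M, TangentSpace I x} (he : IsAdaptedFrame J U e)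
  (hJ : IsAlmostKahler J)
include he hJ

/-- The two anti-invariant forms in `inner_covDerivEnd_eq`, seen as endomorphisms, send v to
orthogonal vectors of length |v|; Pythagoras gives the formula. -/
theorem normSq_covDerivEnd {x : M} (hx : x ∈ U) (u v : TangentSpace I x) :
    ‖covDerivEnd J x v u‖ ^ 2 = ((inner ℝ (torsionField e x) u : ℝ) ^ 2
      + (inner ℝ (J x (torsionField e x)) u : ℝ) ^ 2) * ‖v‖ ^ 2 := by
  have h := he.inner_covDerivEnd_eq hJ hx u v
  rw [← real_inner_self_eq_norm_sq, ← real_inner_self_eq_norm_sq, he.inner_eq_sum hx,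
    he.inner_eq_sum hx v v]
  simp only [← real_inner_comm (e _ x) (covDerivEnd J x v u), h, Fin.sum_univ_four,
    he.inner_eq x hx]
  simp
  ring

/-- Summing over v gives a factor 4, and |W|² + |JW|² = 2 |W|² gives the other factor 2. -/
theorem torsionNormSq_eq (hE : Module.finrank ℝ E = 4) {x : M} (hx : x ∈ U) :
    torsionNormSq J x = 8 * ∑ i, formA e i x ^ 2 := by
  have hfr : Module.finrank ℝ (TangentSpace I x) = 4 := hE
  have hp : ∀ w : TangentSpace I x,
      ∑ i, (inner ℝ w (stdOrthonormalBasis ℝ (TangentSpace I x) i) : ℝ) ^ 2 = ‖w‖ ^ 2 := fun w => by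
    have := (stdOrthonormalBasis ℝ (TangentSpace I x)).sum_sq_norm_inner_left w
    simpa using this
  have hW : ‖torsionField e x‖ ^ 2 = ∑ i, formA e i x ^ 2 := by
    rw [← real_inner_self_eq_norm_sq, he.inner_eq_sum hx]
    refine Finset.sum_congr rfl fun i _ => ?_
    rw [torsionField, he.inner_sum_frame hx, he.covDerivCoeff_zero_two hx, formA, sq]
  have hJW : ‖J x (torsionField e x)‖ ^ 2 = ‖torsionField e x‖ ^ 2 := by
    rw [← real_inner_self_eq_norm_sq, hJ.orthogonal, real_inner_self_eq_norm_sq]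
  simp only [torsionNormSq, he.normSq_covDerivEnd hJ hx, OrthonormalBasis.norm_eq_one, one_pow,
    mul_one, Finset.sum_const, Finset.card_univ, Fintype.card_fin, hfr, ← Finset.smul_sum,
    Finset.sum_add_distrib, hp, hJW, hW]
  simp
  ring

end IsAdaptedFrame

/-- The basis in the definition is chosen pointwise without continuity; the formula in an adapted
frame supplies the smoothness. -/
theorem contMDiff_torsionNormSq (hJ : IsAlmostKahler J) (hE : Module.finrank ℝ E = 4) :
    ContMDiff I 𝓘(ℝ, ℝ) ∞ (torsionNormSq J) := by
  intro x
  obtain ⟨U, e, hx, he⟩ := exists_adaptedFrame hJ hE x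
  have h : CMDiff[U] ∞ (fun y => 8 * ∑ i, formA e i y ^ 2) :=
    contMDiffOn_const.mul (he.smoothOn_finsum fun i => (he.smoothOn_formA i).pow 2)
  exact (h.congr fun y hy => he.torsionNormSq_eq hJ hE hy).contMDiffAt (he.isOpen.mem_nhds hx)

/-- A parallel orthogonal almost complex structure is integrable. -/
theorem isIntegrable_of_parallel (hJ : IsAlmostKahler J)
    (h : ∀ (x : M) (v u : TangentSpace I x), covDerivEnd J x v u = 0) : IsIntegrable J := by
  intro x X Y hX hY
  have hX' : MDiffAt (T% X) x := hX.mdifferentiableAt (by simp)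
  have hY' : MDiffAt (T% Y) x := hY.mdifferentiableAt (by simp)
  have c : ∀ Z W : Π x : M, TangentSpace I x, MDiffAt (T% W) x →
      nabla Z (fun y => J y (W y)) x = J x (nabla Z W x) := fun Z W hW => by
    have := covDerivEnd_apply hJ.smooth Z hW
    rw [h] at this
    exact (sub_eq_zero.1 this.symm)
  have hJX := mdiffAt_apply hJ.smooth hX'
  have hJY := mdiffAt_apply hJ.smooth hY'
  rw [nijenhuis, ← nabla_sub_nabla hJX hJY, ← nabla_sub_nabla hX' hY', ← nabla_sub_nabla hJX hY',
    ← nabla_sub_nabla hX' hJY, c _ _ hX', c _ _ hX', c _ _ hY', c _ _ hY', map_sub, map_sub,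
    hJ.sq, hJ.sq]
  abel

/-- On a connected non-Kähler manifold with the second Gray condition, `∇J` vanishes nowhere, so
that special frames exist near every point. -/
theorem exists_specialFrame_of_not_isKahler [I.Boundaryless] [PreconnectedSpace M]
    (hE : Module.finrank ℝ E = 4) (hJ : IsAlmostKahler J) (hK : ¬ IsKahler J)
    (hG : ∀ x, SecondGrayAt (J x) (curvatureTensor x)) (x : M) :
    ∃ V : Set M, ∃ f : Fin 4 → Π x : M, TangentSpace I x, x ∈ V ∧ IsSpecialFrame J V f := by
  have hsp : ∀ y, torsionNormSq J y ≠ 0 →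
      ∃ V : Set M, ∃ f : Fin 4 → Π x : M, TangentSpace I x, y ∈ V ∧ IsSpecialFrame J V f := by
    intro y hy
    obtain ⟨U, e, hyU, he⟩ := exists_adaptedFrame hJ hE y
    exact he.exists_specialFrame hJ hE hyU (torsionNormSq_ne_zero hy)
  refine hsp x ?_
  -- In a special frame the function is 8r² with dr = 0. Being defined without reference to the
  -- frame, it can be compared between different frames.
  have hloc : ∀ y, torsionNormSq J y ≠ 0 → ∀ᶠ z in 𝓝 y, torsionNormSq J z = torsionNormSq J y := by
    intro y hy
    obtain ⟨V, f, hyV, hf⟩ := hsp y hy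
    have hN : ∀ z ∈ V, torsionNormSq J z = 8 * (formA f 0 z * formA f 0 z) := fun z hz => by
      obtain ⟨-, a1, a2, a3⟩ := hf.formA_eq hz
      rw [hf.torsionNormSq_eq hJ hE hz, Fin.sum_univ_four, a1, a2, a3]
      ring
    refine eventually_eq_of_mvfderiv_eq_zero hf.isOpen
      (fun z _ => (contMDiff_torsionNormSq hJ hE z).mdifferentiableAt (by simp))
      (fun z hz => ?_) hyV
    have hr := (hf.frameDeriv_formA_zero hJ hG hz).1
    have h0 : ∀ i, d% (torsionNormSq J) z (f i z) = 0 := fun i => by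
      have h1 := hf.frameDeriv_congr i hN hz
      have h2 := hf.frameDeriv_mul i (f := fun _ => (8 : ℝ)) contMDiffOn_const
        ((hf.smoothOn_formA 0).mul (hf.smoothOn_formA 0)) hz
      have h3 := hf.frameDeriv_mul i (hf.smoothOn_formA 0) (hf.smoothOn_formA 0) hz
      rw [hr, mul_zero, add_zero] at h3
      rw [frameDeriv_const, mul_zero, add_zero] at h2
      refine h1.trans (h2.trans ?_)
      refine (congrArg (8 * ·) h3).trans (mul_zero _)
    ext v
    rw [hf.expand z hz v]
    simp [h0]
  -- Otherwise J would be parallel, hence integrable, and the structure Kähler.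
  obtain ⟨y, hy⟩ : ∃ y, torsionNormSq J y ≠ 0 := by
    by_contra! hc
    refine hK ⟨hJ, isIntegrable_of_parallel hJ fun y v u => ?_⟩
    obtain ⟨U, e, hyU, he⟩ := exists_adaptedFrame hJ hE y
    have h8 := he.torsionNormSq_eq hJ hE hyU
    rw [hc, eq_comm, mul_eq_zero, Finset.sum_eq_zero_iff_of_nonneg fun i _ => sq_nonneg _] at h8
    have ha : ∀ i, formA e i y = 0 := fun i => by
      have := h8.resolve_left (by norm_num) i (Finset.mem_univ i)
      exact pow_eq_zero_iff (two_ne_zero) |>.1 this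
    have hW : torsionField e y = 0 := by
      rw [torsionField]
      refine Finset.sum_eq_zero fun i _ => ?_
      rw [he.covDerivCoeff_zero_two hyU]
      exact (congrArg (· • e i y) (ha i)).trans (zero_smul _ _)
    have := he.normSq_covDerivEnd hJ hyU u v
    rw [hW, map_zero, inner_zero_left] at this
    simpa using this
  -- A level set at a nonzero value is closed by continuity and open by local constancy, so
  -- connectedness makes it all of M.
  have hclopen : IsClopen {z | torsionNormSq J z = torsionNormSq J y} := by
    refine ⟨isClosed_eq (contMDiff_torsionNormSq hJ hE).continuous continuous_const,
      isOpen_iff_mem_nhds.2 fun z hz => ?_⟩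
    have hz' : torsionNormSq J z = torsionNormSq J y := hz
    filter_upwards [hloc z (by rwa [hz'])] with w hw
    exact hw.trans hz'
  have hu := hclopen.eq_univ ⟨y, rfl⟩
  have : torsionNormSq J x = torsionNormSq J y := hu.ge (Set.mem_univ x)
  rwa [this]

end Global

/-! ### Bilinear forms and independence of traces from the basis -/

section PointwiseForms

variable {V : Type*} [NormedAddCommGroup V] [InnerProductSpace ℝ V]

/-- Bilinearity of a function of two vectors. -/
structure IsBilinear (f : V → V → ℝ) : Prop where
  add_left : ∀ u u' v, f (u + u') v = f u v + f u' v
  smul_left : ∀ (c : ℝ) u v, f (c • u) v = c * f u v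
  add_right : ∀ u v v', f u (v + v') = f u v + f u v'
  smul_right : ∀ (c : ℝ) u v, f u (c • v) = c * f u v

/-- Linearity of a function of four vectors in each of them. -/
structure IsQuadrilinear (T : V → V → V → V → ℝ) : Prop where
  left : ∀ z t, IsBilinear (fun x y => T x y z t)
  right : ∀ x y, IsBilinear (T x y)

namespace IsBilinear

variable {f g : V → V → ℝ} (hf : IsBilinear f)
include hf

theorem sum_left {ι : Type*} (s : Finset ι) (c : ι → ℝ) (u : ι → V) (v : V) :
    f (∑ i ∈ s, c i • u i) v = ∑ i ∈ s, c i * f (u i) v := by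
  classical
  induction s using Finset.induction_on with
  | empty => simpa using hf.smul_left 0 0 v
  | insert a s ha ih => rw [Finset.sum_insert ha, hf.add_left, hf.smul_left, ih,
      Finset.sum_insert ha]

theorem sum_right {ι : Type*} (s : Finset ι) (c : ι → ℝ) (u : V) (v : ι → V) :
    f u (∑ i ∈ s, c i • v i) = ∑ i ∈ s, c i * f u (v i) := by
  classical
  induction s using Finset.induction_on with
  | empty => simpa using hf.smul_right 0 u 0
  | insert a s ha ih => rw [Finset.sum_insert ha, hf.add_right, hf.smul_right, ih,
      Finset.sum_insert ha]

theorem neg_right (u v : V) : f u (-v) = -f u v := by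
  simpa using hf.smul_right (-1) u v

theorem expand {ι : Type*} [Fintype ι] (b : OrthonormalBasis ι ℝ V) (u v : V) :
    f u v = ∑ i, ∑ j, (inner ℝ (b i) u : ℝ) * inner ℝ (b j) v * f (b i) (b j) := by
  conv_lhs => rw [← b.sum_repr' u, ← b.sum_repr' v, hf.sum_left]
  refine Finset.sum_congr rfl fun i _ => ?_
  rw [hf.sum_right, Finset.mul_sum]
  exact Finset.sum_congr rfl fun j _ => by ring

theorem ext (hg : IsBilinear g) {ι : Type*} [Fintype ι] (b : OrthonormalBasis ι ℝ V)
    (h : ∀ i j, f (b i) (b j) = g (b i) (b j)) : f = g := by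
  funext u v
  rw [hf.expand b, hg.expand b]
  simp only [h]

theorem add (hg : IsBilinear g) : IsBilinear (f + g) := by
  constructor <;> intros <;>
    simp only [Pi.add_apply, hf.add_left, hf.smul_left, hf.add_right, hf.smul_right, hg.add_left,
      hg.smul_left, hg.add_right, hg.smul_right] <;> ring

theorem sub (hg : IsBilinear g) : IsBilinear (f - g) := by
  constructor <;> intros <;>
    simp only [Pi.sub_apply, hf.add_left, hf.smul_left, hf.add_right, hf.smul_right, hg.add_left,
      hg.smul_left, hg.add_right, hg.smul_right] <;> ring

theorem smul (c : ℝ) : IsBilinear (c • f) := by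
  constructor <;> intros <;>
    simp only [Pi.smul_apply, smul_eq_mul, hf.add_left, hf.smul_left, hf.add_right,
      hf.smul_right] <;> ring

theorem comp (A : V →L[ℝ] V) : IsBilinear (fun u v => f (A u) (A v)) := by
  constructor <;> intros <;>
    simp only [map_add, map_smul, hf.add_left, hf.smul_left, hf.add_right, hf.smul_right]

/-- The trace of a bilinear form does not depend on the orthonormal basis. -/
theorem trace_eq {ι κ : Type*} [Fintype ι] [Fintype κ] (s : OrthonormalBasis κ ℝ V)
    (b : OrthonormalBasis ι ℝ V) : ∑ a, f (s a) (s a) = ∑ i, f (b i) (b i) := by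
  classical
  have h : ∀ i j,
      ∑ a, (inner ℝ (b i) (s a) : ℝ) * inner ℝ (b j) (s a) = if i = j then 1 else 0 := by
    intro i j
    rw [← orthonormal_iff_ite.1 b.orthonormal i j, ← s.sum_inner_mul_inner (b i) (b j)]
    exact Finset.sum_congr rfl fun a _ => by rw [real_inner_comm (s a) (b j)]
  simp_rw [hf.expand b (s _) (s _)]
  rw [Finset.sum_comm]
  refine Finset.sum_congr rfl fun i _ => ?_
  rw [Finset.sum_comm]
  simp_rw [← Finset.sum_mul, h]
  simp

theorem mul_const_left (hg : IsBilinear g) (a : V) : IsBilinear (fun u v => f a u * g a v) := by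
  constructor <;> intros <;>
    simp only [hf.add_right, hf.smul_right, hg.add_right, hg.smul_right] <;> ring

theorem mul_const_right (hg : IsBilinear g) (a : V) : IsBilinear (fun u v => f u a * g v a) := by
  constructor <;> intros <;>
    simp only [hf.add_left, hf.smul_left, hg.add_left, hg.smul_left] <;> ring

/-- The basis is changed in one slot at a time. This lets contractions defined with
`stdOrthonormalBasis` be computed in an adapted basis. -/
theorem doubleTrace_eq (hg : IsBilinear g) {ι κ : Type*} [Fintype ι] [Fintype κ]
    (s : OrthonormalBasis κ ℝ V) (b : OrthonormalBasis ι ℝ V) :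
    ∑ a, ∑ c, f (s a) (s c) * g (s a) (s c) = ∑ i, ∑ j, f (b i) (b j) * g (b i) (b j) := by
  simp_rw [fun a => (hf.mul_const_left hg (s a)).trace_eq s b]
  rw [Finset.sum_comm]
  simp_rw [fun j => (hf.mul_const_right hg (b j)).trace_eq s b]
  rw [Finset.sum_comm]

end IsBilinear

theorem isBilinear_zero : IsBilinear (0 : V → V → ℝ) := by
  constructor <;> intros <;> simp

theorem isBilinear_inner : IsBilinear (fun u v : V => (inner ℝ u v : ℝ)) := by
  constructor <;> intros <;> simp [inner_add_left, inner_add_right, inner_smul_left,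
    inner_smul_right]

theorem isBilinear_finsum {ι : Type*} [Fintype ι] {f : ι → V → V → ℝ}
    (hf : ∀ i, IsBilinear (f i)) : IsBilinear (fun u v => ∑ i, f i u v) := by
  constructor <;> intros <;>
    simp only [(hf _).add_left, (hf _).smul_left, (hf _).add_right, (hf _).smul_right,
      Finset.sum_add_distrib, Finset.mul_sum]

theorem isBilinear_fundForm (J : V →L[ℝ] V) : IsBilinear (fundForm J) := by
  constructor <;> intros <;> simp [fundForm, inner_add_left, inner_add_right, inner_smul_left,
    inner_smul_right]

theorem isQuadrilinear_volForm (J : V →L[ℝ] V) : IsQuadrilinear (volForm J) := by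
  have h := isBilinear_fundForm J
  constructor <;> intros <;> constructor <;> intros <;>
    simp only [volForm, h.add_left, h.smul_left, h.add_right, h.smul_right] <;> ring

variable [FiniteDimensional ℝ V] {R : V → V → V → V → ℝ} {φ ψ : V → V → ℝ}

theorem IsQuadrilinear.ricciOf (hR : IsQuadrilinear R) : IsBilinear (ricciOf R) := by
  constructor <;> intros <;>
    simp only [AKFour.ricciOf, (hR.left _ _).add_right, (hR.left _ _).smul_right,
      (hR.right _ _).add_right, (hR.right _ _).smul_right, Finset.sum_add_distrib, Finset.mul_sum]

theorem IsQuadrilinear.normalizedRicciOf (hR : IsQuadrilinear R) :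
    IsBilinear (normalizedRicciOf R) := by
  have h := hR.ricciOf
  have hi := isBilinear_inner (V := V)
  constructor <;> intros <;>
    simp only [AKFour.normalizedRicciOf, h.add_left, h.smul_left, h.add_right, h.smul_right,
      hi.add_left, hi.smul_left, hi.add_right, hi.smul_right] <;> ring

theorem IsQuadrilinear.weylOf (hR : IsQuadrilinear R) : IsQuadrilinear (weylOf R) := by
  have h := hR.normalizedRicciOf
  have hi := isBilinear_inner (V := V)
  constructor <;> intros <;> constructor <;> intros <;>
    simp only [AKFour.weylOf, (hR.left _ _).add_left, (hR.left _ _).smul_left,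
      (hR.left _ _).add_right, (hR.left _ _).smul_right, (hR.right _ _).add_left,
      (hR.right _ _).smul_left, (hR.right _ _).add_right, (hR.right _ _).smul_right,
      h.add_left, h.smul_left, h.add_right, h.smul_right,
      hi.add_left, hi.smul_left, hi.add_right, hi.smul_right] <;> ring

theorem IsQuadrilinear.curvatureOp (hR : IsQuadrilinear R) (φ : V → V → ℝ) :
    IsBilinear (curvatureOp R φ) := by
  have h := (isBilinear_finsum fun i => isBilinear_finsum fun j =>
    (hR.right (stdOrthonormalBasis ℝ V i) (stdOrthonormalBasis ℝ V j)).smul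
      (φ (stdOrthonormalBasis ℝ V i) (stdOrthonormalBasis ℝ V j))).smul (1 / 2)
  exact h

theorem IsBilinear.projAnti (hφ : IsBilinear φ) (J : V →L[ℝ] V) : IsBilinear (projAnti J φ) := by
  have h := (hφ.sub (hφ.comp J)).smul (1 / 2)
  convert h using 1
  funext u v
  simp [AKFour.projAnti]
  ring

section Components

variable (b : OrthonormalBasis (Fin 4) ℝ V)

theorem IsQuadrilinear.ricciOf_eq (hR : IsQuadrilinear R) (u v : V) :
    AKFour.ricciOf R u v = ∑ i, R (b i) u (b i) v := by
  refine IsBilinear.trace_eq (f := fun x y => R x u y v) ?_ _ b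
  constructor <;> intros
  · exact (hR.left _ _).add_left _ _ _
  · exact (hR.left _ _).smul_left _ _ _
  · exact (hR.right _ _).add_left _ _ _
  · exact (hR.right _ _).smul_left _ _ _

theorem IsQuadrilinear.curvatureOp_eq (hR : IsQuadrilinear R) (hφ : IsBilinear φ) (z t : V) :
    AKFour.curvatureOp R φ z t = 1 / 2 * ∑ i, ∑ j, φ (b i) (b j) * R (b i) (b j) z t := by
  rw [AKFour.curvatureOp, hφ.doubleTrace_eq (hR.left z t) _ b]

theorem IsBilinear.formInner_eq (hφ : IsBilinear φ) (hψ : IsBilinear ψ) :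
    formInner φ ψ = 1 / 2 * ∑ i, ∑ j, φ (b i) (b j) * ψ (b i) (b j) := by
  rw [formInner, hφ.doubleTrace_eq hψ _ b]

end Components

end PointwiseForms

/-! ### Hodge star, conformal scalar curvature and W^- in an adapted basis -/

section PointwiseStructure

variable {V : Type*} [NormedAddCommGroup V] [InnerProductSpace ℝ V]

/-- A two-form: a skew-symmetric bilinear function. -/
structure IsTwoForm (φ : V → V → ℝ) : Prop extends IsBilinear φ where
  skew : ∀ u v, φ u v = -φ v u

/-- An orthonormal basis with `J b₀ = ε b₁` and `J b₂ = b₃`, where `ε = ±1`. -/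
structure IsAdaptedBasis (ε : ℝ) (b : OrthonormalBasis (Fin 4) ℝ V) (J : V →L[ℝ] V) : Prop where
  map_zero : J (b 0) = ε • b 1
  map_one : J (b 1) = -ε • b 0
  map_two : J (b 2) = b 3
  map_three : J (b 3) = -b 2

namespace IsTwoForm

variable {φ ψ : V → V → ℝ}

theorem self_eq_zero (hφ : IsTwoForm φ) (u : V) : φ u u = 0 := by
  linarith [hφ.skew u u]

theorem ext_basis (hφ : IsTwoForm φ) (hψ : IsTwoForm ψ) (b : OrthonormalBasis (Fin 4) ℝ V)
    (h01 : φ (b 0) (b 1) = ψ (b 0) (b 1)) (h02 : φ (b 0) (b 2) = ψ (b 0) (b 2))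
    (h03 : φ (b 0) (b 3) = ψ (b 0) (b 3)) (h12 : φ (b 1) (b 2) = ψ (b 1) (b 2))
    (h13 : φ (b 1) (b 3) = ψ (b 1) (b 3)) (h23 : φ (b 2) (b 3) = ψ (b 2) (b 3)) : φ = ψ := by
  have s := fun i j => hφ.skew (b i) (b j)
  have t := fun i j => hψ.skew (b i) (b j)
  refine hφ.toIsBilinear.ext hψ.toIsBilinear b fun i j => ?_
  fin_cases i <;> fin_cases j <;> simp [hφ.self_eq_zero, hψ.self_eq_zero, h01, h02, h03, h12, h13,
    h23, s 1 0, s 2 0, s 3 0, s 2 1, s 3 1, s 3 2, t 1 0, t 2 0, t 3 0, t 2 1, t 3 1, t 3 2]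

theorem add (hφ : IsTwoForm φ) (hψ : IsTwoForm ψ) : IsTwoForm (φ + ψ) where
  toIsBilinear := hφ.toIsBilinear.add hψ.toIsBilinear
  skew u v := by simp only [Pi.add_apply, hφ.skew u v, hψ.skew u v]; ring

theorem sub (hφ : IsTwoForm φ) (hψ : IsTwoForm ψ) : IsTwoForm (φ - ψ) where
  toIsBilinear := hφ.toIsBilinear.sub hψ.toIsBilinear
  skew u v := by simp only [Pi.sub_apply, hφ.skew u v, hψ.skew u v]; ring

theorem smul (hφ : IsTwoForm φ) (c : ℝ) : IsTwoForm (c • φ) where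
  toIsBilinear := hφ.toIsBilinear.smul c
  skew u v := by simp only [Pi.smul_apply, smul_eq_mul, hφ.skew u v]; ring

end IsTwoForm

theorem isTwoForm_zero : IsTwoForm (0 : V → V → ℝ) where
  toIsBilinear := isBilinear_zero
  skew := by simp

namespace IsAdaptedBasis

variable {ε : ℝ} {b : OrthonormalBasis (Fin 4) ℝ V} {J : V →L[ℝ] V} (hb : IsAdaptedBasis ε b J)
include hb

theorem fundForm_eq (u v : V) : fundForm J u v =
    ε * ((inner ℝ (b 0) u : ℝ) * inner ℝ (b 1) v - inner ℝ (b 1) u * inner ℝ (b 0) v)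
      + (inner ℝ (b 2) u * inner ℝ (b 3) v - inner ℝ (b 3) u * inner ℝ (b 2) v) := by
  rw [fundForm]
  conv_lhs => rw [← b.sum_repr' u]
  simp only [Fin.sum_univ_four, map_add, map_smul, hb.map_zero, hb.map_one, hb.map_two,
    hb.map_three, inner_add_left, inner_smul_left, inner_neg_left, starRingEnd_apply, star_trivial]
  ring

theorem isTwoForm_fundForm : IsTwoForm (fundForm J) where
  toIsBilinear := isBilinear_fundForm J
  skew u v := by rw [hb.fundForm_eq, hb.fundForm_eq]; ring

theorem fundForm_basis (i j : Fin 4) : fundForm J (b i) (b j) =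
    (![![0, ε, 0, 0], ![-ε, 0, 0, 0], ![0, 0, 0, 1], ![0, 0, -1, 0]] : Fin 4 → Fin 4 → ℝ) i j := by
  rw [hb.fundForm_eq]
  have h := orthonormal_iff_ite.1 b.orthonormal
  simp only [h]
  fin_cases i <;> fin_cases j <;> simp

theorem volForm_eq (u v w z : V) : volForm J u v w z = ε *
    (((inner ℝ (b 0) u : ℝ) * inner ℝ (b 1) v - inner ℝ (b 1) u * inner ℝ (b 0) v)
        * (inner ℝ (b 2) w * inner ℝ (b 3) z - inner ℝ (b 3) w * inner ℝ (b 2) z)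
      + (inner ℝ (b 2) u * inner ℝ (b 3) v - inner ℝ (b 3) u * inner ℝ (b 2) v)
        * (inner ℝ (b 0) w * inner ℝ (b 1) z - inner ℝ (b 1) w * inner ℝ (b 0) z)
      - ((inner ℝ (b 0) u * inner ℝ (b 1) w - inner ℝ (b 1) u * inner ℝ (b 0) w)
        * (inner ℝ (b 2) v * inner ℝ (b 3) z - inner ℝ (b 3) v * inner ℝ (b 2) z)
      + (inner ℝ (b 2) u * inner ℝ (b 3) w - inner ℝ (b 3) u * inner ℝ (b 2) w)
        * (inner ℝ (b 0) v * inner ℝ (b 1) z - inner ℝ (b 1) v * inner ℝ (b 0) z))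
      + ((inner ℝ (b 0) u * inner ℝ (b 1) z - inner ℝ (b 1) u * inner ℝ (b 0) z)
        * (inner ℝ (b 2) v * inner ℝ (b 3) w - inner ℝ (b 3) v * inner ℝ (b 2) w)
      + (inner ℝ (b 2) u * inner ℝ (b 3) z - inner ℝ (b 3) u * inner ℝ (b 2) z)
        * (inner ℝ (b 0) v * inner ℝ (b 1) w - inner ℝ (b 1) v * inner ℝ (b 0) w))) := by
  simp only [volForm, hb.fundForm_eq]
  ring

end IsAdaptedBasis

/-- By `volForm_eq` the sign ε enters ½ Ω ∧ Ω only as an overall factor. -/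
theorem volForm_flip {b : OrthonormalBasis (Fin 4) ℝ V} {J J' : V →L[ℝ] V}
    (hb : IsAdaptedBasis 1 b J) (hb' : IsAdaptedBasis (-1) b J') : volForm J' = -volForm J := by
  funext u v w z
  rw [Pi.neg_apply, Pi.neg_apply, Pi.neg_apply, Pi.neg_apply, hb.volForm_eq,
    hb'.volForm_eq]
  ring

variable [FiniteDimensional ℝ V] {R : V → V → V → V → ℝ} {φ ψ : V → V → ℝ}

theorem IsTwoForm.formInner_eq (hφ : IsTwoForm φ) (hψ : IsTwoForm ψ)
    (b : OrthonormalBasis (Fin 4) ℝ V) :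
    formInner φ ψ = φ (b 0) (b 1) * ψ (b 0) (b 1) + φ (b 0) (b 2) * ψ (b 0) (b 2)
      + φ (b 0) (b 3) * ψ (b 0) (b 3) + φ (b 1) (b 2) * ψ (b 1) (b 2)
      + φ (b 1) (b 3) * ψ (b 1) (b 3) + φ (b 2) (b 3) * ψ (b 2) (b 3) := by
  have s := fun i j => hφ.skew (b i) (b j)
  have t := fun i j => hψ.skew (b i) (b j)
  rw [hφ.toIsBilinear.formInner_eq b hψ.toIsBilinear]
  simp only [Fin.sum_univ_four, hφ.self_eq_zero, s 1 0, s 2 0, s 3 0, s 2 1, s 3 1, s 3 2, t 1 0,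
    t 2 0, t 3 0, t 2 1, t 3 1, t 3 2]
  ring

/-- Curvature-like tensors: four-linear functions, skew in the first and in the last two
arguments. -/
structure IsCurvatureLike (R : V → V → V → V → ℝ) : Prop extends IsQuadrilinear R where
  skew_left : ∀ u v w z, R u v w z = -R v u w z
  skew_right : ∀ u v w z, R u v w z = -R u v z w

theorem isCurvatureLike_volForm {ε : ℝ} {b : OrthonormalBasis (Fin 4) ℝ V} {J : V →L[ℝ] V}
    (hb : IsAdaptedBasis ε b J) : IsCurvatureLike (volForm J) where
  toIsQuadrilinear := isQuadrilinear_volForm J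
  skew_left u v w z := by
    have s := hb.isTwoForm_fundForm.skew
    rw [volForm, volForm, s v u]; ring
  skew_right u v w z := by
    have s := hb.isTwoForm_fundForm.skew
    rw [volForm, volForm, s z w]; ring

namespace IsCurvatureLike

variable (hR : IsCurvatureLike R)
include hR

theorem weylOf : IsCurvatureLike (weylOf R) where
  toIsQuadrilinear := hR.toIsQuadrilinear.weylOf
  skew_left u v w z := by rw [AKFour.weylOf, AKFour.weylOf, hR.skew_left u v w z]; ring
  skew_right u v w z := by rw [AKFour.weylOf, AKFour.weylOf, hR.skew_right u v w z]; ring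

theorem isTwoForm_curvatureOp (φ : V → V → ℝ) : IsTwoForm (curvatureOp R φ) where
  toIsBilinear := hR.curvatureOp φ
  skew z t := by
    simp only [curvatureOp, hR.skew_right _ _ z t, mul_neg, Finset.sum_neg_distrib]

theorem curvatureOp_basis (hφ : IsTwoForm φ) (b : OrthonormalBasis (Fin 4) ℝ V) (z t : V) :
    curvatureOp R φ z t = φ (b 0) (b 1) * R (b 0) (b 1) z t + φ (b 0) (b 2) * R (b 0) (b 2) z t
      + φ (b 0) (b 3) * R (b 0) (b 3) z t + φ (b 1) (b 2) * R (b 1) (b 2) z t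
      + φ (b 1) (b 3) * R (b 1) (b 3) z t + φ (b 2) (b 3) * R (b 2) (b 3) z t := by
  have s := fun i j => hφ.skew (b i) (b j)
  have r := fun i j => hR.skew_left (b i) (b j) z t
  rw [hR.curvatureOp_eq b hφ.toIsBilinear]
  simp only [Fin.sum_univ_four, hφ.self_eq_zero, s 1 0, s 2 0, s 3 0, s 2 1, s 3 1, s 3 2, r 1 0,
    r 2 0, r 3 0, r 2 1, r 3 1, r 3 2]
  ring

end IsCurvatureLike

namespace IsAdaptedBasis

variable {b : OrthonormalBasis (Fin 4) ℝ V} {J J' : V →L[ℝ] V} (hb : IsAdaptedBasis 1 b J)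
include hb

/-- The Hodge star is by definition the curvature operator of the volume form, regarded as a
curvature-like tensor. -/
theorem isTwoForm_hodgeStar (φ : V → V → ℝ) : IsTwoForm (hodgeStar (volForm J) φ) :=
  (isCurvatureLike_volForm hb).isTwoForm_curvatureOp φ

theorem hodgeStar_basis (hφ : IsTwoForm φ) :
    hodgeStar (volForm J) φ (b 0) (b 1) = φ (b 2) (b 3) ∧
    hodgeStar (volForm J) φ (b 0) (b 2) = -φ (b 1) (b 3) ∧
    hodgeStar (volForm J) φ (b 0) (b 3) = φ (b 1) (b 2) ∧
    hodgeStar (volForm J) φ (b 1) (b 2) = φ (b 0) (b 3) ∧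
    hodgeStar (volForm J) φ (b 1) (b 3) = -φ (b 0) (b 2) ∧
    hodgeStar (volForm J) φ (b 2) (b 3) = φ (b 0) (b 1) := by
  have h : hodgeStar (volForm J) φ = curvatureOp (volForm J) φ := rfl
  rw [h]
  simp only [(isCurvatureLike_volForm hb).curvatureOp_basis hφ b, volForm, hb.fundForm_basis]
  simp

theorem isTwoForm_selfDualPart (hφ : IsTwoForm φ) : IsTwoForm (selfDualPart (volForm J) φ) :=
  (hφ.add (hb.isTwoForm_hodgeStar φ)).smul _

theorem isTwoForm_antiSelfDualPart (hφ : IsTwoForm φ) :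
    IsTwoForm (antiSelfDualPart (volForm J) φ) :=
  (hφ.sub (hb.isTwoForm_hodgeStar φ)).smul _

theorem selfDualPart_basis (hφ : IsTwoForm φ) :
    selfDualPart (volForm J) φ (b 0) (b 1) = (φ (b 0) (b 1) + φ (b 2) (b 3)) / 2 ∧
    selfDualPart (volForm J) φ (b 0) (b 2) = (φ (b 0) (b 2) - φ (b 1) (b 3)) / 2 ∧
    selfDualPart (volForm J) φ (b 0) (b 3) = (φ (b 0) (b 3) + φ (b 1) (b 2)) / 2 ∧
    selfDualPart (volForm J) φ (b 1) (b 2) = (φ (b 0) (b 3) + φ (b 1) (b 2)) / 2 ∧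
    selfDualPart (volForm J) φ (b 1) (b 3) = -(φ (b 0) (b 2) - φ (b 1) (b 3)) / 2 ∧
    selfDualPart (volForm J) φ (b 2) (b 3) = (φ (b 0) (b 1) + φ (b 2) (b 3)) / 2 := by
  obtain ⟨h1, h2, h3, h4, h5, h6⟩ := hb.hodgeStar_basis hφ
  simp only [selfDualPart, Pi.smul_apply, Pi.add_apply, smul_eq_mul, h1, h2, h3, h4, h5, h6]
  refine ⟨?_, ?_, ?_, ?_, ?_, ?_⟩ <;> ring

theorem antiSelfDualPart_basis (hφ : IsTwoForm φ) :
    antiSelfDualPart (volForm J) φ (b 0) (b 1) = (φ (b 0) (b 1) - φ (b 2) (b 3)) / 2 ∧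
    antiSelfDualPart (volForm J) φ (b 0) (b 2) = (φ (b 0) (b 2) + φ (b 1) (b 3)) / 2 ∧
    antiSelfDualPart (volForm J) φ (b 0) (b 3) = (φ (b 0) (b 3) - φ (b 1) (b 2)) / 2 ∧
    antiSelfDualPart (volForm J) φ (b 1) (b 2) = -(φ (b 0) (b 3) - φ (b 1) (b 2)) / 2 ∧
    antiSelfDualPart (volForm J) φ (b 1) (b 3) = (φ (b 0) (b 2) + φ (b 1) (b 3)) / 2 ∧
    antiSelfDualPart (volForm J) φ (b 2) (b 3) = -(φ (b 0) (b 1) - φ (b 2) (b 3)) / 2 := by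
  obtain ⟨h1, h2, h3, h4, h5, h6⟩ := hb.hodgeStar_basis hφ
  simp only [antiSelfDualPart, Pi.smul_apply, Pi.sub_apply, smul_eq_mul, h1, h2, h3, h4, h5, h6]
  refine ⟨?_, ?_, ?_, ?_, ?_, ?_⟩ <;> ring

/-- Ω = e^01 + e^23 is self-dual for its own orientation, so the projections in W^+ drop out and κ =
3 ⟨W(Ω), Ω⟩. -/
theorem conformalScalar_eq (hR : IsCurvatureLike R) :
    conformalScalar J R = 3 * (weylOf R (b 0) (b 1) (b 0) (b 1) + weylOf R (b 0) (b 1) (b 2) (b 3)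
      + weylOf R (b 2) (b 3) (b 0) (b 1) + weylOf R (b 2) (b 3) (b 2) (b 3)) := by
  have hΩ := hb.isTwoForm_fundForm
  have h1 := hb.isTwoForm_selfDualPart hΩ
  have h2 := hR.weylOf.isTwoForm_curvatureOp (selfDualPart (volForm J) (fundForm J))
  have h3 := hb.isTwoForm_selfDualPart h2
  obtain ⟨a1, a2, a3, a4, a5, a6⟩ := hb.selfDualPart_basis hΩ
  obtain ⟨c1, c2, c3, c4, c5, c6⟩ := hb.selfDualPart_basis h2
  rw [conformalScalar, weylPlus, h3.formInner_eq hΩ b, c1, c2, c3, c4, c5, c6]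
  simp only [hR.weylOf.curvatureOp_basis h1 b, a1, a2, a3, a4, a5, a6, hb.fundForm_basis]
  simp
  ring

theorem isTwoForm_weylMinus (hR : IsCurvatureLike R) (φ : V → V → ℝ) :
    IsTwoForm (weylMinus (volForm J) R φ) :=
  hb.isTwoForm_antiSelfDualPart (hR.weylOf.isTwoForm_curvatureOp _)

omit hb in
theorem isTwoForm_projFund (hb' : IsAdaptedBasis (-1) b J') (φ : V → V → ℝ) :
    IsTwoForm (projFund J' φ) :=
  hb'.isTwoForm_fundForm.smul _

omit hb in
theorem _root_.AKFour.IsTwoForm.projAnti (hφ : IsTwoForm φ) (J' : V →L[ℝ] V) :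
    IsTwoForm (projAnti J' φ) where
  toIsBilinear := hφ.toIsBilinear.projAnti J'
  skew u v := by rw [AKFour.projAnti, AKFour.projAnti, hφ.skew u v, hφ.skew (J' u)]; ring

omit hb in
theorem projAnti_basis (hb' : IsAdaptedBasis (-1) b J') (hφ : IsTwoForm φ) :
    projAnti J' φ (b 0) (b 1) = 0 ∧
    projAnti J' φ (b 0) (b 2) = (φ (b 0) (b 2) + φ (b 1) (b 3)) / 2 ∧
    projAnti J' φ (b 0) (b 3) = (φ (b 0) (b 3) - φ (b 1) (b 2)) / 2 ∧
    projAnti J' φ (b 1) (b 2) = -(φ (b 0) (b 3) - φ (b 1) (b 2)) / 2 ∧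
    projAnti J' φ (b 1) (b 3) = (φ (b 0) (b 2) + φ (b 1) (b 3)) / 2 ∧
    projAnti J' φ (b 2) (b 3) = 0 := by
  simp only [projAnti, hb'.map_zero, hb'.map_one, hb'.map_two, hb'.map_three, hφ.smul_left,
    hφ.smul_right, hφ.toIsBilinear.neg_right, hφ.skew (b 1) (b 0),
    hφ.skew (b 3) (b 2)]
  refine ⟨?_, ?_, ?_, ?_, ?_, ?_⟩ <;> ring

/-- `W^-` has no component exchanging `ℝ Ω̄` and its complement when the mixed components of the
Weyl tensor vanish. -/
theorem componentTwo_weylMinus (hb' : IsAdaptedBasis (-1) b J') (hR : IsCurvatureLike R)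
    (hφ : IsTwoForm φ)
    (hW : ∀ i ∈ ({0, 1} : Finset (Fin 4)), ∀ j ∈ ({2, 3} : Finset (Fin 4)),
      weylOf R (b 0) (b 1) (b i) (b j) = 0 ∧ weylOf R (b 2) (b 3) (b i) (b j) = 0 ∧
      weylOf R (b i) (b j) (b 0) (b 1) = 0 ∧ weylOf R (b i) (b j) (b 2) (b 3) = 0) :
    componentTwo J' (weylMinus (volForm J) R) φ = 0 := by
  have hW02 := hW 0 (by simp) 2 (by simp)
  have hW03 := hW 0 (by simp) 3 (by simp)
  have hW12 := hW 1 (by simp) 2 (by simp)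
  have hW13 := hW 1 (by simp) 3 (by simp)
  have key : ∀ ζ : V → V → ℝ, IsTwoForm ζ → _ := fun ζ hζ => hb.antiSelfDualPart_basis
    (hR.weylOf.isTwoForm_curvatureOp (antiSelfDualPart (volForm J) ζ))
  have asd : ∀ ζ : V → V → ℝ, IsTwoForm ζ → _ := fun ζ hζ => hb.antiSelfDualPart_basis hζ
  -- Ω̄ = -e^01 + e^23 lives on the planes 01 and 23, while J̄-anti-invariant forms live on the
  -- mixed planes. Each off-diagonal block of W^- therefore involves only the Weyl components
  -- assumed to vanish.
  have h1 : projAnti J' (weylMinus (volForm J) R (projFund J' φ)) = 0 := by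
    have t1 := isTwoForm_projFund hb' φ
    have t2 := hb.isTwoForm_antiSelfDualPart t1
    have t3 := hb.isTwoForm_weylMinus hR (projFund J' φ)
    obtain ⟨p1, p2, p3, p4, p5, p6⟩ := asd _ t1
    obtain ⟨k1, k2, k3, k4, k5, k6⟩ := key _ t1
    obtain ⟨q1, q2, q3, q4, q5, q6⟩ := projAnti_basis hb' t3
    refine (t3.projAnti J').ext_basis isTwoForm_zero b ?_ ?_ ?_ ?_ ?_ ?_
    · exact q1
    · rw [q2, weylMinus, k2, k5]
      simp only [hR.weylOf.curvatureOp_basis t2 b, p1, p2, p3, p4, p5, p6]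
      simp [projFund, hb'.fundForm_basis, hW02, hW13]
    · rw [q3, weylMinus, k3, k4]
      simp only [hR.weylOf.curvatureOp_basis t2 b, p1, p2, p3, p4, p5, p6]
      simp [projFund, hb'.fundForm_basis, hW03, hW12]
    · rw [q4, weylMinus, k3, k4]
      simp only [hR.weylOf.curvatureOp_basis t2 b, p1, p2, p3, p4, p5, p6]
      simp [projFund, hb'.fundForm_basis, hW03, hW12]
    · rw [q5, weylMinus, k2, k5]
      simp only [hR.weylOf.curvatureOp_basis t2 b, p1, p2, p3, p4, p5, p6]
      simp [projFund, hb'.fundForm_basis, hW02, hW13]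
    · exact q6
  have h2 : projFund J' (weylMinus (volForm J) R (projAnti J' φ)) = 0 := by
    have t1 := hφ.projAnti J'
    have t2 := hb.isTwoForm_antiSelfDualPart t1
    have t3 := hb.isTwoForm_weylMinus hR (projAnti J' φ)
    obtain ⟨p1, p2, p3, p4, p5, p6⟩ := asd _ t1
    obtain ⟨k1, k2, k3, k4, k5, k6⟩ := key _ t1
    obtain ⟨q1, q2, q3, q4, q5, q6⟩ := projAnti_basis hb' hφ
    have hz : formInner (weylMinus (volForm J) R (projAnti J' φ)) (fundForm J') = 0 := by
      rw [t3.formInner_eq hb'.isTwoForm_fundForm b, weylMinus, k1, k6]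
      simp [hR.weylOf.curvatureOp_basis t2 b, p1, p2, p3, p4, p5, p6, q1, q6, hb'.fundForm_basis,
        hW02, hW03, hW12, hW13]
    rw [projFund, hz]
    simp
  rw [componentTwo, h1, h2, add_zero]

end IsAdaptedBasis

end PointwiseStructure

/-! ### Ricci and Weyl curvature from the special relations -/

section PointwiseCurvature

variable {V : Type*} [NormedAddCommGroup V] [InnerProductSpace ℝ V]

/-- The relations between the curvature components in a special frame: the second Gray condition,
the vanishing of the mixed components, and one relation between the sectional components. -/
structure SpecialRelations (K : Fin 4 → Fin 4 → Fin 4 → Fin 4 → ℝ) : Prop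
    extends GrayRelations K where
  m0201 : K 0 2 0 1 = 0
  m0223 : K 0 2 2 3 = 0
  m0301 : K 0 3 0 1 = 0
  m0323 : K 0 3 2 3 = 0
  m1201 : K 1 2 0 1 = 0
  m1223 : K 1 2 2 3 = 0
  m1301 : K 1 3 0 1 = 0
  m1323 : K 1 3 2 3 = 0
  trace : K 2 3 0 1 + K 2 3 2 3 = K 0 2 0 2 - K 0 2 1 3

theorem GrayRelations.normalize {K : Fin 4 → Fin 4 → Fin 4 → Fin 4 → ℝ} (g : GrayRelations K) :
    (∀ i k l, K i i k l = 0) ∧ (∀ i k l, K k l i i = 0) ∧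
    (∀ k l, K 1 0 k l = -K 0 1 k l) ∧ (∀ k l, K 2 0 k l = -K 0 2 k l) ∧
    (∀ k l, K 3 0 k l = -K 0 3 k l) ∧ (∀ k l, K 2 1 k l = -K 1 2 k l) ∧
    (∀ k l, K 3 1 k l = -K 1 3 k l) ∧ (∀ k l, K 3 2 k l = -K 2 3 k l) ∧
    (∀ k l, K k l 1 0 = -K k l 0 1) ∧ (∀ k l, K k l 2 0 = -K k l 0 2) ∧
    (∀ k l, K k l 3 0 = -K k l 0 3) ∧ (∀ k l, K k l 2 1 = -K k l 1 2) ∧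
    (∀ k l, K k l 3 1 = -K k l 1 3) ∧ (∀ k l, K k l 3 2 = -K k l 2 3) :=
  ⟨fun i k l => by linarith [g.skew_left i i k l], fun i k l => by linarith [g.skew_right k l i i],
    g.skew_left _ _, g.skew_left _ _, g.skew_left _ _, g.skew_left _ _, g.skew_left _ _,
    g.skew_left _ _, fun k l => g.skew_right k l _ _, fun k l => g.skew_right k l _ _,
    fun k l => g.skew_right k l _ _, fun k l => g.skew_right k l _ _,
    fun k l => g.skew_right k l _ _, fun k l => g.skew_right k l _ _⟩

/-- Off-diagonal terms between the two planes are mixed components; within a plane they cancel by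
the Gray condition, which also equates the two diagonal entries. -/
theorem SpecialRelations.ricci {K : Fin 4 → Fin 4 → Fin 4 → Fin 4 → ℝ} (g : SpecialRelations K)
    (k l : Fin 4) : ∑ i, K i k i l =
      (![![K 0 1 0 1 + K 0 2 0 2 + K 0 3 0 3, 0, 0, 0],
        ![0, K 0 1 0 1 + K 0 2 0 2 + K 0 3 0 3, 0, 0],
        ![0, 0, K 0 2 0 2 + K 0 3 0 3 + K 2 3 2 3, 0],
        ![0, 0, 0, K 0 2 0 2 + K 0 3 0 3 + K 2 3 2 3]] : Fin 4 → Fin 4 → ℝ) k l := by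
  obtain ⟨d, d', s1, s2, s3, s4, s5, s6, t1, t2, t3, t4, t5, t6⟩ := g.normalize
  have p := g.pair
  have := g.g0203; have := g.g0212; have := g.g1312; have := g.g0202; have := g.g0303
  have := g.m0201; have := g.m0223; have := g.m0301; have := g.m0323; have := g.m1201
  have := g.m1223; have := g.m1301; have := g.m1323
  fin_cases k <;> fin_cases l <;>
    simp [Fin.sum_univ_four, d, d', s1, s2, s3, s4, s5, s6, t1, t2, t3, t4, t5, t6] <;>
    linarith [p 0 1 0 2, p 0 1 0 3, p 0 1 1 2, p 0 1 1 3, p 0 1 2 3, p 0 2 0 3, p 0 2 1 2,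
      p 0 2 1 3, p 0 2 2 3, p 0 3 1 2, p 0 3 1 3, p 0 3 2 3, p 1 2 1 3, p 1 2 2 3, p 1 3 2 3]

theorem GrayRelations.bianchi {K : Fin 4 → Fin 4 → Fin 4 → Fin 4 → ℝ} (g : GrayRelations K) :
    K 0 1 2 3 = K 0 2 0 2 + K 0 3 0 3 - 2 * (K 0 2 0 2 - K 0 2 1 3) := by
  linarith [g.cyclic 0 1 2 3, g.g0213, g.pair 0 3 1 2, g.skew_left 2 0 1 3]

section Projection

variable [FiniteDimensional ℝ V] {D : Submodule ℝ V} {b : OrthonormalBasis (Fin 4) ℝ V}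
  (hD : ∀ u, u ∈ D ↔ (inner ℝ (b 0) u : ℝ) = 0 ∧ (inner ℝ (b 1) u : ℝ) = 0)
include hD

theorem starProjection_eq (u : V) :
    D.starProjection u = (inner ℝ (b 2) u : ℝ) • b 2 + (inner ℝ (b 3) u : ℝ) • b 3 := by
  have h := orthonormal_iff_ite.1 b.orthonormal
  refine Submodule.eq_starProjection_of_mem_of_inner_eq_zero ?_ fun w hw => ?_
  · rw [hD]
    simp [inner_add_right, inner_smul_right, h]
  · obtain ⟨h0, h1⟩ := (hD w).1 hw
    rw [inner_sub_left, ← b.sum_inner_mul_inner u w]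
    simp [inner_add_left, inner_smul_left, h0, h1, Fin.sum_univ_four, real_inner_comm u]

theorem starProjection_orthogonal_eq (u : V) :
    Dᗮ.starProjection u = (inner ℝ (b 0) u : ℝ) • b 0 + (inner ℝ (b 1) u : ℝ) • b 1 := by
  rw [Submodule.starProjection_orthogonal_val, starProjection_eq hD]
  conv_lhs => enter [1]; rw [← b.sum_repr' u, Fin.sum_univ_four]
  abel

theorem restrictedMetric_eq (u v : V) : restrictedMetric D u v =
    inner ℝ (b 2) u * inner ℝ (b 2) v + inner ℝ (b 3) u * inner ℝ (b 3) v := by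
  have h := orthonormal_iff_ite.1 b.orthonormal
  rw [restrictedMetric, starProjection_eq hD, starProjection_eq hD]
  simp [inner_add_left, inner_add_right, inner_smul_left, inner_smul_right, h, mul_comm]

theorem restrictedMetric_orthogonal_eq (u v : V) : restrictedMetric Dᗮ u v =
    inner ℝ (b 0) u * inner ℝ (b 0) v + inner ℝ (b 1) u * inner ℝ (b 1) v := by
  have h := orthonormal_iff_ite.1 b.orthonormal
  rw [restrictedMetric, starProjection_orthogonal_eq hD, starProjection_orthogonal_eq hD]
  simp [inner_add_left, inner_add_right, inner_smul_left, inner_smul_right, h, mul_comm]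

omit [FiniteDimensional ℝ V] in
theorem finrank_eq_two : Module.finrank ℝ D = 2 := by
  have h := orthonormal_iff_ite.1 b.orthonormal
  have hs : D = Submodule.span ℝ (Set.range (b ∘ ![2, 3])) := by
    refine le_antisymm (fun u hu => ?_) (Submodule.span_le.2 ?_)
    · obtain ⟨h0, h1⟩ := (hD u).1 hu
      rw [← b.sum_repr' u, Fin.sum_univ_four, h0, h1, zero_smul, zero_smul, zero_add, zero_add]
      exact add_mem (Submodule.smul_mem _ _ (Submodule.subset_span ⟨0, rfl⟩))
        (Submodule.smul_mem _ _ (Submodule.subset_span ⟨1, rfl⟩))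
    · rintro _ ⟨i, rfl⟩
      rw [SetLike.mem_coe, hD]
      fin_cases i <;> simp [h]
  have hl : LinearIndependent ℝ (b ∘ ![2, 3]) :=
    b.orthonormal.linearIndependent.comp _ (by decide)
  rw [hs, finrank_span_eq_card hl, Fintype.card_fin]

theorem isAdaptedBasis_flipOn {J : V →L[ℝ] V} (hb : IsAdaptedBasis 1 b J) :
    IsAdaptedBasis (-1) b (flipOn D J) := by
  have h := orthonormal_iff_ite.1 b.orthonormal
  constructor <;>
    simp [flipOn, starProjection_eq hD, starProjection_orthogonal_eq hD, h, hb.map_zero, hb.map_one,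
      hb.map_two, hb.map_three, -Submodule.starProjection_orthogonal_val]

end Projection

theorem IsAdaptedBasis.apply_eq {ε : ℝ} {b : OrthonormalBasis (Fin 4) ℝ V} {J : V →L[ℝ] V}
    (hb : IsAdaptedBasis ε b J) (u : V) :
    J u = (ε * inner ℝ (b 0) u) • b 1 - (ε * inner ℝ (b 1) u) • b 0
      + (inner ℝ (b 2) u : ℝ) • b 3 - (inner ℝ (b 3) u : ℝ) • b 2 := by
  conv_lhs => rw [← b.sum_repr' u, Fin.sum_univ_four]
  simp only [map_add, map_smul, hb.map_zero, hb.map_one, hb.map_two, hb.map_three, smul_smul,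
    smul_neg, neg_smul, mul_comm ε]
  abel

theorem IsAdaptedBasis.sq {ε : ℝ} (hε : ε ^ 2 = 1) {b : OrthonormalBasis (Fin 4) ℝ V}
    {J : V →L[ℝ] V} (hb : IsAdaptedBasis ε b J) (u : V) : J (J u) = -u := by
  have h : ε * ε = 1 := by rw [← pow_two, hε]
  conv_rhs => rw [← b.sum_repr' u, Fin.sum_univ_four]
  rw [hb.apply_eq u]
  simp only [map_add, map_sub, map_smul, hb.map_zero, hb.map_one, hb.map_two, hb.map_three,
    smul_smul, smul_neg, neg_smul, mul_right_comm ε, h, one_mul]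
  abel

theorem IsAdaptedBasis.inner_map {ε : ℝ} (hε : ε ^ 2 = 1) {b : OrthonormalBasis (Fin 4) ℝ V}
    {J : V →L[ℝ] V} (hb : IsAdaptedBasis ε b J) (u v : V) :
    (inner ℝ (J u) (J v) : ℝ) = inner ℝ u v := by
  have h := orthonormal_iff_ite.1 b.orthonormal
  rw [← b.sum_inner_mul_inner u v, hb.apply_eq u, hb.apply_eq v]
  simp [inner_add_left, inner_add_right, inner_sub_left, inner_sub_right, inner_smul_left,
    inner_smul_right, h, Fin.sum_univ_four, fun i => real_inner_comm (b i) u]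
  linear_combination ((inner ℝ (b 0) u : ℝ) * inner ℝ (b 0) v + inner ℝ (b 1) u * inner ℝ (b 1) v)
    * hε

variable [FiniteDimensional ℝ V] {R : V → V → V → V → ℝ} {b : OrthonormalBasis (Fin 4) ℝ V}
  (hR : IsCurvatureLike R) (hK : SpecialRelations (fun i j k l => R (b i) (b j) (b k) (b l)))
include hR hK

theorem SpecialRelations.ricciOf_eq (u v : V) : ricciOf R u v =
    (R (b 0) (b 1) (b 0) (b 1) + R (b 0) (b 2) (b 0) (b 2) + R (b 0) (b 3) (b 0) (b 3))
      * (inner ℝ (b 0) u * inner ℝ (b 0) v + inner ℝ (b 1) u * inner ℝ (b 1) v)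
    + (R (b 0) (b 2) (b 0) (b 2) + R (b 0) (b 3) (b 0) (b 3) + R (b 2) (b 3) (b 2) (b 3))
      * (inner ℝ (b 2) u * inner ℝ (b 2) v + inner ℝ (b 3) u * inner ℝ (b 3) v) := by
  have h : ∀ k l, ricciOf R (b k) (b l) = _ := fun k l => (hR.ricciOf_eq b _ _).trans (hK.ricci k l)
  rw [hR.toIsQuadrilinear.ricciOf.expand b]
  simp only [h, Fin.sum_univ_four]
  simp
  ring

theorem SpecialRelations.scalarOf_eq : scalarOf R = 2 * (R (b 0) (b 1) (b 0) (b 1)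
    + 2 * R (b 0) (b 2) (b 0) (b 2) + 2 * R (b 0) (b 3) (b 0) (b 3)
    + R (b 2) (b 3) (b 2) (b 3)) := by
  have h := orthonormal_iff_ite.1 b.orthonormal
  rw [scalarOf, hR.toIsQuadrilinear.ricciOf.trace_eq _ b]
  simp only [hK.ricciOf_eq hR, Fin.sum_univ_four, h]
  simp
  ring

/-- Ric and g are both diagonal in the basis, so the Kulkarni–Nomizu correction has no such
components and W agrees there with R, which vanishes. -/
theorem SpecialRelations.weylOf_mixed : ∀ i ∈ ({0, 1} : Finset (Fin 4)),
    ∀ j ∈ ({2, 3} : Finset (Fin 4)),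
      weylOf R (b 0) (b 1) (b i) (b j) = 0 ∧ weylOf R (b 2) (b 3) (b i) (b j) = 0 ∧
      weylOf R (b i) (b j) (b 0) (b 1) = 0 ∧ weylOf R (b i) (b j) (b 2) (b 3) = 0 := by
  have h := orthonormal_iff_ite.1 b.orthonormal
  have p : ∀ i j k l, R (b i) (b j) (b k) (b l) = R (b k) (b l) (b i) (b j) := hK.pair
  have m1 : R (b 0) (b 2) (b 0) (b 1) = 0 := hK.m0201
  have m2 : R (b 0) (b 2) (b 2) (b 3) = 0 := hK.m0223
  have m3 : R (b 0) (b 3) (b 0) (b 1) = 0 := hK.m0301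
  have m4 : R (b 0) (b 3) (b 2) (b 3) = 0 := hK.m0323
  have m5 : R (b 1) (b 2) (b 0) (b 1) = 0 := hK.m1201
  have m6 : R (b 1) (b 2) (b 2) (b 3) = 0 := hK.m1223
  have m7 : R (b 1) (b 3) (b 0) (b 1) = 0 := hK.m1301
  have m8 : R (b 1) (b 3) (b 2) (b 3) = 0 := hK.m1323
  intro i hi j hj
  simp only [Finset.mem_insert, Finset.mem_singleton] at hi hj
  simp only [weylOf, normalizedRicciOf, hK.ricciOf_eq hR, h]
  rcases hi with rfl | rfl <;> rcases hj with rfl | rfl <;>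
    simp [m1, m2, m3, m4, m5, m6, m7, m8, p 0 1 0 2, p 0 1 0 3, p 0 1 1 2, p 0 1 1 3, p 2 3 0 2,
      p 2 3 0 3, p 2 3 1 2, p 2 3 1 3]

/-- Besides K_0101 and K_2323, the expression for κ contains K_0123 and the trace K_0202 + K_0303.
The Bianchi identity and K_2301 + K_2323 = λ eliminate these and λ. -/
theorem SpecialRelations.conformalScalar_eq {J : V →L[ℝ] V} (hb : IsAdaptedBasis 1 b J) :
    conformalScalar J R =
      2 * (R (b 0) (b 1) (b 0) (b 1) - R (b 2) (b 3) (b 2) (b 3)) := by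
  have h := orthonormal_iff_ite.1 b.orthonormal
  have hB : R (b 0) (b 1) (b 2) (b 3) = R (b 0) (b 2) (b 0) (b 2) + R (b 0) (b 3) (b 0) (b 3)
    - 2 * (R (b 0) (b 2) (b 0) (b 2) - R (b 0) (b 2) (b 1) (b 3)) := hK.bianchi
  have hp : R (b 2) (b 3) (b 0) (b 1) = R (b 0) (b 1) (b 2) (b 3) := hK.pair 2 3 0 1
  have ht : R (b 2) (b 3) (b 0) (b 1) + R (b 2) (b 3) (b 2) (b 3)
    = R (b 0) (b 2) (b 0) (b 2) - R (b 0) (b 2) (b 1) (b 3) := hK.trace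
  rw [hb.conformalScalar_eq hR]
  simp only [weylOf, normalizedRicciOf, hK.ricciOf_eq hR, hK.scalarOf_eq hR, h]
  simp
  linear_combination 2 * hB - hp + 4 * ht

/-- The two Ricci eigenvalues differ by K_0101 - K_2323 = κ/2 and have equal multiplicity, so
removing the trace leaves ±κ/4. -/
theorem SpecialRelations.ricciZeroOf_eq {J : V →L[ℝ] V} (hb : IsAdaptedBasis 1 b J)
    {D : Submodule ℝ V}
    (hD : ∀ u, u ∈ D ↔ (inner ℝ (b 0) u : ℝ) = 0 ∧ (inner ℝ (b 1) u : ℝ) = 0) (u v : V) :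
    ricciZeroOf R u v = conformalScalar J R / 4 *
      (-restrictedMetric D u v + restrictedMetric Dᗮ u v) := by
  rw [ricciZeroOf, hK.conformalScalar_eq hR hb, hK.scalarOf_eq hR, hK.ricciOf_eq hR,
    restrictedMetric_eq hD, restrictedMetric_orthogonal_eq hD, ← b.sum_inner_mul_inner u v]
  simp only [Fin.sum_univ_four, real_inner_comm u]
  ring

/-- Ric is a multiple of the metric on each of the two planes, and J' preserves both planes
isometrically. -/
theorem SpecialRelations.ricciOf_map {J' : V →L[ℝ] V} (hb' : IsAdaptedBasis (-1) b J') (u v : V) :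
    ricciOf R (J' u) (J' v) = ricciOf R u v := by
  have h := orthonormal_iff_ite.1 b.orthonormal
  rw [hK.ricciOf_eq hR, hK.ricciOf_eq hR, hb'.apply_eq u, hb'.apply_eq v]
  simp [inner_add_right, inner_sub_right, inner_smul_right, h]
  ring

end PointwiseCurvature

/-! ### The reversed structure J̄ -/

section ReversedStructure

variable {E : Type*} [NormedAddCommGroup E] [NormedSpace ℝ E]
  {H : Type*} [TopologicalSpace H] {I : ModelWithCorners ℝ E H}
  {M : Type*} [TopologicalSpace M] [ChartedSpace H M] [IsManifold I ∞ M]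
  [FiniteDimensional ℝ E] [RiemannianBundle (fun x : M => TangentSpace I x)]
  [IsContMDiffRiemannianBundle I ∞ E (fun x : M => TangentSpace I x)]

namespace IsOrthonormalFrame

variable {U : Set M} {e : Fin 4 → Π x : M, TangentSpace I x} (he : IsOrthonormalFrame U e)

/-- The orthonormal basis of `T_x M` given by an orthonormal frame. -/
def basis {x : M} (hx : x ∈ U) : OrthonormalBasis (Fin 4) ℝ (TangentSpace I x) :=
  OrthonormalBasis.mk (v := fun i => e i x) (orthonormal_iff_ite.2 (he.inner_eq x hx))
    (fun v _ => by
      rw [he.expand x hx v]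
      exact sum_mem fun i _ => Submodule.smul_mem _ _ (Submodule.subset_span ⟨i, rfl⟩))

theorem basis_apply {x : M} (hx : x ∈ U) (i : Fin 4) : he.basis hx i = e i x := by
  simp [basis]

include he in
theorem isCurvatureLike {x : M} (hx : x ∈ U) : IsCurvatureLike (curvatureTensor (I := I) x) := by
  constructor
  · constructor <;> intros <;> constructor <;> intros <;>
      simp only [he.curvatureTensor_eq_sum hx, inner_add_right, inner_smul_right,
        ← Finset.sum_add_distrib, Finset.mul_sum] <;>
      refine Finset.sum_congr rfl fun i _ => Finset.sum_congr rfl fun j _ =>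
        Finset.sum_congr rfl fun k _ => Finset.sum_congr rfl fun l _ => ?_ <;>
      ring
  · intro u v w z
    rw [he.curvatureTensor_eq_sum hx, he.curvatureTensor_eq_sum hx, Finset.sum_comm]
    simp only [← Finset.sum_neg_distrib]
    refine Finset.sum_congr rfl fun i _ => Finset.sum_congr rfl fun j _ =>
      Finset.sum_congr rfl fun k _ => Finset.sum_congr rfl fun l _ => ?_
    rw [he.curvatureCoeff_skew_left j i k l hx]
    ring
  · intro u v w z
    rw [he.curvatureTensor_eq_sum hx, he.curvatureTensor_eq_sum hx]
    simp only [← Finset.sum_neg_distrib]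
    refine Finset.sum_congr rfl fun i _ => Finset.sum_congr rfl fun j _ => ?_
    rw [Finset.sum_comm]
    refine Finset.sum_congr rfl fun k _ => Finset.sum_congr rfl fun l _ => ?_
    rw [he.curvatureCoeff_skew_right i j l k hx]
    ring

end IsOrthonormalFrame

/-- The matrix of the reversed structure in a special frame. -/
def reversedMatrix : Fin 4 → Fin 4 → ℝ :=
  ![![0, -1, 0, 0], ![1, 0, 0, 0], ![0, 0, 0, 1], ![0, 0, -1, 0]]

/-- Reversing J on the first plane exchanges the roles of the self-dual and anti-self-dual parts:
∇J̄ is carried by P and Q as ∇J is by A and A'. -/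
theorem IsOrthonormalFrame.covDerivCoeff_reversed {U : Set M}
    {e : Fin 4 → Π x : M, TangentSpace I x} (he : IsOrthonormalFrame U e) {x : M} (hx : x ∈ U)
    (i j k : Fin 4) :
    covDerivCoeff e reversedMatrix i j k x =
      (![![0, 0, formP e i x, -formQ e i x], ![0, 0, formQ e i x, formP e i x],
        ![-formP e i x, -formQ e i x, 0, 0],
        ![formQ e i x, -formP e i x, 0, 0]] : Fin 4 → Fin 4 → ℝ) j k := by
  have s := fun j k => he.christoffel_skew i j k hx
  have d := fun j => he.christoffel_self i j hx
  fin_cases j <;> fin_cases k <;>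
    simp [covDerivCoeff, reversedMatrix, Fin.sum_univ_four, d, formP, formQ] <;>
    linarith [s 0 1, s 0 2, s 0 3, s 1 2, s 1 3, s 2 3]

namespace IsSpecialFrame

variable {J : Π x : M, TangentSpace I x →L[ℝ] TangentSpace I x} {U : Set M}
  {e : Fin 4 → Π x : M, TangentSpace I x} (he : IsSpecialFrame J U e)
  (hJ : IsAlmostKahler J)
include hJ

theorem isAdaptedBasis {x : M} (hx : x ∈ U) : IsAdaptedBasis 1 (he.basis hx) (J x) := by
  constructor <;>
    simp [he.basis_apply, he.map_zero x hx, he.map_one hJ hx, he.map_two x hx, he.map_three hJ hx]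

/-- In a special frame W = r e_0 and JW = r e_1 with r ≠ 0. -/
theorem mem_kahlerNullity {x : M} (hx : x ∈ U) (u : TangentSpace I x) :
    u ∈ kahlerNullity J x ↔
      (inner ℝ (he.basis hx 0) u : ℝ) = 0 ∧ (inner ℝ (he.basis hx 1) u : ℝ) = 0 := by
  obtain ⟨hr, a1, a2, a3⟩ := he.formA_eq hx
  have hW : torsionField e x = formA e 0 x • e 0 x := by
    have c := fun i => he.covDerivCoeff_zero_two hx i
    rw [torsionField, Fin.sum_univ_four, c, c, c, c]
    change formA e 0 x • e 0 x + formA e 1 x • e 1 x + formA e 2 x • e 2 x + formA e 3 x • e 3 x = _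
    rw [a1, a2, a3, zero_smul, zero_smul, zero_smul, add_zero, add_zero, add_zero]
  have h := fun v w => he.inner_covDerivEnd_eq hJ hx u v w
  simp only [hW, map_smul, he.map_zero x hx, inner_smul_left, starRingEnd_apply, star_trivial] at h
  rw [he.basis_apply, he.basis_apply]
  change (∀ v, covDerivEnd J x v u = 0) ↔ _
  constructor
  · intro hu
    have h1 := h (e 0 x) (e 2 x)
    have h2 := h (e 0 x) (e 3 x)
    rw [hu, inner_zero_left] at h1 h2
    simp only [he.inner_eq x hx] at h1 h2
    simp [hr] at h1 h2
    exact ⟨h1, h2⟩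
  · rintro ⟨h0, h1⟩ v
    refine ext_inner_right ℝ fun w => ?_
    rw [h, h0, h1, inner_zero_left]
    ring

theorem isAdaptedBasis_reversedStructure {x : M} (hx : x ∈ U) :
    IsAdaptedBasis (-1) (he.basis hx) (reversedStructure J x) :=
  isAdaptedBasis_flipOn (he.mem_kahlerNullity hJ hx) (he.isAdaptedBasis hJ hx)

include he

theorem reversedStructure_frame {x : M} (hx : x ∈ U) (j : Fin 4) :
    reversedStructure J x (e j x) = ∑ m, reversedMatrix j m • e m x := by
  have h := he.isAdaptedBasis_reversedStructure hJ hx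
  have h0 := h.map_zero; have h1 := h.map_one; have h2 := h.map_two; have h3 := h.map_three
  simp only [he.basis_apply] at h0 h1 h2 h3
  fin_cases j <;> simp [reversedMatrix, Fin.sum_univ_four, h0, h1, h2, h3]

/-- The orthogonal projections to the nullity need no separate treatment: J̄ has a constant matrix
in a smooth special frame. -/
theorem contMDiffAt_reversedStructure {x : M} (hx : x ∈ U) :
    ContMDiffAt I (I.prod 𝓘(ℝ, E →L[ℝ] E)) ∞
      (fun x => TotalSpace.mk' (E →L[ℝ] E)
        (E := fun x : M => TangentSpace I x →L[ℝ] TangentSpace I x)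
        x (reversedStructure J x)) x := by
  refine he.contMDiffAt_hom (fun i => ?_) hx
  refine (he.smoothOn_sum (f := fun m _ => reversedMatrix i m) fun m => contMDiffOn_const).congr
    fun y hy => ?_
  rw [he.reversedStructure_frame hJ hy]

variable (hG : ∀ x, SecondGrayAt (J x) (curvatureTensor x))
include hG

-- The trace relation holds because both of its sides equal -r²/2, one by the first-order and the
-- other by the second-order computation.
omit he in
theorem specialRelations (he : IsSpecialFrame J U e) {x : M} (hx : x ∈ U) : SpecialRelations
    (fun i j k l => curvatureTensor x (he.basis hx i) (he.basis hx j) (he.basis hx k)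
      (he.basis hx l)) := by
  obtain ⟨⟨h1, h2⟩, ⟨h3, h4⟩, ⟨h5, h6⟩, h7, h8⟩ := he.curvatureCoeff_mixed hJ hG hx
  have hl := (he.first_order hJ hx (hG x)).1
  have ht := (he.frameDeriv_formA_zero hJ hG hx).2
  simp only [he.basis_apply]
  exact ⟨he.grayRelations hJ hx (hG x), h1, h2, h3, h4, h5, h6, h7, h8, ht.trans hl.symm⟩

/-- P and Q vanish on e_0 and e_1, and u has no other components. -/
theorem covDerivEnd_reversedStructure {x : M} (hx : x ∈ U)
    (hA : ContMDiff I (I.prod 𝓘(ℝ, E →L[ℝ] E)) ∞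
      (fun x => TotalSpace.mk' (E →L[ℝ] E)
        (E := fun x : M => TangentSpace I x →L[ℝ] TangentSpace I x) x (reversedStructure J x)))
    {u : TangentSpace I x} (h2 : (inner ℝ (e 2 x) u : ℝ) = 0) (h3 : (inner ℝ (e 3 x) u : ℝ) = 0)
    (v : TangentSpace I x) : covDerivEnd (reversedStructure J) x v u = 0 := by
  obtain ⟨-, P0, P1, Q0, Q1, -, -⟩ := he.antiSelfDual_forms hJ hG hx
  refine ext_inner_right ℝ fun w => ?_
  rw [he.inner_covDerivEnd hA (fun y hy => he.reversedStructure_frame hJ hy) hx, inner_zero_left]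
  simp only [he.covDerivCoeff_reversed hx, Fin.sum_univ_four]
  simp [h2, h3, P0, P1, Q0, Q1]

/-- The relations P_2 = Q_3 and P_3 = -Q_2, with P and Q zero on e_0 and e_1, make every component
of dΩ̄ cancel. -/
theorem dTwoForm_reversedStructure {x : M} (hx : x ∈ U)
    (hA : ContMDiff I (I.prod 𝓘(ℝ, E →L[ℝ] E)) ∞
      (fun x => TotalSpace.mk' (E →L[ℝ] E)
        (E := fun x : M => TangentSpace I x →L[ℝ] TangentSpace I x) x (reversedStructure J x)))
    {X Y Z : Π x : M, TangentSpace I x} (hX : MDiffAt (T% X) x) (hY : MDiffAt (T% Y) x)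
    (hZ : MDiffAt (T% Z) x) :
    dTwoForm (fun y => fundForm (reversedStructure J y)) X Y Z x = 0 := by
  obtain ⟨-, P0, P1, Q0, Q1, h1, h2⟩ := he.antiSelfDual_forms hJ hG hx
  have hb := he.isAdaptedBasis_reversedStructure hJ hx
  rw [he.dTwoForm_eq_sum hA (fun y hy => he.reversedStructure_frame hJ hy) hx
    (skew_of_orthogonal (hb.sq (by norm_num)) (hb.inner_map (by norm_num))) hX hY hZ]
  simp only [he.covDerivCoeff_reversed hx, Fin.sum_univ_four]
  simp [P0, P1, Q0, Q1, h1, h2]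

end IsSpecialFrame

end ReversedStructure

end AKFour

end

/-! ### The theorem -/

open AKFour in
theorem proposition2 {M : Type*} [TopologicalSpace M] [T2Space M] [ConnectedSpace M]
    [ChartedSpace (EuclideanSpace ℝ (Fin 4)) M] [IsManifold (𝓡 4) ∞ M]
    [RiemannianBundle (fun x : M => TangentSpace (𝓡 4) x)]
    [IsContMDiffRiemannianBundle (𝓡 4) ∞ (EuclideanSpace ℝ (Fin 4))
      (fun x : M => TangentSpace (𝓡 4) x)]
    (J : Π x : M, TangentSpace (𝓡 4) x →L[ℝ] TangentSpace (𝓡 4) x)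
    (hAK : IsAlmostKahler J) (hnonK : ¬ IsKahler J)
    (hG : ∀ x, SecondGrayAt (J x) (curvatureTensor x)) :
    (∀ x, Module.finrank ℝ (kahlerNullity J x) = 2) ∧
    (∀ x u v, ricciZeroOf (curvatureTensor x) u v =
      conformalScalar (J x) (curvatureTensor x) / 4 *
        (-restrictedMetric (kahlerNullity J x) u v
          + restrictedMetric (kahlerNullity J x)ᗮ u v)) ∧
    (∀ x, volForm (reversedStructure J x) = -volForm (J x)) ∧
    IsAlmostKahler (reversedStructure J) ∧
    (∀ x u v, ricciOf (curvatureTensor x) (reversedStructure J x u) (reversedStructure J x v) =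
      ricciOf (curvatureTensor x) u v) ∧
    (∀ x, ∀ φ : LinearMap.BilinForm ℝ (TangentSpace (𝓡 4) x), φ.IsAlt →
      componentTwo (reversedStructure J x) (weylMinus (volForm (J x)) (curvatureTensor x))
        (fun u v => φ u v) = 0) ∧
    (∀ x, (kahlerNullity J x)ᗮ ≤ kahlerNullity (reversedStructure J) x) := by
  have hE : Module.finrank ℝ (EuclideanSpace ℝ (Fin 4)) = 4 := by simp
  have hsp := exists_specialFrame_of_not_isKahler hE hAK hnonK hG
  have hsmooth : ContMDiff (𝓡 4) ((𝓡 4).prod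
      𝓘(ℝ, EuclideanSpace ℝ (Fin 4) →L[ℝ] EuclideanSpace ℝ (Fin 4))) ∞
      (fun x => TotalSpace.mk' (EuclideanSpace ℝ (Fin 4) →L[ℝ] EuclideanSpace ℝ (Fin 4))
        (E := fun x : M => TangentSpace (𝓡 4) x →L[ℝ] TangentSpace (𝓡 4) x) x
        (reversedStructure J x)) := fun x => by
    obtain ⟨U, e, hx, he⟩ := hsp x
    exact he.contMDiffAt_reversedStructure hAK hx
  refine ⟨fun x => ?_, fun x u v => ?_, fun x => ?_, ⟨hsmooth, fun x u => ?_, fun x u v => ?_,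
    fun x X Y Z hX hY hZ => ?_⟩, fun x u v => ?_, fun x φ hφ => ?_, fun x u hu => ?_⟩ <;>
    obtain ⟨U, e, hx, he⟩ := hsp x
  · exact finrank_eq_two (he.mem_kahlerNullity hAK hx)
  · exact (he.specialRelations hAK hG hx).ricciZeroOf_eq (he.isCurvatureLike hx)
      (he.isAdaptedBasis hAK hx) (he.mem_kahlerNullity hAK hx) u v
  · exact volForm_flip (he.isAdaptedBasis hAK hx) (he.isAdaptedBasis_reversedStructure hAK hx)
  · exact (he.isAdaptedBasis_reversedStructure hAK hx).sq (by norm_num) u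
  · exact (he.isAdaptedBasis_reversedStructure hAK hx).inner_map (by norm_num) u v
  · exact he.dTwoForm_reversedStructure hAK hG hx hsmooth (hX.mdifferentiableAt (by simp))
      (hY.mdifferentiableAt (by simp)) (hZ.mdifferentiableAt (by simp))
  · exact (he.specialRelations hAK hG hx).ricciOf_map (he.isCurvatureLike hx)
      (he.isAdaptedBasis_reversedStructure hAK hx) u v
  · refine (he.isAdaptedBasis hAK hx).componentTwo_weylMinus
      (he.isAdaptedBasis_reversedStructure hAK hx) (he.isCurvatureLike hx) ?_
      ((he.specialRelations hAK hG hx).weylOf_mixed (he.isCurvatureLike hx))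
    refine ⟨⟨fun u u' v => by simp, fun c u v => by simp, fun u v v' => by simp,
      fun c u v => by simp⟩, fun u v => ?_⟩
    rw [← hφ.neg_eq v u]
  -- The nullity contains e_2 and e_3, so a vector orthogonal to it has no components along them.
  · have h := he.mem_kahlerNullity hAK hx
    have h2 : e 2 x ∈ kahlerNullity J x := by
      rw [h, he.basis_apply, he.basis_apply, he.inner_eq x hx, he.inner_eq x hx]
      simp
    have h3 : e 3 x ∈ kahlerNullity J x := by
      rw [h, he.basis_apply, he.basis_apply, he.inner_eq x hx, he.inner_eq x hx]
      simp
    exact he.covDerivEnd_reversedStructure hAK hG hx hsmooth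
      ((Submodule.mem_orthogonal _ _).1 hu _ h2) ((Submodule.mem_orthogonal _ _).1 hu _ h3)
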